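/- Notation. Let $\mu=(\mu_1,\mu_2,\mu_3)\in\mathbb{C}^3$ with $\mu_1+\mu_2+\mu_3=0$, $\rho=(1,0,-1)$, $U(\mathbb{R})$ the group of matrices $x=\begin{pmatrix}1&x_2&x_3\\&1&x_1\\&&1\end{pmatrix}$ with $dx=dx_1\,dx_2\,dx_3$, $\psi_{11}(x)=e^{2\pi i(x_1+x_2)}$, and $Y(\mathbb{R})$ the set of matrices $y=\mathrm{diag}(y_1y_2,y_1,1)$ with $y_1,y_2>0$ and $dy=\frac{dy_1\,dy_2}{(y_1y_2)^3}$. The power function is $p_{\mu}(r\,xyk)=y_1^{\mu_1+\mu_2}y_2^{\mu_1}$ ($r>0$ a scalar, $x\in U(\mathbb{R})$, $y\in Y(\mathbb{R})$, $k\in SO(3,\mathbb{R})$). With $w_l=\begin{pmatrix}&&1\\&-1&\\1&&\end{pmatrix}$, the Jacquet-Whittaker function is \[ W(y,\mu,\psi_{11})=\int_{U(\mathbb{R})}p_{\rho+\mu}(w_l u y)\,\psi_{11}(u)\,du \] for $\mathrm{Re}\,\mu_1>\mathrm{Re}\,\mu_2>\mathrm{Re}\,\mu_3$, and is extended to all $\mu$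 by analytic continuation. Put \[ M_{\rm poly}(a,b,c;\mu)=|1+i\,\mathrm{Im}(\mu_1-\mu_2)|^a\,|1+i\,\mathrm{Im}(\mu_1-\mu_3)|^b\,|1+i\,\mathrm{Im}(\mu_2-\mu_3)|^c, \] \[ M_{\rm sym}(\kappa,\delta;\mu)=\sum_{w\in S_3}M_{\rm poly}\Big(\tfrac{\kappa-\delta}{2}+\epsilon,\tfrac{\kappa-\delta}{2}+\epsilon,\delta+\epsilon;\mu^w\Big), \] where $\mu^w$ runs over the permutations of $\mu$, and \[ \Lambda_{\rm poly}(\mu)=M_{\rm poly}\Big(\tfrac{\mathrm{Re}(\mu_1-\mu_2)}{2},\tfrac{\mathrm{Re}(\mu_1-\mu_3)}{2},\tfrac{\mathrm{Re}(\mu_2-\mu_3)}{2};\mu\Big). \] Proposition. Fix $\mathfrak{s}_1,\mathfrak{s}_2\in\mathbb{R}$, the real parts $\mathrm{Re}\,\mu_i$, and $\epsilon>0$, and suppose that $\mathfrak{s}_1-\mathrm{Re}\,\mu_i>0$ and $\mathfrak{s}_2+\mathrm{Re}\,\mu_i>0$ for $i=1,2,3$. Then the following integral converges and \[ \int_{Y(\mathbb{R})}|W(t,\mu,\psi_{11})|\,t_1^{\mathfrak{s}_1+1}t_2^{\mathfrak{s}_2+1}\,dt\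 \ll\ \frac{M_{\rm sym}(\mathfrak{s}_1+\mathfrak{s}_2-\frac12,\delta;\mu)}{\Lambda_{\rm poly}(\mu)}, \] where \[ \delta=\min_{i}\Big\{\tfrac{2\mathfrak{s}_1+\mathrm{Re}\,\mu_i}{2},\tfrac{\mathfrak{s}_1-\mathrm{Re}\,\mu_i}{2},\tfrac{2\mathfrak{s}_2-\mathrm{Re}\,\mu_i}{2},\tfrac{\mathfrak{s}_2+\mathrm{Re}\,\mu_i}{2}\Big\}, \] and the implied constant depends only on $\mathfrak{s}_1,\mathfrak{s}_2$, the $\mathrm{Re}\,\mu_i$ and $\epsilon$ (so the bound is uniform in the imaginary parts of $\mu$). -/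

import Mathlib

open MeasureTheory

noncomputable section

namespace SL3

/-- The unipotent upper triangular matrix with coordinates `(x₁, x₂, x₃)`; note the ordering of the
indices. -/
def unip (x : ℝ × ℝ × ℝ) : Matrix (Fin 3) (Fin 3) ℝ :=
  !![1, x.2.1, x.2.2; 0, 1, x.1; 0, 0, 1]

/-- The diagonal matrix `diag(y₁ y₂, y₁, 1)` attached to a pair `y = (y₁, y₂)`. -/
def torus (y : ℝ × ℝ) : Matrix (Fin 3) (Fin 3) ℝ :=
  !![y.1 * y.2, 0, 0; 0, y.1, 0; 0, 0, 1]

/-- The long Weyl element. -/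
def longWeyl : Matrix (Fin 3) (Fin 3) ℝ :=
  !![0, 0, 1; 0, -1, 0; 1, 0, 0]

/-- The pair `(y₁, y₂)` of the Iwasawa decomposition `g = r x y k` of an invertible matrix `g`
(`r > 0` a scalar, `x` unipotent upper triangular, `y = diag(y₁ y₂, y₁, 1)` with `y₁, y₂ > 0`, and
`k` orthogonal), read off from the lower right minors `m₁, m₂, m₃` of `S = g gᵀ`:
`m₁ = r²`, `m₂ = r⁴ y₁²`, `m₃ = r⁶ y₁⁴ y₂²`. See `iwasawaY_eq`. -/
def iwasawaY (g : Matrix (Fin 3) (Fin 3) ℝ) : ℝ × ℝ :=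
  let S := g * g.transpose
  let m₁ := S 2 2
  let m₂ := S 1 1 * S 2 2 - S 1 2 * S 2 1
  let m₃ := S.det
  (Real.sqrt m₂ / m₁, Real.sqrt (m₃ * m₁) / m₂)

/-- `iwasawaY` is the `y`-part of the Iwasawa decomposition. -/
theorem iwasawaY_eq (r : ℝ) (hr : 0 < r) (x : ℝ × ℝ × ℝ) (y : ℝ × ℝ) (hy₁ : 0 < y.1)
    (hy₂ : 0 < y.2) (k : Matrix (Fin 3) (Fin 3) ℝ) (hk : k * k.transpose = 1) :
    iwasawaY (r • (unip x * torus y * k)) = y := by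
  have hS : (r • (unip x * torus y * k)) * (r • (unip x * torus y * k)).transpose
      = (r • (unip x * torus y)) * (r • (unip x * torus y)).transpose := by
    simp only [Matrix.transpose_smul, Matrix.transpose_mul, Matrix.smul_mul, Matrix.mul_smul]
    congr 2
    calc unip x * torus y * k * (k.transpose * ((torus y).transpose * (unip x).transpose))
        = unip x * torus y * (k * k.transpose) * ((torus y).transpose * (unip x).transpose) := by
          simp only [Matrix.mul_assoc]
      _ = _ := by rw [hk, Matrix.mul_one]
  obtain ⟨a, b⟩ := y
  obtain ⟨x₁, x₂, x₃⟩ := x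
  simp only at hy₁ hy₂
  have h2 : Real.sqrt (r ^ 4 * a ^ 2) = r ^ 2 * a := by
    rw [show r ^ 4 * a ^ 2 = (r ^ 2 * a) ^ 2 by ring, Real.sqrt_sq (by positivity)]
  have h3 : Real.sqrt (r ^ 6 * a ^ 4 * b ^ 2 * r ^ 2) = r ^ 4 * a ^ 2 * b := by
    rw [show r ^ 6 * a ^ 4 * b ^ 2 * r ^ 2 = (r ^ 4 * a ^ 2 * b) ^ 2 by ring,
      Real.sqrt_sq (by positivity)]
  have e1 : ((r • (unip (x₁, x₂, x₃) * torus (a, b))) *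
      (r • (unip (x₁, x₂, x₃) * torus (a, b))).transpose) 2 2 = r ^ 2 := by
    simp [unip, torus, Matrix.mul_apply, Fin.sum_univ_three]; ring
  have e2 : ((r • (unip (x₁, x₂, x₃) * torus (a, b))) *
      (r • (unip (x₁, x₂, x₃) * torus (a, b))).transpose) 1 1 * ((r • (unip (x₁, x₂, x₃) *
        torus (a, b))) * (r • (unip (x₁, x₂, x₃) * torus (a, b))).transpose) 2 2
      - ((r • (unip (x₁, x₂, x₃) * torus (a, b))) *
      (r • (unip (x₁, x₂, x₃) * torus (a, b))).transpose) 1 2 * ((r • (unip (x₁, x₂, x₃) *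
        torus (a, b))) * (r • (unip (x₁, x₂, x₃) * torus (a, b))).transpose) 2 1
      = r ^ 4 * a ^ 2 := by
    simp [unip, torus, Matrix.mul_apply, Fin.sum_univ_three]; ring
  have e3 : ((r • (unip (x₁, x₂, x₃) * torus (a, b))) *
      (r • (unip (x₁, x₂, x₃) * torus (a, b))).transpose).det = r ^ 6 * a ^ 4 * b ^ 2 := by
    rw [Matrix.det_mul, Matrix.det_transpose]
    simp [unip, torus, Matrix.det_fin_three]; ring
  simp only [iwasawaY]
  rw [hS, e2, e3, e1, h2, h3]
  ext
  · simp only; field_simp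
  · simp only; field_simp

/-- `ρ = (1, 0, -1)`. -/
def rho : Fin 3 → ℂ := ![1, 0, -1]

/-- The power function `p_μ(xyk) = y₁^{μ₁+μ₂} y₂^{μ₁}`. -/
def powerFn (μ : Fin 3 → ℂ) (g : Matrix (Fin 3) (Fin 3) ℝ) : ℂ :=
  ((iwasawaY g).1 : ℂ) ^ (μ 0 + μ 1) * ((iwasawaY g).2 : ℂ) ^ (μ 0)

/-- The character `ψ_m(x) = e(m₁ x₁ + m₂ x₂)`, where `e(θ) = exp(2πiθ)`. -/
def psi (m : ℝ × ℝ) (x : ℝ × ℝ × ℝ) : ℂ :=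
  Complex.exp (2 * Real.pi * Complex.I * ((m.1 * x.1 + m.2 * x.2.1 : ℝ) : ℂ))

/-- Jacquet's integral `∫_{U(ℝ)} p_{ρ+μ}(w_l u z) ψ_m(u) du`, absolutely convergent for
`Re μ₁ > Re μ₂ > Re μ₃`. -/
def jacquetIntegral (z : Matrix (Fin 3) (Fin 3) ℝ) (μ : Fin 3 → ℂ) (m : ℝ × ℝ) : ℂ :=
  ∫ x : ℝ × ℝ × ℝ, powerFn (rho + μ) (longWeyl * unip x * z) * psi m x

/-- `F` is the holomorphic continuation, to all `(μ₁, μ₂) ∈ ℂ²` (with `μ₃ = -μ₁-μ₂`), of Jacquet's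
integral from its domain of absolute convergence `Re μ₁ > Re μ₂ > Re μ₃`. By the identity theorem
there is at most one such `F`. -/
def IsJacquetContinuation (z : Matrix (Fin 3) (Fin 3) ℝ) (m : ℝ × ℝ) (F : ℂ × ℂ → ℂ) : Prop :=
  Differentiable ℂ F ∧ ∀ a b : ℂ, b.re < a.re → (-a - b).re < b.re →
    F (a, b) = jacquetIntegral z ![a, b, -a - b] m

open Classical in
/-- The Jacquet-Whittaker function `W(z; μ, ψ_m)`, for `m₁ m₂ ≠ 0` and `μ₁ + μ₂ + μ₃ = 0`: the
value at `μ` of the entire continuation of Jacquet's integral. -/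
def whittaker (z : Matrix (Fin 3) (Fin 3) ℝ) (μ : Fin 3 → ℂ) (m : ℝ × ℝ) : ℂ :=
  if h : ∃ F : ℂ × ℂ → ℂ, IsJacquetContinuation z m F then h.choose (μ 0, μ 1) else 0

/-- The measure `dy = dy₁ dy₂ / (y₁ y₂)³` on `Y(ℝ) = {(y₁, y₂) : y₁, y₂ > 0}`. -/
def measY : Measure (ℝ × ℝ) :=
  (volume.restrict (Set.Ioi 0 ×ˢ Set.Ioi 0)).withDensity
    fun y => ENNReal.ofReal (1 / (y.1 * y.2) ^ 3)

/-- `M_poly(a, b, c; μ)`. -/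
def Mpoly (a b c : ℝ) (μ : Fin 3 → ℂ) : ℝ :=
  ‖1 + Complex.I * ((μ 0 - μ 1).im : ℂ)‖ ^ a * ‖1 + Complex.I * ((μ 0 - μ 2).im : ℂ)‖ ^ b *
    ‖1 + Complex.I * ((μ 1 - μ 2).im : ℂ)‖ ^ c

/-- `M_sym(κ, δ; μ)`; the Weyl group acts on `μ` by all permutations of the coordinates. The
parameter `ε` is written out. -/
def Msym (ε κ δ : ℝ) (μ : Fin 3 → ℂ) : ℝ :=
  ∑ w : Equiv.Perm (Fin 3), Mpoly ((κ - δ) / 2 + ε) ((κ - δ) / 2 + ε) (δ + ε) (μ ∘ w)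

/-- `Λ_poly(μ)`. -/
def LambdaPoly (μ : Fin 3 → ℂ) : ℝ :=
  Mpoly ((μ 0 - μ 1).re / 2) ((μ 0 - μ 2).re / 2) ((μ 1 - μ 2).re / 2) μ

/-- The exponent `δ`, a minimum over `i` of four linear expressions. -/
def deltaExp (s₁ s₂ : ℝ) (μ : Fin 3 → ℂ) : ℝ :=
  Finset.univ.inf' Finset.univ_nonempty fun i : Fin 3 =>
    min (min ((2 * s₁ + (μ i).re) / 2) ((s₁ - (μ i).re) / 2))
      (min ((2 * s₂ - (μ i).re) / 2) ((s₂ + (μ i).re) / 2))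

end SL3

end

open MeasureTheory Filter Topology

noncomputable section

namespace SL3

/-! Indices run over 0, 1, 2, and τᵢ = Im μᵢ / 2. The integral is controlled by a pointwise bound.
For σ₁ > Re μᵢ and σ₂ > -Re μᵢ, W(y) is a constant times 1/(Γ((1+μ₀-μ₁)/2) Γ((1+μ₁-μ₂)/2)
Γ((1+μ₀-μ₂)/2)) times a double Mellin–Barnes integral. In absolute value its integrand is y₁^(1-σ₁)
y₂^(1-σ₂) times ∏ |Γ((σ₁-Re μᵢ)/2 + i(u-τᵢ))| ∏ |Γ((σ₂+Re μᵢ)/2 + i(v-τᵢ))| / |Γ((σ₁+σ₂)/2 +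
i(u-v))|, again up to a constant. Taking σⱼ = sⱼ - e where yⱼ ≤ 1 and σⱼ = sⱼ + e beyond makes the
integral over Y converge at both ends.

The representation comes from `bigKernel`. Jacquet's integrand is a product of powers of two
polynomials in the unipotent coordinates. A beta integral in v merges them and gamma integrals in m
and w exponentiate the result, scaled so that the exponent becomes a sheared Gaussian
(`bigKernel_eq`). Integrating (v, m, w) first returns the power function times exactly the three
normalizing gamma values. Integrating the unipotent variables first gives `tripleInt`, an integral
of a product of two Bessel functions. It converges for all parameters, so it supplies the entire
continuation. Mellin inversion in each Bessel function and a beta integral in v then give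
`tripleInt_eq_mellinBarnes`.

To bound the absolute integral, sort τ₀ ≥ τ₁ ≥ τ₂. Stirling produces the exponent -(π/2)(∑|u-τᵢ| +
∑|v-τᵢ| - |u-v|). The bracket is minimal on the box τ₂ ≤ v ≤ τ₁ ≤ u ≤ τ₀ and on its mirror image
under u ↔ v, and grows linearly away from them (`exists_clamp`). The minimal value cancels the
exponential growth of the normalizing factor, whose polynomial part is 1/`LambdaPoly`
(`norm_gammaFactor_le`). On the box the logarithms of the polynomial factors obey a linear
inequality (`stationary_linear`), giving (larger gap)^(2g-1/2-δ) (smaller gap)^δ with g = (σ₁+σ₂)/2,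
even after room is made for integrable weights in u and v. Placing the smaller gap last identifies
this with one term of `Msym`. -/

/-! ### Stirling-type bounds for Γ on vertical lines, by log-concavity. -/

/-- One Euler factor of the log-concavity of `x ↦ ‖Γ(x + iy)‖ / Γ(x)`. -/
theorem euler_factor_logConcave {t₀ t₁ θ : ℝ} (y : ℝ) (h₀ : 0 < t₀) (h₁ : 0 < t₁) (hθ : 0 < θ)
    (hθ' : θ < 1) :
    (t₀ / ‖(t₀ + y * Complex.I : ℂ)‖) ^ (1 - θ) * (t₁ / ‖(t₁ + y * Complex.I : ℂ)‖) ^ θ ≤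
      ((1 - θ) * t₀ + θ * t₁) / ‖(((1 - θ) * t₀ + θ * t₁ : ℝ) + y * Complex.I : ℂ)‖ := by
  have hθ1 : 0 < 1 - θ := by linarith
  set t := (1 - θ) * t₀ + θ * t₁ with ht
  have htpos : 0 < t := by positivity
  have key : ∀ s : ℝ, 0 < s → s / ‖(s + y * Complex.I : ℂ)‖ = (1 + y ^ 2 / s ^ 2) ^ (-(1 / 2 : ℝ)) := by
    intro s hs
    rw [Complex.norm_add_mul_I, show s ^ 2 + y ^ 2 = s ^ 2 * (1 + y ^ 2 / s ^ 2) by field_simp,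
      Real.sqrt_mul (by positivity), Real.sqrt_sq hs.le, Real.rpow_neg (by positivity),
      ← Real.sqrt_eq_rpow]
    field_simp
  rw [key t₀ h₀, key t₁ h₁, key t htpos]
  set A := y ^ 2 / t₀ ^ 2
  set B := y ^ 2 / t₁ ^ 2
  have hA : 0 ≤ A := by positivity
  have hB : 0 ≤ B := by positivity
  have hu : 0 < 1 + A := by linarith
  have hv : 0 < 1 + B := by linarith
  -- Two-term Hölder, 1 + A^(1-θ) B^θ ≤ (1+A)^(1-θ) (1+B)^θ, is the sum of the weighted AM–GM
  -- inequalities `e1` and `e2`. It suffices because t is at least the weighted geometric mean of t₀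
  -- and t₁.
  have h1 : 1 + y ^ 2 / t ^ 2 ≤ (1 + A) ^ (1 - θ) * (1 + B) ^ θ := by
    have e1 : (1 / (1 + A)) ^ (1 - θ) * (1 / (1 + B)) ^ θ ≤
        (1 - θ) * (1 / (1 + A)) + θ * (1 / (1 + B)) :=
      Real.geom_mean_le_arith_mean2_weighted hθ1.le hθ.le (by positivity) (by positivity) (by ring)
    have e2 : (A / (1 + A)) ^ (1 - θ) * (B / (1 + B)) ^ θ ≤
        (1 - θ) * (A / (1 + A)) + θ * (B / (1 + B)) :=
      Real.geom_mean_le_arith_mean2_weighted hθ1.le hθ.le (by positivity) (by positivity) (by ring)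
    have e3 : (1 - θ) * (1 / (1 + A)) + θ * (1 / (1 + B)) +
        ((1 - θ) * (A / (1 + A)) + θ * (B / (1 + B))) = 1 := by field_simp; ring
    rw [Real.div_rpow zero_le_one hu.le, Real.div_rpow zero_le_one hv.le] at e1
    rw [Real.div_rpow hA hu.le, Real.div_rpow hB hv.le] at e2
    simp only [Real.one_rpow] at e1
    have pu : 0 < (1 + A) ^ (1 - θ) := Real.rpow_pos_of_pos hu _
    have pv : 0 < (1 + B) ^ θ := Real.rpow_pos_of_pos hv _
    have e4 : (1 + A ^ (1 - θ) * B ^ θ) / ((1 + A) ^ (1 - θ) * (1 + B) ^ θ) ≤ 1 := by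
      calc _ = 1 / (1 + A) ^ (1 - θ) * (1 / (1 + B) ^ θ) +
            A ^ (1 - θ) / (1 + A) ^ (1 - θ) * (B ^ θ / (1 + B) ^ θ) := by field_simp
        _ ≤ _ := by linarith
    rw [div_le_one (by positivity)] at e4
    refine le_trans ?_ e4
    gcongr
    have e5 : t₀ ^ (1 - θ) * t₁ ^ θ ≤ t :=
      Real.geom_mean_le_arith_mean2_weighted hθ1.le hθ.le h₀.le h₁.le (by ring)
    have e6 : A ^ (1 - θ) * B ^ θ = y ^ 2 / (t₀ ^ (1 - θ) * t₁ ^ θ) ^ 2 := by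
      rw [Real.div_rpow (by positivity) (by positivity), Real.div_rpow (by positivity)
        (by positivity), div_mul_div_comm, mul_pow, Real.rpow_pow_comm h₀.le,
        Real.rpow_pow_comm h₁.le, ← Real.rpow_add' (by positivity) (by norm_num)]
      norm_num
    rw [e6]
    gcongr
  calc _ = ((1 + A) ^ (1 - θ) * (1 + B) ^ θ) ^ (-(1 / 2 : ℝ)) := by
        rw [Real.mul_rpow (by positivity) (by positivity), ← Real.rpow_mul hu.le,
          ← Real.rpow_mul hv.le, ← Real.rpow_mul hu.le, ← Real.rpow_mul hv.le]
        ring_nf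
    _ ≤ _ := Real.rpow_le_rpow_of_nonpos (by positivity) h1 (by norm_num)

/-- The ratio `‖Γ(x + iy)‖ / Γ(x)`. -/
def gammaRatio (x y : ℝ) : ℝ := ‖Complex.Gamma (x + y * Complex.I)‖ / Real.Gamma x

/-- In Euler's limit formula for Γ(x + iy) and for Γ(x), the factors n^x and n! agree in absolute
value and cancel in the quotient. -/
theorem gammaSeq_ratio_tendsto {x : ℝ} (hx : 0 < x) (y : ℝ) :
    Tendsto (fun n : ℕ => ∏ j ∈ Finset.range (n + 1), (x + j) / ‖((x + j : ℝ) + y * Complex.I : ℂ)‖)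
      atTop (𝓝 (gammaRatio x y)) := by
  have h1 := (Complex.GammaSeq_tendsto_Gamma (x + y * Complex.I)).norm
  have h2 := Real.GammaSeq_tendsto_Gamma x
  refine (h1.div h2 (Real.Gamma_pos_of_pos hx).ne').congr' ?_
  filter_upwards [eventually_gt_atTop 0] with n hn
  have hn' : (0 : ℝ) < n := by exact_mod_cast hn
  simp only [Pi.div_apply, Complex.GammaSeq, Real.GammaSeq, norm_div, norm_mul, norm_prod]
  rw [Complex.norm_natCast_cpow_of_pos hn]
  have : (x + y * Complex.I : ℂ).re = x := by simp
  rw [this, Complex.norm_natCast, Finset.prod_div_distrib]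
  have hp : (∏ j ∈ Finset.range (n + 1), (x + j)) ≠ 0 :=
    Finset.prod_ne_zero_iff.2 fun j _ => by positivity
  have e : ∀ j : ℕ, (x + y * Complex.I + j : ℂ) = ((x + j : ℝ) + y * Complex.I : ℂ) := by
    intro j; push_cast; ring
  simp only [e]
  have hr : (n : ℝ) ^ x ≠ 0 := (Real.rpow_pos_of_pos hn' _).ne'
  have hf : (n.factorial : ℝ) ≠ 0 := by positivity
  have hp' : (∏ j ∈ Finset.range (n + 1), ‖((x + j : ℝ) + y * Complex.I : ℂ)‖) ≠ 0 :=
    Finset.prod_ne_zero_iff.2 fun j _ => by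
      rw [norm_ne_zero_iff]
      intro h
      have := congrArg Complex.re h
      simp at this
      linarith [(Nat.cast_nonneg j : (0:ℝ) ≤ j)]
  field_simp

/-- The inequality holds for each Euler factor and survives the limit. It reduces uniform bounds on
arbitrary vertical lines to the half-integral ones, where exact formulas are available. -/
theorem gammaRatio_logConcave {x₀ x₁ θ : ℝ} (y : ℝ) (h₀ : 0 < x₀) (h₁ : 0 < x₁) (hθ : 0 < θ)
    (hθ' : θ < 1) :
    gammaRatio x₀ y ^ (1 - θ) * gammaRatio x₁ y ^ θ ≤ gammaRatio ((1 - θ) * x₀ + θ * x₁) y := by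
  have hθ1 : 0 < 1 - θ := by linarith
  have hx : 0 < (1 - θ) * x₀ + θ * x₁ := by positivity
  refine le_of_tendsto_of_tendsto' (((gammaSeq_ratio_tendsto h₀ y).rpow_const (Or.inr hθ1.le)).mul
    ((gammaSeq_ratio_tendsto h₁ y).rpow_const (Or.inr hθ.le))) (gammaSeq_ratio_tendsto hx y) ?_
  intro n
  rw [← Real.finsetProd_rpow _ _ (fun j _ => by positivity),
    ← Real.finsetProd_rpow _ _ (fun j _ => by positivity), ← Finset.prod_mul_distrib]
  refine Finset.prod_le_prod (fun j _ => by positivity) fun j _ => ?_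
  have := euler_factor_logConcave y (t₀ := x₀ + j) (t₁ := x₁ + j) (by positivity) (by positivity)
    hθ hθ'
  rwa [show (1 - θ) * (x₀ + j) + θ * (x₁ + j) = (1 - θ) * x₀ + θ * x₁ + j by ring] at this

/-- On the line Re s = 1/2 one has 1 - s = conj s, so the reflection formula computes |Γ(s)|²
itself. -/
theorem norm_Gamma_half (y : ℝ) :
    ‖Complex.Gamma ((1 / 2 : ℝ) + y * Complex.I)‖ ^ 2 = Real.pi / Real.cosh (Real.pi * y) := by
  have h := Complex.Gamma_mul_Gamma_one_sub ((1 / 2 : ℝ) + y * Complex.I)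
  have e : (1 - ((1 / 2 : ℝ) + y * Complex.I) : ℂ) =
      (starRingEnd ℂ) ((1 / 2 : ℝ) + y * Complex.I) := by
    apply Complex.ext
    · simp; norm_num
    · simp
  rw [e, Complex.Gamma_conj, Complex.mul_conj, Complex.normSq_eq_norm_sq] at h
  have e2 : Complex.sin (Real.pi * ((1 / 2 : ℝ) + y * Complex.I)) =
      (Real.cosh (Real.pi * y) : ℂ) := by
    rw [show (Real.pi * ((1 / 2 : ℝ) + y * Complex.I) : ℂ) =
      (Real.pi * y : ℝ) * Complex.I + Real.pi / 2 by push_cast; ring, Complex.sin_add_pi_div_two,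
      Complex.cos_mul_I, Complex.ofReal_cosh]
  rw [e2] at h
  exact_mod_cast h

theorem norm_Gamma_half_le (y : ℝ) :
    ‖Complex.Gamma ((1 / 2 : ℝ) + y * Complex.I)‖ ≤
      Real.sqrt (2 * Real.pi) * Real.exp (-(Real.pi / 2 * |y|)) := by
  refine abs_le_of_sq_le_sq' ?_ (by positivity) |>.2
  rw [norm_Gamma_half, mul_pow, Real.sq_sqrt (by positivity), ← Real.exp_nat_mul,
    div_le_iff₀ (Real.cosh_pos _), ← Real.cosh_abs, abs_mul, abs_of_pos Real.pi_pos, Real.cosh_eq]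
  have : Real.exp (((2 : ℕ) : ℝ) * -(Real.pi / 2 * |y|)) * Real.exp (Real.pi * |y|) = 1 := by
    rw [← Real.exp_add]; simp; ring
  have h2 : 0 ≤ Real.exp (((2 : ℕ) : ℝ) * -(Real.pi / 2 * |y|)) * Real.exp (-(Real.pi * |y|)) := by
    positivity
  nlinarith [Real.pi_pos]

theorem le_norm_Gamma_half (y : ℝ) :
    Real.exp (-(Real.pi / 2 * |y|)) ≤ ‖Complex.Gamma ((1 / 2 : ℝ) + y * Complex.I)‖ := by
  refine abs_le_of_sq_le_sq' ?_ (by positivity) |>.2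
  rw [norm_Gamma_half, ← Real.exp_nat_mul,
    le_div_iff₀ (Real.cosh_pos _), ← Real.cosh_abs, abs_mul, abs_of_pos Real.pi_pos, Real.cosh_eq]
  have : Real.exp (((2 : ℕ) : ℝ) * -(Real.pi / 2 * |y|)) * Real.exp (Real.pi * |y|) = 1 := by
    rw [← Real.exp_add]; simp; ring
  have h2 : Real.exp (((2 : ℕ) : ℝ) * -(Real.pi / 2 * |y|)) * Real.exp (-(Real.pi * |y|)) ≤ 1 := by
    rw [← Real.exp_add]
    refine Real.exp_le_one_iff.2 ?_
    have : 0 ≤ Real.pi * |y| := by positivity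
    push_cast; linarith
  linarith [Real.pi_gt_three]

/-- The size of `Γ(x + iy)` in vertical strips. -/
def gammaSize (x y : ℝ) : ℝ := (1 + |y|) ^ (x - 1 / 2) * Real.exp (-(Real.pi / 2 * |y|))

theorem gammaSize_pos (x y : ℝ) : 0 < gammaSize x y := by unfold gammaSize; positivity

theorem norm_add_mul_I_le (x y : ℝ) : ‖(x + y * Complex.I : ℂ)‖ ≤ (1 + |x|) * (1 + |y|) := by
  calc _ ≤ ‖(x : ℂ)‖ + ‖(y * Complex.I : ℂ)‖ := norm_add_le _ _
    _ = |x| + |y| := by simp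
    _ ≤ _ := by nlinarith [abs_nonneg x, abs_nonneg y]

theorem le_norm_add_mul_I {x : ℝ} (hx : 1 / 2 ≤ x) (y : ℝ) :
    (1 + |y|) / 4 ≤ ‖(x + y * Complex.I : ℂ)‖ := by
  have h1 := Complex.abs_re_le_norm (x + y * Complex.I : ℂ)
  have h2 := Complex.abs_im_le_norm (x + y * Complex.I : ℂ)
  simp at h1 h2
  linarith [le_abs_self x]

theorem Gamma_succ_add_mul_I {x : ℝ} (hx : x ≠ 0) (y : ℝ) :
    ‖Complex.Gamma ((x + 1 : ℝ) + y * Complex.I)‖ =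
      ‖(x + y * Complex.I : ℂ)‖ * ‖Complex.Gamma (x + y * Complex.I)‖ := by
  rw [← norm_mul, ← Complex.Gamma_add_one]
  · push_cast; ring_nf
  · intro h
    have := congrArg Complex.re h
    simp at this
    exact hx this

theorem gammaSize_succ (x y : ℝ) : gammaSize (x + 1) y = (1 + |y|) * gammaSize x y := by
  unfold gammaSize
  rw [show x + 1 - 1 / 2 = (x - 1 / 2) + 1 by ring, Real.rpow_add (by positivity), Real.rpow_one]
  ring

/-- `‖Γ(n + 1/2 + iy)‖` is of size `gammaSize (n + 1/2) y`. -/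
theorem norm_Gamma_nat_add_half (n : ℕ) : ∃ c C : ℝ, 0 < c ∧ 0 < C ∧ ∀ y : ℝ,
    c * gammaSize (n + 1 / 2) y ≤ ‖Complex.Gamma ((n + 1 / 2 : ℝ) + y * Complex.I)‖ ∧
    ‖Complex.Gamma ((n + 1 / 2 : ℝ) + y * Complex.I)‖ ≤ C * gammaSize (n + 1 / 2) y := by
  induction n with
  | zero =>
    refine ⟨1, Real.sqrt (2 * Real.pi), one_pos, by positivity, fun y => ⟨?_, ?_⟩⟩
    · simpa [gammaSize] using le_norm_Gamma_half y
    · simpa [gammaSize] using norm_Gamma_half_le y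
  | succ n ih =>
    obtain ⟨c, C, hc, hC, h⟩ := ih
    refine ⟨c / 4, (1 + |(n + 1 / 2 : ℝ)|) * C, by positivity, by positivity, fun y => ?_⟩
    obtain ⟨h1, h2⟩ := h y
    have e : ((n + 1 : ℕ) : ℝ) + 1 / 2 = (n + 1 / 2 : ℝ) + 1 := by push_cast; ring
    have hn : (1 / 2 : ℝ) ≤ n + 1 / 2 := by linarith [(Nat.cast_nonneg n : (0 : ℝ) ≤ n)]
    rw [e, Gamma_succ_add_mul_I (by positivity), gammaSize_succ]
    have g := gammaSize_pos (n + 1 / 2) y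
    constructor
    · calc c / 4 * ((1 + |y|) * gammaSize (n + 1 / 2) y)
          = ((1 + |y|) / 4) * (c * gammaSize (n + 1 / 2) y) := by ring
        _ ≤ _ := mul_le_mul (le_norm_add_mul_I hn y) h1 (by positivity) (by positivity)
    · calc _ ≤ ((1 + |(n + 1 / 2 : ℝ)|) * (1 + |y|)) * (C * gammaSize (n + 1 / 2) y) :=
          mul_le_mul (norm_add_mul_I_le _ y) h2 (by positivity) (by positivity)
        _ = _ := by ring

/-- The comparison function is log-linear in x, so interpolating between vertical lines loses
nothing in y. -/
theorem gammaSize_interp {x₀ x₁ θ : ℝ} (y : ℝ) :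
    gammaSize x₀ y ^ (1 - θ) * gammaSize x₁ y ^ θ = gammaSize ((1 - θ) * x₀ + θ * x₁) y := by
  unfold gammaSize
  have hp : 0 < 1 + |y| := by positivity
  rw [Real.mul_rpow (by positivity) (by positivity), Real.mul_rpow (by positivity) (by positivity),
    ← Real.rpow_mul hp.le, ← Real.rpow_mul hp.le, ← Real.exp_mul, ← Real.exp_mul,
    mul_mul_mul_comm, ← Real.rpow_add hp, ← Real.exp_add]
  ring_nf

theorem gammaRatio_pos {x : ℝ} (hx : 0 < x) (y : ℝ) : 0 < gammaRatio x y :=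
  div_pos (norm_pos_iff.2 (Complex.Gamma_ne_zero_of_re_pos (by simpa))) (Real.Gamma_pos_of_pos hx)

theorem norm_Gamma_eq {x : ℝ} (hx : 0 < x) (y : ℝ) :
    ‖Complex.Gamma (x + y * Complex.I)‖ = Real.Gamma x * gammaRatio x y := by
  unfold gammaRatio
  field_simp [(Real.Gamma_pos_of_pos hx).ne']

theorem gammaRatio_nat_add_half (n : ℕ) : ∃ c C : ℝ, 0 < c ∧ 0 < C ∧ ∀ y : ℝ,
    c * gammaSize (n + 1 / 2) y ≤ gammaRatio (n + 1 / 2) y ∧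
    gammaRatio (n + 1 / 2) y ≤ C * gammaSize (n + 1 / 2) y := by
  obtain ⟨c, C, hc, hC, h⟩ := norm_Gamma_nat_add_half n
  have hg : 0 < Real.Gamma (n + 1 / 2) := Real.Gamma_pos_of_pos (by positivity)
  refine ⟨c / Real.Gamma (n + 1 / 2), C / Real.Gamma (n + 1 / 2), by positivity, by positivity,
    fun y => ?_⟩
  unfold gammaRatio
  rw [div_mul_eq_mul_div, div_mul_eq_mul_div]
  exact ⟨div_le_div_of_nonneg_right (h y).1 hg.le, div_le_div_of_nonneg_right (h y).2 hg.le⟩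

/-- Upper bound for `Γ` on a vertical line in the right half plane. -/
theorem norm_Gamma_le {x : ℝ} (hx : 0 < x) : ∃ C : ℝ, 0 < C ∧ ∀ y : ℝ,
    ‖Complex.Gamma (x + y * Complex.I)‖ ≤ C * gammaSize x y := by
  obtain ⟨N, hN⟩ := exists_nat_gt x
  obtain ⟨_, C₀, _, hC₀, h₀⟩ := gammaRatio_nat_add_half N
  obtain ⟨c₁, _, hc₁, _, h₁⟩ := gammaRatio_nat_add_half (N + 1)
  -- This θ makes N + 1/2 the convex combination of x and N + 3/2. A log-concave function is bounded
  -- above at the end x by its values at the interior point and at the other end, so this is an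
  -- extrapolation.
  set θ : ℝ := (N + 1 / 2 - x) / (N + 3 / 2 - x) with hθ
  have hd : 0 < N + 3 / 2 - x := by linarith
  have hθ0 : 0 < θ := div_pos (by linarith) hd
  have hθ1 : θ < 1 := (div_lt_one hd).2 (by linarith)
  have e : (1 - θ) * x + θ * ((N + 1 : ℕ) + 1 / 2) = N + 1 / 2 := by
    have : θ * (N + 3 / 2 - x) = N + 1 / 2 - x := div_mul_cancel₀ _ hd.ne'
    push_cast; linear_combination this
  set D := C₀ / c₁ ^ θ with hD
  have hDpos : 0 < D := by positivity
  have hx' : (1 - θ) ≠ 0 := by linarith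
  refine ⟨Real.Gamma x * D ^ (1 / (1 - θ)), by have := Real.Gamma_pos_of_pos hx; positivity,
    fun y => ?_⟩
  rw [norm_Gamma_eq hx, mul_assoc]
  refine mul_le_mul_of_nonneg_left ?_ (Real.Gamma_pos_of_pos hx).le
  have hr := gammaRatio_pos hx y
  have g := gammaSize_pos x y
  have g₁ := gammaSize_pos ((N + 1 : ℕ) + 1 / 2) y
  have k := gammaRatio_logConcave y hx (x₁ := (N + 1 : ℕ) + 1 / 2) (by positivity) hθ0 hθ1
  have i := gammaSize_interp (x₀ := x) (x₁ := (N + 1 : ℕ) + 1 / 2) (θ := θ) y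
  rw [e] at k i
  have k2 : gammaRatio x y ^ (1 - θ) * (c₁ * gammaSize ((N + 1 : ℕ) + 1 / 2) y) ^ θ ≤
      C₀ * gammaSize (N + 1 / 2) y :=
    (mul_le_mul_of_nonneg_left (Real.rpow_le_rpow (by positivity) (h₁ y).1 hθ0.le)
      (by positivity)).trans (k.trans (h₀ y).2)
  rw [Real.mul_rpow hc₁.le g₁.le, ← i] at k2
  have hg₁ : 0 < gammaSize ((N + 1 : ℕ) + 1 / 2) y ^ θ := Real.rpow_pos_of_pos g₁ _
  have k3 : gammaRatio x y ^ (1 - θ) ≤ D * gammaSize x y ^ (1 - θ) := by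
    rw [hD, div_mul_eq_mul_div, le_div_iff₀ (by positivity)]
    refine le_of_mul_le_mul_right ?_ hg₁
    linarith
  have k4 := Real.rpow_le_rpow (by positivity) k3 (z := 1 / (1 - θ)) (by
    rw [one_div]; exact inv_nonneg.2 (by linarith))
  rwa [Real.mul_rpow hDpos.le (by positivity), ← Real.rpow_mul hr.le, ← Real.rpow_mul g.le,
    mul_one_div_cancel hx', Real.rpow_one, Real.rpow_one] at k4

theorem le_norm_Gamma {x : ℝ} (hx : 1 / 2 ≤ x) : ∃ c : ℝ, 0 < c ∧ ∀ y : ℝ,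
    c * gammaSize x y ≤ ‖Complex.Gamma (x + y * Complex.I)‖ := by
  rcases hx.eq_or_lt with rfl | hx
  · obtain ⟨c, _, hc, _, h⟩ := norm_Gamma_nat_add_half 0
    exact ⟨c, hc, fun y => by simpa using (h y).1⟩
  obtain ⟨N, hN⟩ := exists_nat_gt x
  have hx0 : 0 < x := by linarith
  obtain ⟨c₀, _, hc₀, _, h₀⟩ := gammaRatio_nat_add_half 0
  obtain ⟨c₁, _, hc₁, _, h₁⟩ := gammaRatio_nat_add_half N
  have hN0 : (0 : ℝ) < N := by linarith
  set θ : ℝ := (x - 1 / 2) / N with hθ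
  have hθ0 : 0 < θ := div_pos (by linarith) hN0
  have hθ1 : θ < 1 := (div_lt_one hN0).2 (by linarith)
  have e : (1 - θ) * ((0 : ℕ) + 1 / 2) + θ * (N + 1 / 2) = x := by
    rw [hθ]; push_cast; field_simp; ring
  refine ⟨Real.Gamma x * (c₀ ^ (1 - θ) * c₁ ^ θ), by
    have := Real.Gamma_pos_of_pos hx0; positivity, fun y => ?_⟩
  rw [norm_Gamma_eq hx0, mul_assoc]
  refine mul_le_mul_of_nonneg_left ?_ (Real.Gamma_pos_of_pos hx0).le
  have g₀ := gammaSize_pos ((0 : ℕ) + 1 / 2) y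
  have g₁ := gammaSize_pos (N + 1 / 2) y
  have k := gammaRatio_logConcave y (x₀ := (0 : ℕ) + 1 / 2) (by norm_num) (x₁ := N + 1 / 2)
    (by positivity) hθ0 hθ1
  have i := gammaSize_interp (x₀ := (0 : ℕ) + 1 / 2) (x₁ := N + 1 / 2) (θ := θ) y
  rw [e] at k i
  refine le_trans ?_ k
  rw [← i, mul_mul_mul_comm, ← Real.mul_rpow hc₀.le g₀.le, ← Real.mul_rpow hc₁.le g₁.le]
  have hm : 0 < 1 - θ := by linarith
  have q₀ : 0 < c₀ * gammaSize ((0 : ℕ) + 1 / 2) y := by positivity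
  have q₁ : 0 < c₁ * gammaSize (N + 1 / 2) y := by positivity
  exact mul_le_mul (Real.rpow_le_rpow q₀.le (h₀ y).1 hm.le) (Real.rpow_le_rpow q₁.le (h₁ y).1 hθ0.le)
    (by positivity) (Real.rpow_nonneg (q₀.le.trans (h₀ y).1) _)

/-- Upper bound for `1/Γ` on any vertical line. -/
theorem norm_Gamma_inv_le (x : ℝ) : ∃ C : ℝ, 0 < C ∧ ∀ y : ℝ,
    ‖(Complex.Gamma (x + y * Complex.I))⁻¹‖ ≤ C * (gammaSize x y)⁻¹ := by
  -- The identity 1/Γ(z) = z/Γ(z+1) holds at the poles of Γ as well, so n shifts reach any real x.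
  -- This generality is needed because the normalizing factors may have nonpositive real part.
  have main : ∀ n : ℕ, ∀ x : ℝ, 1 / 2 ≤ x + n → ∃ C : ℝ, 0 < C ∧ ∀ y : ℝ,
      ‖(Complex.Gamma (x + y * Complex.I))⁻¹‖ ≤ C * (gammaSize x y)⁻¹ := by
    intro n
    induction n with
    | zero =>
      intro x hx
      obtain ⟨c, hc, h⟩ := le_norm_Gamma (x := x) (by simpa using hx)
      refine ⟨c⁻¹, by positivity, fun y => ?_⟩
      rw [norm_inv, ← mul_inv]
      exact inv_anti₀ (mul_pos hc (gammaSize_pos x y)) (h y)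
    | succ n ih =>
      intro x hx
      obtain ⟨C, hC, h⟩ := ih (x + 1) (by push_cast at hx; linarith)
      refine ⟨(1 + |x|) * C, by positivity, fun y => ?_⟩
      have hh := h y
      have g := gammaSize_pos x y
      rw [show (((x + 1 : ℝ) : ℂ) + y * Complex.I) = (x + y * Complex.I) + 1 by push_cast; ring,
        gammaSize_succ] at hh
      rw [Complex.one_div_Gamma_eq_self_mul_one_div_Gamma_add_one, norm_mul]
      calc _ ≤ ((1 + |x|) * (1 + |y|)) * (C * ((1 + |y|) * gammaSize x y)⁻¹) :=
            mul_le_mul (norm_add_mul_I_le _ y) hh (by positivity) (by positivity)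
        _ = _ := by field_simp
  obtain ⟨n, hn⟩ := exists_nat_gt (1 / 2 - x)
  exact main n x (by linarith)

/-! ### Logarithmic sizes and the linear inequality on the stationary box. -/

/-- `log (1 + |x|)`. -/
def logBr (x : ℝ) : ℝ := Real.log (1 + |x|)

theorem logBr_nonneg (x : ℝ) : 0 ≤ logBr x := Real.log_nonneg (by linarith [abs_nonneg x])

theorem logBr_neg (x : ℝ) : logBr (-x) = logBr x := by simp [logBr]

theorem logBr_mono {x y : ℝ} (h : |x| ≤ |y|) : logBr x ≤ logBr y :=
  Real.log_le_log (by positivity) (by linarith)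

theorem logBr_add_le (x y : ℝ) : logBr (x + y) ≤ logBr x + logBr y := by
  unfold logBr
  rw [← Real.log_mul (by positivity) (by positivity)]
  refine Real.log_le_log (by positivity) ?_
  nlinarith [abs_add_le x y, abs_nonneg x, abs_nonneg y]

theorem logBr_le_of_abs_le {x y k : ℝ} (hk : 1 ≤ k) (h : 1 + |x| ≤ k * (1 + |y|)) :
    logBr x ≤ logBr y + Real.log k := by
  unfold logBr
  rw [add_comm (Real.log _), ← Real.log_mul (by positivity) (by positivity)]
  exact Real.log_le_log (by positivity) h

theorem abs_logBr_sub_le (x y : ℝ) : |logBr x - logBr y| ≤ logBr (x - y) := by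
  have h1 := logBr_add_le (x - y) y
  have h2 := logBr_add_le (-(x - y)) x
  rw [logBr_neg] at h2
  simp only [sub_add_cancel, neg_sub] at h1 h2
  rw [abs_le]; constructor <;> linarith

theorem mul_le_mul_add_abs {k x y c : ℝ} (h : |x - y| ≤ c) : k * x ≤ k * y + |k| * c := by
  have h1 : k * (x - y) ≤ |k| * |x - y| := by rw [← abs_mul]; exact le_abs_self _
  have h2 : |k| * |x - y| ≤ |k| * c := mul_le_mul_of_nonneg_left h (abs_nonneg k)
  linarith

/-- The linear inequality behind the stationary region estimate. -/
theorem stationary_linear {α₀ α₁ α₂ β₀ β₁ β₂ g δ c X₀ X₁ X₂ Y₀ Y₁ Y₂ Z L S : ℝ}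
    (hα₀ : 0 < α₀) (hα₁ : 0 < α₁) (hβ₁ : 0 < β₁) (hβ₂ : 0 < β₂)
    (h₀ : α₀ + β₀ = g) (h₁ : α₁ + β₁ = g) (h₂ : α₂ + β₂ = g)
    (hδ : δ ≤ β₁ + β₂) (hδ' : δ ≤ g + 1 / 2)
    (hX₀ : X₀ ≤ L) (hX₁ : X₁ ≤ L) (hY₁ : Y₁ ≤ S) (hY₂ : Y₂ ≤ S) (hSL : S ≤ L)
    (hX₂ : |X₂ - max X₁ S| ≤ c) (hY₀ : |Y₀ - L| ≤ c) (hZ : |Z - max X₁ Y₁| ≤ c) :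
    (α₀ - 1 / 2) * X₀ + (α₁ - 1 / 2) * X₁ + (α₂ - 1 / 2) * X₂ +
      ((β₀ - 1 / 2) * Y₀ + (β₁ - 1 / 2) * Y₁ + (β₂ - 1 / 2) * Y₂) + (1 / 2 - g) * Z +
      (X₀ + X₁ - L) + (Y₁ + Y₂ - S) ≤
    (|α₂ - 1 / 2| + |β₀ - 1 / 2| + |1 / 2 - g|) * c + (2 * g - 1 / 2 - δ) * L + δ * S := by
  have e1 := mul_le_mul_add_abs (k := α₂ - 1 / 2) hX₂
  have e2 := mul_le_mul_add_abs (k := β₀ - 1 / 2) hY₀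
  have e3 := mul_le_mul_add_abs (k := 1 / 2 - g) hZ
  have p1 := mul_le_mul_of_nonneg_left hX₀ (by linarith : 0 ≤ α₀ + 1 / 2)
  have p2 := mul_le_mul_of_nonneg_left hY₂ (by linarith : 0 ≤ β₂ + 1 / 2)
  have p3 := mul_le_mul_of_nonneg_left hSL (by linarith : 0 ≤ g + 1 / 2 - δ)
  have p4 := mul_le_mul_of_nonneg_left hSL (by linarith : 0 ≤ β₁ + β₂ - δ)
  subst h₀
  obtain rfl : α₁ = α₀ + β₀ - β₁ := by linarith
  obtain rfl : α₂ = α₀ + β₀ - β₂ := by linarith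
  -- If X₁ ≤ S, then X₂ is about S, and Z is about `max X₁ Y₁`, which is at most S. If S ≤ X₁, then
  -- X₂ and Z are both about X₁. The bound is then affine in X₁ on [S, L], and the sign of its slope
  -- decides at which end to evaluate it.
  rcases le_total X₁ S with h | h
  · rw [max_eq_right h] at e1
    set M := max X₁ Y₁
    have hM : M ≤ S := max_le h hY₁
    have p5 := mul_le_mul_of_nonneg_left (le_max_left X₁ Y₁ : X₁ ≤ M)
      (by linarith : 0 ≤ α₀ + β₀ - β₁ + 1 / 2)
    have p6 := mul_le_mul_of_nonneg_left (le_max_right X₁ Y₁ : Y₁ ≤ M)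
      (by linarith : 0 ≤ β₁ + 1 / 2)
    linarith
  · rw [max_eq_left h] at e1
    rw [max_eq_left (hY₁.trans h)] at e3
    have p6 := mul_le_mul_of_nonneg_left hY₁ (by linarith : 0 ≤ β₁ + 1 / 2)
    rcases le_total 0 (α₀ + β₀ - β₁ + (α₀ + β₀ - β₂) + 1 / 2 - (α₀ + β₀)) with he | he
    · have p7 := mul_le_mul_of_nonneg_left hX₁ he
      linarith
    · have p7 := mul_le_mul_of_nonpos_left h he
      linarith

/-- The logarithm of the polynomial part of the Mellin-Barnes integrand. -/
def polyLog (α β τ : Fin 3 → ℝ) (g u v : ℝ) : ℝ :=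
  ∑ i, (α i - 1 / 2) * logBr (u - τ i) + ∑ i, (β i - 1 / 2) * logBr (v - τ i) +
    (1 / 2 - g) * logBr (u - v)

/-- Hypotheses on the exponents. -/
structure Exponents (α β : Fin 3 → ℝ) (g δ : ℝ) : Prop where
  posα : ∀ i, 0 < α i
  posβ : ∀ i, 0 < β i
  add : ∀ i, α i + β i = g
  leα : ∀ i j, i ≠ j → δ ≤ α i + α j
  leβ : ∀ i j, i ≠ j → δ ≤ β i + β j
  le : δ ≤ g + 1 / 2

theorem Exponents.symm {α β : Fin 3 → ℝ} {g δ : ℝ} (h : Exponents α β g δ) :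
    Exponents β α g δ :=
  ⟨h.posβ, h.posα, fun i => by rw [add_comm]; exact h.add i, h.leβ, h.leα, h.le⟩

theorem Exponents.comp {α β : Fin 3 → ℝ} {g δ : ℝ} (h : Exponents α β g δ)
    (w : Equiv.Perm (Fin 3)) : Exponents (α ∘ w) (β ∘ w) g δ :=
  ⟨fun _ => h.posα _, fun _ => h.posβ _, fun _ => h.add _,
    fun _ _ hij => h.leα _ _ (w.injective.ne hij), fun _ _ hij => h.leβ _ _ (w.injective.ne hij),
    h.le⟩

theorem logBr_le_max_add {x y z k : ℝ} (hk : 1 ≤ k)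
    (h : 1 + |x| ≤ k * (1 + max |y| |z|)) : logBr x ≤ max (logBr y) (logBr z) + Real.log k := by
  rcases le_total |y| |z| with hyz | hyz
  · rw [max_eq_right hyz] at h
    exact (logBr_le_of_abs_le hk h).trans (by gcongr; exact le_max_right _ _)
  · rw [max_eq_left hyz] at h
    exact (logBr_le_of_abs_le hk h).trans (by gcongr; exact le_max_left _ _)

/-- When the gap on the u side is the larger one, every logarithm is bounded by, or within `log 2`
of, the quantities of `stationary_linear`. The two added terms with coefficient 1 + e pay for the
integrable weights in u and v inserted later. -/
theorem stationary_aux {α β τ : Fin 3 → ℝ} {g δ u v e : ℝ} (he : 0 ≤ e) (H : Exponents α β g δ)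
    (hu : τ 1 ≤ u) (hu' : u ≤ τ 0) (hv : τ 2 ≤ v) (hv' : v ≤ τ 1)
    (hAB : τ 1 - τ 2 ≤ τ 0 - τ 1) :
    ∃ i j, polyLog α β τ g u v + (1 + e) * logBr (u - τ i) + (1 + e) * logBr (v - τ j) ≤
      (∑ i, |α i - 1 / 2| + ∑ i, |β i - 1 / 2| + |1 / 2 - g| + 2) * Real.log 2 +
      (2 * g - 1 / 2 - δ + 2 * e) * logBr (τ 0 - τ 1) + δ * logBr (τ 1 - τ 2) := by
  have a0 : |u - τ 0| = τ 0 - u := by rw [abs_sub_comm]; exact abs_of_nonneg (by linarith)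
  have a1 : |u - τ 1| = u - τ 1 := abs_of_nonneg (by linarith)
  have a2 : |u - τ 2| = u - τ 2 := abs_of_nonneg (by linarith)
  have b0 : |v - τ 0| = τ 0 - v := by rw [abs_sub_comm]; exact abs_of_nonneg (by linarith)
  have b1 : |v - τ 1| = τ 1 - v := by rw [abs_sub_comm]; exact abs_of_nonneg (by linarith)
  have b2 : |v - τ 2| = v - τ 2 := abs_of_nonneg (by linarith)
  have d : |u - v| = u - v := abs_of_nonneg (by linarith)
  have dA : |τ 0 - τ 1| = τ 0 - τ 1 := abs_of_nonneg (by linarith)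
  have dB : |τ 1 - τ 2| = τ 1 - τ 2 := abs_of_nonneg (by linarith)
  have hX₀ : logBr (u - τ 0) ≤ logBr (τ 0 - τ 1) := logBr_mono (by rw [a0, dA]; linarith)
  have hX₁ : logBr (u - τ 1) ≤ logBr (τ 0 - τ 1) := logBr_mono (by rw [a1, dA]; linarith)
  have hY₁ : logBr (v - τ 1) ≤ logBr (τ 1 - τ 2) := logBr_mono (by rw [b1, dB]; linarith)
  have hY₂ : logBr (v - τ 2) ≤ logBr (τ 1 - τ 2) := logBr_mono (by rw [b2, dB]; linarith)
  have hSL : logBr (τ 1 - τ 2) ≤ logBr (τ 0 - τ 1) := logBr_mono (by rw [dA, dB]; linarith)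
  have hl : 0 ≤ Real.log 2 := Real.log_nonneg (by norm_num)
  have hX₂ : |logBr (u - τ 2) - max (logBr (u - τ 1)) (logBr (τ 1 - τ 2))| ≤ Real.log 2 := by
    have h1 : logBr (u - τ 2) ≤ max (logBr (u - τ 1)) (logBr (τ 1 - τ 2)) + Real.log 2 :=
      logBr_le_max_add one_le_two (by
        rw [a2, a1, dB]
        have := le_max_left (u - τ 1) (τ 1 - τ 2)
        have := le_max_right (u - τ 1) (τ 1 - τ 2)
        linarith)
    have h2 : logBr (u - τ 1) ≤ logBr (u - τ 2) := logBr_mono (by rw [a1, a2]; linarith)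
    have h3 : logBr (τ 1 - τ 2) ≤ logBr (u - τ 2) := logBr_mono (by rw [dB, a2]; linarith)
    have h4 := max_le h2 h3
    rw [abs_le]; constructor <;> linarith
  have hY₀ : |logBr (v - τ 0) - logBr (τ 0 - τ 1)| ≤ Real.log 2 := by
    have h1 : logBr (v - τ 0) ≤ logBr (τ 0 - τ 1) + Real.log 2 :=
      logBr_le_of_abs_le one_le_two (by rw [b0, dA]; linarith)
    have h2 : logBr (τ 0 - τ 1) ≤ logBr (v - τ 0) := logBr_mono (by rw [b0, dA]; linarith)
    rw [abs_le]; constructor <;> linarith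
  have hZ : |logBr (u - v) - max (logBr (u - τ 1)) (logBr (v - τ 1))| ≤ Real.log 2 := by
    have h1 : logBr (u - v) ≤ max (logBr (u - τ 1)) (logBr (v - τ 1)) + Real.log 2 :=
      logBr_le_max_add one_le_two (by
        rw [d, a1, b1]
        have := le_max_left (u - τ 1) (τ 1 - v)
        have := le_max_right (u - τ 1) (τ 1 - v)
        linarith)
    have h2 : logBr (u - τ 1) ≤ logBr (u - v) := logBr_mono (by rw [a1, d]; linarith)
    have h3 : logBr (v - τ 1) ≤ logBr (u - v) := logBr_mono (by rw [b1, d]; linarith)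
    have h4 := max_le h2 h3
    rw [abs_le]; constructor <;> linarith
  have main := stationary_linear (H.posα 0) (H.posα 1) (H.posβ 1) (H.posβ 2) (H.add 0) (H.add 1)
    (H.add 2) (H.leβ 1 2 (by decide)) H.le hX₀ hX₁ hY₁ hY₂ hSL hX₂ hY₀ hZ
  -- The index i belongs to the endpoint of [τ₁, τ₀] nearer to u. The other endpoint is at least
  -- half the gap away, so its logarithm cancels that of the gap up to `log 2`. The index j is found
  -- in the same way for v.
  obtain ⟨i, hi, hi'⟩ : ∃ i, logBr (u - τ i) ≤
      logBr (u - τ 0) + logBr (u - τ 1) - logBr (τ 0 - τ 1) + Real.log 2 ∧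
      logBr (u - τ i) ≤ logBr (τ 0 - τ 1) := by
    rcases le_total (τ 0 - u) (u - τ 1) with h | h
    · refine ⟨0, ?_, hX₀⟩
      have := logBr_le_of_abs_le (x := τ 0 - τ 1) (y := u - τ 1) one_le_two
        (by rw [a1, dA]; linarith)
      linarith
    · refine ⟨1, ?_, hX₁⟩
      have := logBr_le_of_abs_le (x := τ 0 - τ 1) (y := u - τ 0) one_le_two
        (by rw [a0, dA]; linarith)
      linarith
  obtain ⟨j, hj, hj'⟩ : ∃ j, logBr (v - τ j) ≤
      logBr (v - τ 1) + logBr (v - τ 2) - logBr (τ 1 - τ 2) + Real.log 2 ∧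
      logBr (v - τ j) ≤ logBr (τ 1 - τ 2) := by
    rcases le_total (τ 1 - v) (v - τ 2) with h | h
    · refine ⟨1, ?_, hY₁⟩
      have := logBr_le_of_abs_le (x := τ 1 - τ 2) (y := v - τ 2) one_le_two
        (by rw [b2, dB]; linarith)
      linarith
    · refine ⟨2, ?_, hY₂⟩
      have := logBr_le_of_abs_le (x := τ 1 - τ 2) (y := v - τ 1) one_le_two
        (by rw [b1, dB]; linarith)
      linarith
  refine ⟨i, j, ?_⟩
  have q1 := mul_le_mul_of_nonneg_left hi' he
  have q2 := mul_le_mul_of_nonneg_left (hj'.trans hSL) he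
  have n0 := mul_nonneg (abs_nonneg (α 0 - 1 / 2)) hl
  have n1 := mul_nonneg (abs_nonneg (α 1 - 1 / 2)) hl
  have n2 := mul_nonneg (abs_nonneg (β 1 - 1 / 2)) hl
  have n3 := mul_nonneg (abs_nonneg (β 2 - 1 / 2)) hl
  simp only [polyLog, Fin.sum_univ_three]
  linarith

/-- The common bound for the polynomial part. -/
def boundLog (τ : Fin 3 → ℝ) (g δ e : ℝ) : ℝ :=
  (2 * g - 1 / 2 - δ + 2 * e) * max (logBr (τ 0 - τ 1)) (logBr (τ 1 - τ 2)) +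
    δ * min (logBr (τ 0 - τ 1)) (logBr (τ 1 - τ 2))

/-- The constant in the stationary region estimate. -/
def stationaryConst (α β : Fin 3 → ℝ) (g : ℝ) : ℝ :=
  (∑ i, |α i - 1 / 2| + ∑ i, |β i - 1 / 2| + |1 / 2 - g| + 2) * Real.log 2

theorem stationaryConst_symm (α β : Fin 3 → ℝ) (g : ℝ) :
    stationaryConst β α g = stationaryConst α β g := by unfold stationaryConst; ring

theorem polyLog_symm (α β τ : Fin 3 → ℝ) (g u v : ℝ) :
    polyLog β α τ g v u = polyLog α β τ g u v := by
  unfold polyLog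
  rw [← logBr_neg (v - u), neg_sub]; ring

theorem stationary_le {α β τ : Fin 3 → ℝ} {g δ u v e : ℝ} (he : 0 ≤ e) (H : Exponents α β g δ)
    (hu : τ 1 ≤ u) (hu' : u ≤ τ 0) (hv : τ 2 ≤ v) (hv' : v ≤ τ 1) :
    ∃ i j, polyLog α β τ g u v + (1 + e) * logBr (u - τ i) + (1 + e) * logBr (v - τ j) ≤
      stationaryConst α β g + boundLog τ g δ e := by
  have dA : |τ 0 - τ 1| = τ 0 - τ 1 := abs_of_nonneg (by linarith)
  have dB : |τ 1 - τ 2| = τ 1 - τ 2 := abs_of_nonneg (by linarith)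
  rcases le_total (τ 1 - τ 2) (τ 0 - τ 1) with h | h
  · obtain ⟨i, j, hij⟩ := stationary_aux he H hu hu' hv hv' h
    refine ⟨i, j, hij.trans ?_⟩
    have hm : logBr (τ 1 - τ 2) ≤ logBr (τ 0 - τ 1) := logBr_mono (by rw [dA, dB]; linarith)
    rw [boundLog, max_eq_left hm, min_eq_right hm, stationaryConst, add_assoc]
  -- The reflection (u, v) ↦ (-v, -u), with τ negated and reversed and α, β exchanged, swaps the two
  -- gaps.
  · obtain ⟨i, j, hij⟩ := stationary_aux (τ := fun i => -τ (Fin.revPerm i)) (u := -v) (v := -u)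
      he (H.symm.comp Fin.revPerm) (by simpa [Fin.rev] using hv') (by simpa [Fin.rev] using hv)
      (by simpa [Fin.rev] using hu') (by simpa [Fin.rev] using hu)
      (by simp [Fin.rev]; linarith)
    refine ⟨Fin.revPerm j, Fin.revPerm i, ?_⟩
    have hm : logBr (τ 0 - τ 1) ≤ logBr (τ 1 - τ 2) := logBr_mono (by rw [dA, dB]; linarith)
    rw [boundLog, max_eq_right hm, min_eq_left hm]
    have ev : ∀ x y : ℝ, logBr (-x - -y) = logBr (x - y) := fun x y => by
      rw [← logBr_neg (x - y)]; ring_nf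
    simp only [polyLog, ev, Function.comp_apply, stationaryConst, Fin.sum_univ_three] at hij ⊢
    simp only [show Fin.revPerm (0 : Fin 3) = 2 from rfl, show Fin.revPerm (1 : Fin 3) = 1 from rfl,
      show Fin.revPerm (2 : Fin 3) = 0 from rfl] at hij
    have ev1 : logBr (v - u) = logBr (u - v) := by rw [← logBr_neg, neg_sub]
    have ev2 : logBr (τ 2 - τ 1) = logBr (τ 1 - τ 2) := by rw [← logBr_neg, neg_sub]
    have ev3 : logBr (τ 1 - τ 0) = logBr (τ 0 - τ 1) := by rw [← logBr_neg, neg_sub]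
    rw [ev1, ev2, ev3] at hij
    linarith

/-! ### The exponential factor and the pointwise bound off the box. -/

/-- The excess of the exponential part over its minimum. -/
def expDist (τ : Fin 3 → ℝ) (u v : ℝ) : ℝ := ∑ i, |u - τ i| + ∑ i, |v - τ i| - |u - v|

/-- The minimum of `expDist`. -/
def gapSum (τ : Fin 3 → ℝ) : ℝ := |τ 0 - τ 1| + |τ 0 - τ 2| + |τ 1 - τ 2|

theorem expDist_symm (τ : Fin 3 → ℝ) (u v : ℝ) : expDist τ v u = expDist τ u v := by
  unfold expDist; rw [abs_sub_comm v u]; ring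

/-- For v ≤ u the term -|u-v| is affine, so the expression separates into a convex function of u,
flat on [τ₁, τ₀], and one of v, flat on [τ₂, τ₁]. Outside these intervals the slopes are at least 2
in absolute value. The witness is the nearest point of the box. -/
theorem exists_clamp {τ : Fin 3 → ℝ} (h01 : τ 1 ≤ τ 0) (h12 : τ 2 ≤ τ 1) {u v : ℝ} (huv : v ≤ u) :
    ∃ u' v', τ 1 ≤ u' ∧ u' ≤ τ 0 ∧ τ 2 ≤ v' ∧ v' ≤ τ 1 ∧
      |u - u'| + |v - v'| ≤ expDist τ u v - gapSum τ := by
  refine ⟨max (τ 1) (min u (τ 0)), max (τ 2) (min v (τ 1)), le_max_left _ _,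
    max_le h01 (min_le_right _ _), le_max_left _ _, max_le h12 (min_le_right _ _), ?_⟩
  have hd : |u - v| = u - v := abs_of_nonneg (by linarith)
  have dA : |τ 0 - τ 1| = τ 0 - τ 1 := abs_of_nonneg (by linarith)
  have dB : |τ 1 - τ 2| = τ 1 - τ 2 := abs_of_nonneg (by linarith)
  have dC : |τ 0 - τ 2| = τ 0 - τ 2 := abs_of_nonneg (by linarith)
  have tri : ∀ x y : ℝ, x - y ≤ |x - y| ∧ y - x ≤ |x - y| := fun x y =>
    ⟨le_abs_self _, by rw [abs_sub_comm]; exact le_abs_self _⟩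
  have t0 := tri u (τ 0); have t1 := tri u (τ 1); have t2 := tri u (τ 2)
  have s0 := tri v (τ 0); have s1 := tri v (τ 1); have s2 := tri v (τ 2)
  simp only [expDist, gapSum, Fin.sum_univ_three, hd, dA, dB, dC]
  rcases le_total u (τ 0) with hu | hu
  · rw [min_eq_left hu]
    rcases le_total (τ 1) u with hu1 | hu1
    · rw [max_eq_right hu1, sub_self, abs_zero]
      rcases le_total v (τ 1) with hv | hv
      · rw [min_eq_left hv]
        rcases le_total (τ 2) v with hv2 | hv2
        · rw [max_eq_right hv2, sub_self, abs_zero]; linarith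
        · rw [max_eq_left hv2]
          have : |v - τ 2| = τ 2 - v := by rw [abs_sub_comm]; exact abs_of_nonneg (by linarith)
          linarith
      · rw [min_eq_right hv, max_eq_right h12]
        have : |v - τ 1| = v - τ 1 := abs_of_nonneg (by linarith)
        linarith
    · rw [max_eq_left hu1]
      have hu2 : |u - τ 1| = τ 1 - u := by rw [abs_sub_comm]; exact abs_of_nonneg (by linarith)
      rw [min_eq_left (huv.trans hu1)]
      rcases le_total (τ 2) v with hv2 | hv2
      · rw [max_eq_right hv2, sub_self, abs_zero]; linarith
      · rw [max_eq_left hv2]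
        have : |v - τ 2| = τ 2 - v := by rw [abs_sub_comm]; exact abs_of_nonneg (by linarith)
        linarith
  · rw [min_eq_right hu, max_eq_right h01]
    have hu2 : |u - τ 0| = u - τ 0 := abs_of_nonneg (by linarith)
    rcases le_total v (τ 1) with hv | hv
    · rw [min_eq_left hv]
      rcases le_total (τ 2) v with hv2 | hv2
      · rw [max_eq_right hv2, sub_self, abs_zero]; linarith
      · rw [max_eq_left hv2]
        have : |v - τ 2| = τ 2 - v := by rw [abs_sub_comm]; exact abs_of_nonneg (by linarith)
        linarith
    · rw [min_eq_right hv, max_eq_right h12]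
      have : |v - τ 1| = v - τ 1 := abs_of_nonneg (by linarith)
      linarith

theorem mul_log_sub_le {N : ℝ} (hN : 0 ≤ N) : ∃ C : ℝ, ∀ X : ℝ, 0 ≤ X →
    N * Real.log (1 + X) ≤ C + Real.pi / 2 * X := by
  refine ⟨N * Real.log (N + 1), fun X hX => ?_⟩
  have h := Real.log_le_sub_one_of_pos (x := (1 + X) / (N + 1)) (by positivity)
  rw [Real.log_div (by positivity) (by positivity)] at h
  have h2 := mul_le_mul_of_nonneg_left h hN
  have h3 : N * ((1 + X) / (N + 1) - 1) ≤ X := by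
    rw [div_sub_one (by positivity), mul_div_assoc', div_le_iff₀ (by positivity)]
    nlinarith
  nlinarith [Real.pi_gt_three]

/-- The pointwise estimate of the Mellin-Barnes integrand. -/
theorem polyLog_sub_expDist_le {α β : Fin 3 → ℝ} {g δ e : ℝ} (he : 0 ≤ e)
    (H : Exponents α β g δ) : ∃ C : ℝ, ∀ (τ : Fin 3 → ℝ), τ 1 ≤ τ 0 → τ 2 ≤ τ 1 → ∀ u v : ℝ,
    ∃ i j, polyLog α β τ g u v - Real.pi / 2 * expDist τ u v + (1 + e) * logBr (u - τ i) +
      (1 + e) * logBr (v - τ j) ≤ C + boundLog τ g δ e - Real.pi / 2 * gapSum τ := by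
  -- A move by total distance X changes each logarithm by at most `log (1 + X)`, and that of u - v
  -- by at most twice as much. N is the resulting total of the absolute coefficients. The loss N
  -- log(1 + X) is absorbed by the excess of the exponential part, whose rate is π/2.
  set N := ∑ i, |α i - 1 / 2| + ∑ i, |β i - 1 / 2| + 2 * |1 / 2 - g| + 2 * (1 + e) with hN
  have hN0 : 0 ≤ N := by positivity
  obtain ⟨C, hC⟩ := mul_log_sub_le hN0
  refine ⟨stationaryConst α β g + C, fun τ h01 h12 => ?_⟩
  have key : ∀ u v u' v' X : ℝ, |u - u'| + |v - v'| ≤ X → ∀ i j,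
      polyLog α β τ g u v + (1 + e) * logBr (u - τ i) + (1 + e) * logBr (v - τ j) ≤
      polyLog α β τ g u' v' + (1 + e) * logBr (u' - τ i) + (1 + e) * logBr (v' - τ j) +
        N * Real.log (1 + X) := by
    intro u v u' v' X hX i j
    have hl1 : logBr (u - u') ≤ Real.log (1 + X) :=
      Real.log_le_log (by positivity) (by linarith [abs_nonneg (v - v')])
    have hl2 : logBr (v - v') ≤ Real.log (1 + X) :=
      Real.log_le_log (by positivity) (by linarith [abs_nonneg (u - u')])
    have d1 : ∀ i, |logBr (u - τ i) - logBr (u' - τ i)| ≤ Real.log (1 + X) := fun i => by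
      refine (abs_logBr_sub_le _ _).trans ?_
      rwa [sub_sub_sub_cancel_right]
    have d2 : ∀ i, |logBr (v - τ i) - logBr (v' - τ i)| ≤ Real.log (1 + X) := fun i => by
      refine (abs_logBr_sub_le _ _).trans ?_
      rwa [sub_sub_sub_cancel_right]
    have d3 : |logBr (u - v) - logBr (u' - v')| ≤ 2 * Real.log (1 + X) := by
      refine (abs_logBr_sub_le _ _).trans ?_
      have := logBr_add_le (u - u') (-(v - v'))
      rw [logBr_neg] at this
      rw [show u - v - (u' - v') = u - u' + -(v - v') by ring]
      linarith
    have f1 := fun i => mul_le_mul_add_abs (k := α i - 1 / 2) (d1 i)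
    have f2 := fun i => mul_le_mul_add_abs (k := β i - 1 / 2) (d2 i)
    have f3 := mul_le_mul_add_abs (k := 1 / 2 - g) d3
    have f4 := mul_le_mul_add_abs (k := 1 + e) (d1 i)
    have f5 := mul_le_mul_add_abs (k := 1 + e) (d2 j)
    have s1 := Finset.sum_le_sum fun i (_ : i ∈ Finset.univ) => f1 i
    have s2 := Finset.sum_le_sum fun i (_ : i ∈ Finset.univ) => f2 i
    rw [Finset.sum_add_distrib, ← Finset.sum_mul] at s1 s2
    rw [abs_of_nonneg (by linarith : 0 ≤ 1 + e)] at f4 f5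
    simp only [polyLog, hN]
    linarith
  have fin : ∀ u v u' v' : ℝ, |u - u'| + |v - v'| ≤ expDist τ u v - gapSum τ →
      (∃ i j, polyLog α β τ g u' v' + (1 + e) * logBr (u' - τ i) + (1 + e) * logBr (v' - τ j) ≤
      stationaryConst α β g + boundLog τ g δ e) →
      ∃ i j, polyLog α β τ g u v - Real.pi / 2 * expDist τ u v + (1 + e) * logBr (u - τ i) +
      (1 + e) * logBr (v - τ j) ≤
        stationaryConst α β g + C + boundLog τ g δ e - Real.pi / 2 * gapSum τ := by
    rintro u v u' v' hX ⟨i, j, hij⟩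
    refine ⟨i, j, ?_⟩
    have k := key u v u' v' _ hX i j
    have c := hC (expDist τ u v - gapSum τ) (by linarith [abs_nonneg (u - u'), abs_nonneg (v - v')])
    linarith
  intro u v
  rcases le_total v u with huv | huv
  · obtain ⟨u', v', h1, h2, h3, h4, h5⟩ := exists_clamp h01 h12 huv
    exact fin u v u' v' h5 (stationary_le he H h1 h2 h3 h4)
  · obtain ⟨v', u', h1, h2, h3, h4, h5⟩ := exists_clamp h01 h12 huv
    refine fin u v u' v' (by rw [add_comm, expDist_symm τ v u]; exact h5) ?_
    obtain ⟨i, j, hij⟩ := stationary_le he H.symm h1 h2 h3 h4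
    refine ⟨j, i, ?_⟩
    rw [stationaryConst_symm, polyLog_symm] at hij
    linarith

/-! ### The absolute Mellin–Barnes integral. -/

theorem gammaSize_eq_exp (x y : ℝ) :
    gammaSize x y = Real.exp ((x - 1 / 2) * logBr y - Real.pi / 2 * |y|) := by
  unfold gammaSize logBr
  rw [Real.rpow_def_of_pos (by positivity), ← Real.exp_add]
  ring_nf

/-- The absolute value of the Mellin-Barnes integrand. -/
def mbWeight (α β τ : Fin 3 → ℝ) (g u v : ℝ) : ℝ :=
  (∏ i, ‖Complex.Gamma (α i + (u - τ i : ℝ) * Complex.I)‖) *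
    (∏ i, ‖Complex.Gamma (β i + (v - τ i : ℝ) * Complex.I)‖) *
      ‖(Complex.Gamma (g + (u - v : ℝ) * Complex.I))⁻¹‖

theorem mbWeight_comp (α β τ : Fin 3 → ℝ) (g u v : ℝ) (w : Equiv.Perm (Fin 3)) :
    mbWeight (α ∘ w) (β ∘ w) (τ ∘ w) g u v = mbWeight α β τ g u v := by
  unfold mbWeight
  congr 2
  · exact Equiv.prod_comp w fun i => ‖Complex.Gamma (α i + (u - τ i : ℝ) * Complex.I)‖
  · exact Equiv.prod_comp w fun i => ‖Complex.Gamma (β i + (v - τ i : ℝ) * Complex.I)‖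

/-- Stirling is applied factor by factor. The gamma function in the denominator is what puts the
term -|u-v| into `expDist`, and the exponent 1/2 - g into `polyLog`. -/
theorem mbWeight_le {α β : Fin 3 → ℝ} (hα : ∀ i, 0 < α i) (hβ : ∀ i, 0 < β i) (g : ℝ) :
    ∃ C : ℝ, 0 < C ∧ ∀ (τ : Fin 3 → ℝ) (u v : ℝ), mbWeight α β τ g u v ≤
      C * Real.exp (polyLog α β τ g u v - Real.pi / 2 * expDist τ u v) := by
  choose A hA hA' using fun i => norm_Gamma_le (hα i)
  choose B hB hB' using fun i => norm_Gamma_le (hβ i)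
  obtain ⟨D, hD, hD'⟩ := norm_Gamma_inv_le g
  refine ⟨(∏ i, A i) * (∏ i, B i) * D, mul_pos (mul_pos (Finset.prod_pos fun i _ => hA i)
    (Finset.prod_pos fun i _ => hB i)) hD, fun τ u v => ?_⟩
  have h1 : ∏ i, ‖Complex.Gamma (α i + (u - τ i : ℝ) * Complex.I)‖ ≤
      ∏ i, (A i * gammaSize (α i) (u - τ i)) :=
    Finset.prod_le_prod (fun _ _ => norm_nonneg _) fun i _ => hA' i _
  have h2 : ∏ i, ‖Complex.Gamma (β i + (v - τ i : ℝ) * Complex.I)‖ ≤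
      ∏ i, (B i * gammaSize (β i) (v - τ i)) :=
    Finset.prod_le_prod (fun _ _ => norm_nonneg _) fun i _ => hB' i _
  have p1 : 0 ≤ ∏ i, (A i * gammaSize (α i) (u - τ i)) :=
    Finset.prod_nonneg fun i _ => (mul_pos (hA i) (gammaSize_pos _ _)).le
  have p2 : 0 ≤ ∏ i, (B i * gammaSize (β i) (v - τ i)) :=
    Finset.prod_nonneg fun i _ => (mul_pos (hB i) (gammaSize_pos _ _)).le
  calc mbWeight α β τ g u v ≤ (∏ i, (A i * gammaSize (α i) (u - τ i))) *
        (∏ i, (B i * gammaSize (β i) (v - τ i))) * (D * (gammaSize g (u - v))⁻¹) := by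
        unfold mbWeight
        gcongr
        exact hD' _
    _ = _ := by
        rw [Finset.prod_mul_distrib, Finset.prod_mul_distrib]
        simp only [gammaSize_eq_exp]
        rw [← Real.exp_sum, ← Real.exp_sum, ← Real.exp_neg,
          show ∀ a b c p q r : ℝ, a * p * (b * q) * (c * r) = a * b * c * (p * q * r) from
            fun _ _ _ _ _ _ => by ring, ← Real.exp_add, ← Real.exp_add]
        congr 2
        simp only [polyLog, expDist, Finset.sum_sub_distrib, ← Finset.mul_sum]
        ring

/-- An integrable weight. -/
def decayWeight (e x : ℝ) : ℝ := (1 + ‖x‖) ^ (-(1 + e))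

theorem decayWeight_nonneg (e x : ℝ) : 0 ≤ decayWeight e x := by unfold decayWeight; positivity

theorem decayWeight_eq_exp (e x : ℝ) : decayWeight e x = Real.exp (-((1 + e) * logBr x)) := by
  unfold decayWeight logBr
  rw [Real.rpow_def_of_pos (by positivity), Real.norm_eq_abs]
  ring_nf

theorem integrable_decayWeight {e : ℝ} (he : 0 < e) : Integrable (decayWeight e) :=
  integrable_one_add_norm (by simp; exact he)

theorem gapSum_comp (τ : Fin 3 → ℝ) (w : Equiv.Perm (Fin 3)) : gapSum (τ ∘ w) = gapSum τ := by
  have h : ∀ τ : Fin 3 → ℝ, 2 * gapSum τ = ∑ i, ∑ j, |τ i - τ j| := by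
    intro τ
    simp only [gapSum, Fin.sum_univ_three, sub_self, abs_zero]
    rw [abs_sub_comm (τ 1) (τ 0), abs_sub_comm (τ 2) (τ 0), abs_sub_comm (τ 2) (τ 1)]
    ring
  have e : ∑ i, ∑ j, |(τ ∘ w) i - (τ ∘ w) j| = ∑ i, ∑ j, |τ i - τ j| := by
    rw [← Equiv.sum_comp w (fun i => ∑ j, (|τ i - τ j|))]
    exact Finset.sum_congr rfl fun i _ => Equiv.sum_comp w fun j => |τ (w i) - τ j|
  linarith [h τ, h (τ ∘ w)]

theorem exists_perm_antitone (τ : Fin 3 → ℝ) :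
    ∃ w : Equiv.Perm (Fin 3), τ (w 1) ≤ τ (w 0) ∧ τ (w 2) ≤ τ (w 1) := by
  have h := Tuple.monotone_sort fun i => -τ i
  refine ⟨Tuple.sort fun i => -τ i, ?_, ?_⟩
  · simpa using h (show (0 : Fin 3) ≤ 1 by decide)
  · simpa using h (show (1 : Fin 3) ≤ 2 by decide)

/-- The majorant of the Mellin-Barnes integrand, with the variables separated. -/
theorem mbWeight_le_decay {α β : Fin 3 → ℝ} {g δ e : ℝ} (he : 0 ≤ e) (H : Exponents α β g δ) :
    ∃ C : ℝ, 0 < C ∧ ∀ (τ : Fin 3 → ℝ), ∃ w : Equiv.Perm (Fin 3),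
      τ (w 1) ≤ τ (w 0) ∧ τ (w 2) ≤ τ (w 1) ∧ ∀ u v : ℝ,
      mbWeight α β τ g u v ≤ C * Real.exp (boundLog (τ ∘ w) g δ e) *
        Real.exp (-(Real.pi / 2 * gapSum τ)) *
        ((∑ i, decayWeight e (u - τ i)) * (∑ i, decayWeight e (v - τ i))) := by
  choose C hC using fun w : Equiv.Perm (Fin 3) => polyLog_sub_expDist_le he (H.comp w)
  choose A hA hA' using fun w : Equiv.Perm (Fin 3) =>
    mbWeight_le (H.comp w).posα (H.comp w).posβ g
  -- The permutation sorting τ also permutes α and β, so the constants depend on it. Summing over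
  -- all of S₃ gives one constant valid for every τ.
  refine ⟨∑ w, A w * Real.exp (C w), Finset.sum_pos (fun w _ => mul_pos (hA w) (Real.exp_pos _))
    Finset.univ_nonempty, fun τ => ?_⟩
  obtain ⟨w, hw1, hw2⟩ := exists_perm_antitone τ
  refine ⟨w, hw1, hw2, fun u v => ?_⟩
  obtain ⟨i, j, hij⟩ := hC w (τ ∘ w) hw1 hw2 u v
  rw [gapSum_comp] at hij
  have hs1 : decayWeight e (u - τ (w i)) ≤ ∑ i, decayWeight e (u - τ i) :=
    Finset.single_le_sum (f := fun i => decayWeight e (u - τ i))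
      (fun _ _ => decayWeight_nonneg _ _) (Finset.mem_univ _)
  have hs2 : decayWeight e (v - τ (w j)) ≤ ∑ i, decayWeight e (v - τ i) :=
    Finset.single_le_sum (f := fun i => decayWeight e (v - τ i))
      (fun _ _ => decayWeight_nonneg _ _) (Finset.mem_univ _)
  have hCw : A w * Real.exp (C w) ≤ ∑ w, A w * Real.exp (C w) :=
    Finset.single_le_sum (f := fun w => A w * Real.exp (C w))
      (fun w _ => (mul_pos (hA w) (Real.exp_pos _)).le) (Finset.mem_univ w)
  rw [← mbWeight_comp α β τ g u v w]
  refine (hA' w _ u v).trans ?_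
  calc A w * Real.exp (polyLog (α ∘ w) (β ∘ w) (τ ∘ w) g u v -
        Real.pi / 2 * expDist (τ ∘ w) u v)
      ≤ A w * (Real.exp (C w) * Real.exp (boundLog (τ ∘ w) g δ e) *
        Real.exp (-(Real.pi / 2 * gapSum τ)) * (decayWeight e (u - τ (w i)) *
          decayWeight e (v - τ (w j)))) := by
        refine mul_le_mul_of_nonneg_left ?_ (hA w).le
        rw [decayWeight_eq_exp, decayWeight_eq_exp, ← Real.exp_add, ← Real.exp_add,
          ← Real.exp_add, ← Real.exp_add, Real.exp_le_exp]
        simp only [Function.comp_apply] at hij ⊢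
        linarith
    _ = (A w * Real.exp (C w)) * (Real.exp (boundLog (τ ∘ w) g δ e) *
        Real.exp (-(Real.pi / 2 * gapSum τ))) * (decayWeight e (u - τ (w i)) *
          decayWeight e (v - τ (w j))) := by ring
    _ ≤ (∑ w, A w * Real.exp (C w)) * (Real.exp (boundLog (τ ∘ w) g δ e) *
        Real.exp (-(Real.pi / 2 * gapSum τ))) * ((∑ i, decayWeight e (u - τ i)) *
          (∑ i, decayWeight e (v - τ i))) := by
        have := decayWeight_nonneg e (u - τ (w i))
        have := decayWeight_nonneg e (v - τ (w j))
        have := (mul_pos (hA w) (Real.exp_pos (C w))).le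
        have := this.trans hCw
        have := (decayWeight_nonneg e (u - τ (w i))).trans hs1
        gcongr
    _ = _ := by ring

theorem integral_decay_sum {e : ℝ} (he : 0 < e) (τ : Fin 3 → ℝ) :
    Integrable (fun u => ∑ i, decayWeight e (u - τ i)) ∧
      ∫ u, ∑ i, decayWeight e (u - τ i) = 3 * ∫ u, decayWeight e u := by
  have h := fun i => (integrable_decayWeight he).comp_sub_right (τ i)
  refine ⟨integrable_finsetSum _ fun i _ => h i, ?_⟩
  rw [integral_finsetSum _ fun i _ => h i]
  simp only [integral_sub_right_eq_self]
  simp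

/-- Integrals of functions dominated by the Mellin-Barnes integrand. -/
theorem integral_le_of_le_mbWeight {α β : Fin 3 → ℝ} {g δ e : ℝ} (he : 0 < e)
    (H : Exponents α β g δ) :
    ∃ C : ℝ, 0 < C ∧ ∀ (τ : Fin 3 → ℝ), ∃ w : Equiv.Perm (Fin 3),
      τ (w 1) ≤ τ (w 0) ∧ τ (w 2) ≤ τ (w 1) ∧ ∀ f : ℝ × ℝ → ℂ,
      (∀ p, ‖f p‖ ≤ mbWeight α β τ g p.1 p.2) →
      ‖∫ p, f p‖ ≤ C * Real.exp (boundLog (τ ∘ w) g δ e) *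
        Real.exp (-(Real.pi / 2 * gapSum τ)) := by
  obtain ⟨C, hC, h⟩ := mbWeight_le_decay he.le H
  have hI : 0 ≤ ∫ u, decayWeight e u := integral_nonneg fun u => decayWeight_nonneg e u
  refine ⟨C * ((3 * ∫ u, decayWeight e u) * (3 * ∫ u, decayWeight e u) + 1), by positivity,
    fun τ => ?_⟩
  obtain ⟨w, hw1, hw2, hb⟩ := h τ
  refine ⟨w, hw1, hw2, fun f hf => ?_⟩
  obtain ⟨i1, i2⟩ := integral_decay_sum he τ
  set K := C * Real.exp (boundLog (τ ∘ w) g δ e) * Real.exp (-(Real.pi / 2 * gapSum τ)) with hK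
  have hK0 : 0 ≤ K := by positivity
  calc ‖∫ p, f p‖ ≤ ∫ p : ℝ × ℝ, K * ((∑ i, decayWeight e (p.1 - τ i)) *
        (∑ i, decayWeight e (p.2 - τ i))) :=
        norm_integral_le_of_norm_le ((i1.mul_prod i1).const_mul K)
          (Eventually.of_forall fun p => (hf p).trans (hb p.1 p.2))
    _ = K * ((3 * ∫ u, decayWeight e u) * (3 * ∫ u, decayWeight e u)) := by
        rw [integral_const_mul, Measure.volume_eq_prod, integral_prod_mul
          (fun u => ∑ i, decayWeight e (u - τ i)) (fun u => ∑ i, decayWeight e (u - τ i)), i2]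
    _ ≤ K * ((3 * ∫ u, decayWeight e u) * (3 * ∫ u, decayWeight e u) + 1) := by
        gcongr; linarith
    _ = _ := by rw [hK]; ring

/-! ### Comparison with `Msym` and `LambdaPoly`. -/

theorem norm_one_add_I_mul (x : ℝ) : ‖(1 + Complex.I * (x : ℂ))‖ = Real.sqrt (1 + x ^ 2) := by
  have := Complex.norm_add_mul_I 1 x
  rw [mul_comm]; simpa using this

theorem one_add_abs_le_two_mul_norm (x : ℝ) : 1 + |x| ≤ 2 * ‖(1 + Complex.I * (x : ℂ))‖ := by
  rw [norm_one_add_I_mul]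
  have h1 : 1 ≤ Real.sqrt (1 + x ^ 2) := Real.one_le_sqrt.2 (by nlinarith)
  have h2 : |x| ≤ Real.sqrt (1 + x ^ 2) := Real.abs_le_sqrt (by linarith)
  linarith

theorem norm_le_one_add_abs (x : ℝ) : ‖(1 + Complex.I * (x : ℂ))‖ ≤ 1 + |x| := by
  refine (norm_add_le _ _).trans ?_
  simp

theorem norm_one_add_I_mul_pos (x : ℝ) : 0 < ‖(1 + Complex.I * (x : ℂ))‖ := by
  have := one_add_abs_le_two_mul_norm x
  linarith [abs_nonneg x]

/-- Comparison of `log ‖1 + ix‖` with `logBr` of a quantity of comparable size. -/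
theorem abs_log_norm_sub_logBr_le {x y k : ℝ} (hk : 1 ≤ k) (h₁ : |x| ≤ k * |y|)
    (h₂ : |y| ≤ k * |x|) :
    |Real.log ‖(1 + Complex.I * (x : ℂ))‖ - logBr y| ≤ Real.log (2 * k) := by
  have p := norm_one_add_I_mul_pos x
  rw [abs_le]
  constructor
  · have : logBr y ≤ Real.log (2 * k) + Real.log ‖(1 + Complex.I * (x : ℂ))‖ := by
      rw [← Real.log_mul (by positivity) p.ne']
      refine Real.log_le_log (by positivity) ?_
      have := one_add_abs_le_two_mul_norm x
      nlinarith
    linarith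
  · have : Real.log ‖(1 + Complex.I * (x : ℂ))‖ ≤ logBr y + Real.log (2 * k) := by
      unfold logBr
      rw [← Real.log_mul (by positivity) (by positivity)]
      refine Real.log_le_log p ?_
      have := norm_le_one_add_abs x
      nlinarith [abs_nonneg y]
    linarith

theorem Mpoly_eq_exp (a b c : ℝ) (μ : Fin 3 → ℂ) : Mpoly a b c μ =
    Real.exp (a * Real.log ‖1 + Complex.I * ((μ 0 - μ 1).im : ℂ)‖ +
      b * Real.log ‖1 + Complex.I * ((μ 0 - μ 2).im : ℂ)‖ +
      c * Real.log ‖1 + Complex.I * ((μ 1 - μ 2).im : ℂ)‖) := by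
  unfold Mpoly
  rw [Real.rpow_def_of_pos (norm_one_add_I_mul_pos _),
    Real.rpow_def_of_pos (norm_one_add_I_mul_pos _),
    Real.rpow_def_of_pos (norm_one_add_I_mul_pos _), ← Real.exp_add, ← Real.exp_add]
  ring_nf

theorem Mpoly_pos (a b c : ℝ) (μ : Fin 3 → ℂ) : 0 < Mpoly a b c μ := by
  rw [Mpoly_eq_exp]; exact Real.exp_pos _

theorem Mpoly_le_Msym (ε κ δ : ℝ) (μ : Fin 3 → ℂ) (w : Equiv.Perm (Fin 3)) :
    Mpoly ((κ - δ) / 2 + ε) ((κ - δ) / 2 + ε) (δ + ε) (μ ∘ w) ≤ Msym ε κ δ μ :=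
  Finset.single_le_sum (f := fun w : Equiv.Perm (Fin 3) =>
    Mpoly ((κ - δ) / 2 + ε) ((κ - δ) / 2 + ε) (δ + ε) (μ ∘ w))
    (fun _ _ => (Mpoly_pos _ _ _ _).le) (Finset.mem_univ w)

theorem Mpoly_lower {a c L S : ℝ} {ν : Fin 3 → ℂ}
    (h1 : |Real.log ‖1 + Complex.I * ((ν 0 - ν 1).im : ℂ)‖ - L| ≤ Real.log 8)
    (h2 : |Real.log ‖1 + Complex.I * ((ν 0 - ν 2).im : ℂ)‖ - L| ≤ Real.log 8)
    (h3 : |Real.log ‖1 + Complex.I * ((ν 1 - ν 2).im : ℂ)‖ - S| ≤ Real.log 8) :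
    Real.exp (2 * a * L + c * S) ≤
      Real.exp ((2 * |a| + |c|) * Real.log 8) * Mpoly a a c ν := by
  rw [Mpoly_eq_exp, ← Real.exp_add, Real.exp_le_exp]
  rw [abs_sub_comm] at h1 h2 h3
  have e1 := mul_le_mul_add_abs (k := a) h1
  have e2 := mul_le_mul_add_abs (k := a) h2
  have e3 := mul_le_mul_add_abs (k := c) h3
  linarith

/-- Among the three differences of the sorted imaginary parts, two are comparable to the larger gap
and the third is the smaller gap. One permutation of μ puts that third one last. -/
theorem exp_boundLog_le_Msym {g δ₀ δ e κ ε : ℝ}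
    (h : (2 * g - 1 / 2 - δ₀ + 2 * e) ≤ κ - δ + 2 * ε) (hδ : δ₀ ≤ δ + ε) :
    ∃ C : ℝ, 0 < C ∧ ∀ (μ : Fin 3 → ℂ) (w : Equiv.Perm (Fin 3)),
      (μ (w 1)).im ≤ (μ (w 0)).im → (μ (w 2)).im ≤ (μ (w 1)).im →
      Real.exp (boundLog ((fun i => (μ i).im / 2) ∘ w) g δ₀ e) ≤ C * Msym ε κ δ μ := by
  refine ⟨Real.exp ((2 * |(κ - δ) / 2 + ε| + |δ + ε|) * Real.log 8), Real.exp_pos _, ?_⟩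
  intro μ w h01 h12
  set τ : Fin 3 → ℝ := (fun i => (μ i).im / 2) ∘ w with hτ
  have im0 : (μ (w 0)).im = 2 * τ 0 := by simp [hτ]; ring
  have im1 : (μ (w 1)).im = 2 * τ 1 := by simp [hτ]; ring
  have im2 : (μ (w 2)).im = 2 * τ 2 := by simp [hτ]; ring
  have t01 : τ 1 ≤ τ 0 := by linarith
  have t12 : τ 2 ≤ τ 1 := by linarith
  have dA : |τ 0 - τ 1| = τ 0 - τ 1 := abs_of_nonneg (by linarith)
  have dB : |τ 1 - τ 2| = τ 1 - τ 2 := abs_of_nonneg (by linarith)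
  -- The 4 combines the factor 2 in Im μᵢ = 2τᵢ with the fact that the full span is at most twice
  -- the larger gap. A further 2 comes from comparing |1 + ix| with 1 + |x|, whence `log 8`.
  have key : ∀ x y : ℝ, |x| ≤ 4 * |y| → |y| ≤ 4 * |x| →
      |Real.log ‖(1 + Complex.I * (x : ℂ))‖ - logBr y| ≤ Real.log 8 := by
    intro x y h1 h2
    have := abs_log_norm_sub_logBr_le (by norm_num) h1 h2
    norm_num at this ⊢
    exact this
  set Λ := max (logBr (τ 0 - τ 1)) (logBr (τ 1 - τ 2)) with hΛ
  set S := min (logBr (τ 0 - τ 1)) (logBr (τ 1 - τ 2)) with hS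
  have hΛ0 : 0 ≤ Λ := le_max_of_le_left (logBr_nonneg _)
  have hS0 : 0 ≤ S := le_min (logBr_nonneg _) (logBr_nonneg _)
  have step : Real.exp (boundLog τ g δ₀ e) ≤
      Real.exp (2 * ((κ - δ) / 2 + ε) * Λ + (δ + ε) * S) := by
    rw [Real.exp_le_exp, boundLog]
    have a1 := mul_le_mul_of_nonneg_right h hΛ0
    have a2 := mul_le_mul_of_nonneg_right hδ hS0
    rw [← hΛ, ← hS]
    linarith
  refine step.trans ?_
  have red : ∀ w' : Equiv.Perm (Fin 3),
      |Real.log ‖1 + Complex.I * (((μ ∘ w') 0 - (μ ∘ w') 1).im : ℂ)‖ - Λ| ≤ Real.log 8 →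
      |Real.log ‖1 + Complex.I * (((μ ∘ w') 0 - (μ ∘ w') 2).im : ℂ)‖ - Λ| ≤ Real.log 8 →
      |Real.log ‖1 + Complex.I * (((μ ∘ w') 1 - (μ ∘ w') 2).im : ℂ)‖ - S| ≤ Real.log 8 →
      Real.exp (2 * ((κ - δ) / 2 + ε) * Λ + (δ + ε) * S) ≤
        Real.exp ((2 * |(κ - δ) / 2 + ε| + |δ + ε|) * Real.log 8) * Msym ε κ δ μ :=
    fun w' h1 h2 h3 => (Mpoly_lower h1 h2 h3).trans
      (mul_le_mul_of_nonneg_left (Mpoly_le_Msym _ _ _ _ _) (Real.exp_pos _).le)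
  rcases le_total (τ 1 - τ 2) (τ 0 - τ 1) with hc | hc
  · have hm : logBr (τ 1 - τ 2) ≤ logBr (τ 0 - τ 1) := logBr_mono (by rw [dA, dB]; linarith)
    rw [max_eq_left hm] at hΛ
    rw [min_eq_right hm] at hS
    refine red w ?_ ?_ ?_
    all_goals
      simp only [Function.comp_apply, Complex.sub_im, im0, im1, im2, hΛ, hS]
      apply key
    · rw [dA, abs_of_nonneg (by linarith)]; linarith
    · rw [dA, abs_of_nonneg (by linarith)]; linarith
    · rw [dA, abs_of_nonneg (by linarith)]; linarith
    · rw [dA, abs_of_nonneg (by linarith)]; linarith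
    · rw [dB, abs_of_nonneg (by linarith)]; linarith
    · rw [dB, abs_of_nonneg (by linarith)]; linarith
  · have hm : logBr (τ 0 - τ 1) ≤ logBr (τ 1 - τ 2) := logBr_mono (by rw [dA, dB]; linarith)
    rw [max_eq_right hm] at hΛ
    rw [min_eq_left hm] at hS
    have r0 : (finRotate 3).symm 0 = 2 := by decide
    have r1 : (finRotate 3).symm 1 = 0 := by decide
    have r2 : (finRotate 3).symm 2 = 1 := by decide
    -- The smaller gap is now τ₀ - τ₁. The inverse rotation sends 0, 1, 2 to 2, 0, 1, which moves
    -- this pair to the last two places.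
    refine red (w * (finRotate 3).symm) ?_ ?_ ?_
    all_goals
      simp only [Function.comp_apply, Equiv.Perm.coe_mul, r0, r1, r2, Complex.sub_im, im0, im1,
        im2, hΛ, hS]
      apply key
    · rw [dB, abs_of_nonpos (by linarith)]; linarith
    · rw [dB, abs_of_nonpos (by linarith)]; linarith
    · rw [dB, abs_of_nonpos (by linarith)]; linarith
    · rw [dB, abs_of_nonpos (by linarith)]; linarith
    · rw [dA, abs_of_nonneg (by linarith)]; linarith
    · rw [dA, abs_of_nonneg (by linarith)]; linarith

/-- The normalizing factor `1 / (Γ(a) Γ(b) Γ(c))`. -/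
def gammaFactor (μ : Fin 3 → ℂ) : ℂ :=
  (Complex.Gamma ((1 + μ 0 - μ 1) / 2))⁻¹ * (Complex.Gamma ((1 + μ 1 - μ 2) / 2))⁻¹ *
    (Complex.Gamma ((1 + μ 0 - μ 2) / 2))⁻¹

/-- At real part (1 + x)/2 the Stirling exponent is x/2, which is how the halved real parts enter
`LambdaPoly`. -/
theorem norm_Gamma_inv_le_rpow (x : ℝ) : ∃ C : ℝ, 0 < C ∧ ∀ z : ℂ, z.re = x →
    ‖(Complex.Gamma ((1 + z) / 2))⁻¹‖ ≤ C * ((‖1 + Complex.I * (z.im : ℂ)‖ ^ (x / 2))⁻¹ *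
      Real.exp (Real.pi / 2 * |z.im / 2|)) := by
  obtain ⟨C, hC, h⟩ := norm_Gamma_inv_le ((1 + x) / 2)
  refine ⟨C * Real.exp (|x / 2| * Real.log (2 * 2)), by positivity, fun z hz => ?_⟩
  have e : (1 + z) / 2 = (((1 + x) / 2 : ℝ) : ℂ) + (z.im / 2 : ℝ) * Complex.I := by
    conv_lhs => rw [← Complex.re_add_im z, hz]
    push_cast; ring
  rw [e]
  refine (h _).trans ?_
  rw [mul_assoc]
  refine mul_le_mul_of_nonneg_left ?_ hC.le
  rw [Real.rpow_def_of_pos (norm_one_add_I_mul_pos _), gammaSize_eq_exp, ← Real.exp_neg,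
    ← Real.exp_neg, ← Real.exp_add, ← Real.exp_add, Real.exp_le_exp]
  have h2 := abs_log_norm_sub_logBr_le (x := z.im) (y := z.im / 2) (k := 2) (by norm_num)
    (by rw [abs_div]; simp; linarith [abs_nonneg z.im])
    (by rw [abs_div]; simp; linarith [abs_nonneg z.im])
  have := mul_le_mul_add_abs (k := x / 2) h2
  linarith

/-- The three Stirling bounds multiply to the denominator of the final estimate. Their growth
exp((π/2) `gapSum`) is the exact inverse of the decay found for the Mellin–Barnes integral. -/
theorem norm_gammaFactor_le (η : Fin 3 → ℝ) : ∃ C : ℝ, 0 < C ∧ ∀ μ : Fin 3 → ℂ,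
    (∀ i, (μ i).re = η i) → ‖gammaFactor μ‖ ≤
      C * ((LambdaPoly μ)⁻¹ * Real.exp (Real.pi / 2 * gapSum fun i => (μ i).im / 2)) := by
  obtain ⟨A, hA, h1⟩ := norm_Gamma_inv_le_rpow (η 0 - η 1)
  obtain ⟨B, hB, h2⟩ := norm_Gamma_inv_le_rpow (η 1 - η 2)
  obtain ⟨D, hD, h3⟩ := norm_Gamma_inv_le_rpow (η 0 - η 2)
  refine ⟨A * B * D, by positivity, fun μ hμ => ?_⟩
  have k1 := h1 (μ 0 - μ 1) (by simp [hμ])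
  have k2 := h2 (μ 1 - μ 2) (by simp [hμ])
  have k3 := h3 (μ 0 - μ 2) (by simp [hμ])
  unfold gammaFactor LambdaPoly Mpoly gapSum
  rw [norm_mul, norm_mul, add_sub_assoc, add_sub_assoc, add_sub_assoc]
  refine (mul_le_mul (mul_le_mul k1 k2 (norm_nonneg _) (by positivity)) k3 (norm_nonneg _)
    (by positivity)).trans (le_of_eq ?_)
  simp only [Complex.sub_re, Complex.sub_im, hμ, mul_add, Real.exp_add, ← sub_div]
  field_simp

/-! ### Mellin inversion, Bessel integrals and beta integrals. -/

/-- Lebesgue measure on the positive half line. -/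
abbrev posMeas : Measure ℝ := volume.restrict (Set.Ioi 0)

theorem ae_posMeas_pos : ∀ᵐ v ∂posMeas, 0 < v := ae_restrict_mem measurableSet_Ioi

theorem integrable_rpow_mul_exp {a A : ℝ} (ha : 0 < a) (hA : 0 < A) :
    Integrable (fun m : ℝ => m ^ (a - 1) * Real.exp (-(A * m))) posMeas := by
  have h := integrableOn_rpow_mul_exp_neg_mul_rpow (p := 1) (s := a - 1) (b := A) (by linarith)
    one_pos hA
  refine h.congr ?_
  filter_upwards with m
  simp

theorem continuous_Gamma_vertical {x : ℝ} (hx : 0 < x) :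
    Continuous fun y : ℝ => Complex.Gamma (x + y * Complex.I) := by
  rw [continuous_iff_continuousAt]
  intro y
  have h : DifferentiableAt ℂ Complex.Gamma (x + y * Complex.I) :=
    Complex.differentiableAt_Gamma _ fun m hm => by
      have := congrArg Complex.re hm
      simp at this
      linarith [(Nat.cast_nonneg m : (0 : ℝ) ≤ m)]
  exact h.continuousAt.comp (f := fun y : ℝ => (x + y * Complex.I : ℂ)) (by fun_prop)

theorem norm_Gamma_le_decay {x : ℝ} (hx : 0 < x) :
    ∃ C : ℝ, ∀ y : ℝ, ‖Complex.Gamma (x + y * Complex.I)‖ ≤ C * decayWeight 1 y := by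
  obtain ⟨C, hC, h⟩ := norm_Gamma_le hx
  obtain ⟨D, hD⟩ := mul_log_sub_le (N := |x| + 2) (by positivity)
  refine ⟨C * Real.exp D, fun y => (h y).trans ?_⟩
  rw [mul_assoc, gammaSize_eq_exp, decayWeight_eq_exp, ← Real.exp_add]
  refine mul_le_mul_of_nonneg_left (Real.exp_le_exp.2 ?_) hC.le
  have := hD |y| (abs_nonneg y)
  have h2 : (x - 1 / 2 + 2) * logBr y ≤ (|x| + 2) * logBr y :=
    mul_le_mul_of_nonneg_right (by linarith [le_abs_self x]) (logBr_nonneg y)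
  have h3 : logBr y = Real.log (1 + |y|) := rfl
  rw [← h3] at this
  linarith

theorem integrable_Gamma_vertical {x : ℝ} (hx : 0 < x) :
    Integrable fun y : ℝ => Complex.Gamma (x + y * Complex.I) := by
  obtain ⟨C, hC⟩ := norm_Gamma_le_decay hx
  exact ((integrable_decayWeight one_pos).const_mul C).mono'
    (continuous_Gamma_vertical hx).aestronglyMeasurable (Eventually.of_forall hC)

theorem norm_Gamma_bounded {x : ℝ} (hx : 0 < x) :
    ∃ C : ℝ, ∀ y : ℝ, ‖Complex.Gamma (x + y * Complex.I)‖ ≤ C := by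
  obtain ⟨C, hC⟩ := norm_Gamma_le_decay hx
  have hC0 : 0 ≤ C := by
    have := (norm_nonneg _).trans (hC 0)
    simpa [decayWeight] using this
  refine ⟨C, fun y => (hC y).trans (mul_le_of_le_one_right hC0 ?_)⟩
  rw [decayWeight_eq_exp, Real.exp_le_one_iff]
  linarith [logBr_nonneg y]

/-- Mellin inversion for `exp (-X)`. -/
theorem exp_neg_eq_mellinInv {σ X : ℝ} (hσ : 0 < σ) (hX : 0 < X) :
    (Real.exp (-X) : ℂ) = (1 / (2 * Real.pi) : ℝ) *
      ∫ y : ℝ, (X : ℂ) ^ (-(σ + y * Complex.I)) * Complex.Gamma (σ + y * Complex.I) := by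
  have hG : ∀ s : ℂ, 0 < s.re →
      mellin (fun x : ℝ => (Real.exp (-x) : ℂ)) s = Complex.Gamma s := by
    intro s hs
    rw [Complex.Gamma_eq_integral hs, Complex.GammaIntegral_eq_mellin]
  have h := mellinInv_mellin_eq σ (fun x : ℝ => (Real.exp (-x) : ℂ)) hX ?_ ?_ (by fun_prop)
  · rw [← h, mellinInv, Complex.real_smul]
    congr 1
    refine integral_congr_ae (Eventually.of_forall fun y => ?_)
    simp only [smul_eq_mul]
    rw [hG _ (by simpa)]
  · have := Complex.GammaIntegral_convergent (s := σ) (by simpa)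
    refine this.congr_fun (fun x _ => ?_) measurableSet_Ioi
    simp [mul_comm]
  · refine (integrable_Gamma_vertical hσ).congr (Eventually.of_forall fun y => ?_)
    exact (hG _ (by simpa)).symm

/-- The integral `∫_0^∞ m^{z-1} exp (-A m - B / m) dm`, a Bessel function. -/
def besselInt (z : ℂ) (A B : ℝ) : ℂ :=
  ∫ m : ℝ, (m : ℂ) ^ (z - 1) * (Real.exp (-(A * m + B / m)) : ℂ) ∂posMeas

/-- Mellin inversion replaces exp(-B/m) by an integral of Γ(s) (B/m)^(-s). The m-integral is then a
gamma integral with parameter z + s. -/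
theorem besselInt_eq_mellinBarnes {z : ℂ} {A B σ : ℝ} (hA : 0 < A) (hB : 0 < B) (hσ : 0 < σ)
    (hσz : 0 < σ + z.re) :
    besselInt z A B = (1 / (2 * Real.pi) : ℝ) * ∫ y : ℝ, Complex.Gamma (σ + y * Complex.I) *
      Complex.Gamma (z + (σ + y * Complex.I)) * (A : ℂ) ^ (-(z + (σ + y * Complex.I))) *
      (B : ℂ) ^ (-(σ + y * Complex.I)) := by
  have e1 : besselInt z A B = (1 / (2 * Real.pi) : ℝ) * ∫ m : ℝ, (∫ y : ℝ,
      (m : ℂ) ^ (z + (σ + y * Complex.I) - 1) * Complex.exp (-(A * m)) *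
        (Complex.Gamma (σ + y * Complex.I) * (B : ℂ) ^ (-(σ + y * Complex.I)))) ∂posMeas := by
    rw [← integral_const_mul]
    refine integral_congr_ae ?_
    filter_upwards [ae_posMeas_pos] with m hm
    have hm' : (m : ℂ) ≠ 0 := Complex.ofReal_ne_zero.2 hm.ne'
    rw [neg_add, Real.exp_add, Complex.ofReal_mul, exp_neg_eq_mellinInv hσ (div_pos hB hm),
      show ∀ a b k J : ℂ, a * (b * (k * J)) = k * (a * b * J) from fun _ _ _ _ => by ring,
      ← integral_const_mul]
    congr 1
    refine integral_congr_ae (Eventually.of_forall fun y => ?_)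
    simp only
    rw [Complex.ofReal_div, Complex.div_cpow_ofReal_nonneg hB.le hm.le, add_sub_right_comm,
      Complex.cpow_add _ _ hm', Complex.cpow_neg (m : ℂ) (_ + _)]
    push_cast
    have : (m : ℂ) ^ (σ + y * Complex.I) ≠ 0 := by simp [Complex.cpow_eq_zero_iff, hm']
    field_simp
  have hint : Integrable (Function.uncurry fun (m y : ℝ) =>
      (m : ℂ) ^ (z + (σ + y * Complex.I) - 1) * Complex.exp (-(A * m)) *
        (Complex.Gamma (σ + y * Complex.I) * (B : ℂ) ^ (-(σ + y * Complex.I))))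
      (posMeas.prod volume) := by
    have b1 := integrable_rpow_mul_exp hσz hA
    have b2 := ((integrable_Gamma_vertical hσ).norm).mul_const (B ^ (-σ))
    refine (b1.mul_prod b2).mono' ?_ ?_
    · have := (continuous_Gamma_vertical hσ).measurable
      refine Measurable.aestronglyMeasurable ?_
      unfold Function.uncurry
      refine Measurable.mul (by fun_prop) (Measurable.mul ?_ (by fun_prop))
      exact this.comp measurable_snd
    · have hp : ∀ᵐ p : ℝ × ℝ ∂(posMeas.prod volume), 0 < p.1 :=
        Measure.quasiMeasurePreserving_fst.ae ae_posMeas_pos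
      filter_upwards [hp] with p hp
      simp only [Function.uncurry, norm_mul]
      rw [Complex.norm_cpow_eq_rpow_re_of_pos hp, Complex.norm_cpow_eq_rpow_re_of_pos hB,
        Complex.norm_exp]
      simp
      rw [add_comm σ]
  rw [e1, integral_integral_swap hint]
  congr 1
  refine integral_congr_ae (Eventually.of_forall fun y => ?_)
  simp only
  rw [integral_mul_const, Complex.integral_cpow_mul_exp_neg_mul_Ioi (by simpa [add_comm] using hσz)
    hA, one_div, Complex.inv_cpow, ← Complex.cpow_neg]
  · ring
  · rw [Complex.arg_ofReal_of_nonneg hA.le]; exact Real.pi_pos.ne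

/-- Integrated over t first, this kernel gives Γ(p+q) times the beta integral. Integrated over v
first, it gives Γ(p) Γ(q). Fubini needs this absolute convergence. -/
theorem integrable_beta_kernel {p q : ℂ} (hp : 0 < p.re) (hq : 0 < q.re) :
    Integrable (Function.uncurry fun (v t : ℝ) => (v : ℂ) ^ (p - 1) * ((t : ℂ) ^ (p + q - 1) *
      Complex.exp (-(((1 + v : ℝ) : ℂ) * t)))) (posMeas.prod posMeas) := by
  have hm : Measurable (Function.uncurry fun (v t : ℝ) => (v : ℂ) ^ (p - 1) *
      ((t : ℂ) ^ (p + q - 1) * Complex.exp (-(((1 + v : ℝ) : ℂ) * t)))) := by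
    unfold Function.uncurry; fun_prop
  have hn : ∀ v t : ℝ, 0 < v → 0 < t → ‖(v : ℂ) ^ (p - 1) * ((t : ℂ) ^ (p + q - 1) *
      Complex.exp (-(((1 + v : ℝ) : ℂ) * t)))‖ =
      v ^ (p.re - 1) * Real.exp (-(t * v)) * (t ^ (p.re + q.re - 1) * Real.exp (-t)) := by
    intro v t hv ht
    rw [norm_mul, norm_mul, Complex.norm_cpow_eq_rpow_re_of_pos hv,
      Complex.norm_cpow_eq_rpow_re_of_pos ht, Complex.norm_exp]
    have : (-(((1 + v : ℝ) : ℂ) * t)).re = -(t * v) + -t := by simp; ring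
    rw [this, Real.exp_add]
    simp
    ring
  rw [integrable_prod_iff' hm.aestronglyMeasurable]
  constructor
  · filter_upwards [ae_posMeas_pos] with t ht
    have hb := (integrable_rpow_mul_exp hp ht).mul_const (t ^ (p.re + q.re - 1) * Real.exp (-t))
    refine hb.mono' (hm.comp measurable_prodMk_right).aestronglyMeasurable ?_
    filter_upwards [ae_posMeas_pos] with v hv
    exact (hn v t hv ht).le
  · have hb := (integrable_rpow_mul_exp hq one_pos).const_mul (Real.Gamma p.re)
    refine hb.congr ?_
    filter_upwards [ae_posMeas_pos] with t ht
    simp only [Function.uncurry]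
    have : ∫ v, ‖(v : ℂ) ^ (p - 1) * ((t : ℂ) ^ (p + q - 1) *
        Complex.exp (-(((1 + v : ℝ) : ℂ) * t)))‖ ∂posMeas =
        ∫ v, v ^ (p.re - 1) * Real.exp (-(t * v)) * (t ^ (p.re + q.re - 1) * Real.exp (-t))
          ∂posMeas := by
      refine integral_congr_ae ?_
      filter_upwards [ae_posMeas_pos] with v hv
      exact hn v t hv ht
    rw [this, integral_mul_const, Real.integral_rpow_mul_exp_neg_mul_Ioi hp ht,
      show p.re + q.re - 1 = p.re + (q.re - 1) by ring, Real.rpow_add ht, one_div,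
      Real.inv_rpow ht.le]
    have : t ^ p.re ≠ 0 := (Real.rpow_pos_of_pos ht _).ne'
    field_simp

theorem beta_inner {p q : ℂ} (hp : 0 < p.re) (hq : 0 < q.re) {v : ℝ} (hv : 0 < v) :
    ∫ t : ℝ, (v : ℂ) ^ (p - 1) * ((t : ℂ) ^ (p + q - 1) *
      Complex.exp (-(((1 + v : ℝ) : ℂ) * t))) ∂posMeas =
      Complex.Gamma (p + q) * ((v : ℂ) ^ (p - 1) * ((1 + v : ℝ) : ℂ) ^ (-(p + q))) := by
  have h1 : 0 < 1 + v := by linarith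
  rw [integral_const_mul, Complex.integral_cpow_mul_exp_neg_mul_Ioi (by simp; linarith) h1,
    one_div, Complex.inv_cpow, ← Complex.cpow_neg]
  · ring
  · rw [Complex.arg_ofReal_of_nonneg h1.le]; exact Real.pi_pos.ne

/-- The beta integral over the half line. -/
theorem integral_beta_Ioi {p q : ℂ} (hp : 0 < p.re) (hq : 0 < q.re) :
    ∫ v : ℝ, (v : ℂ) ^ (p - 1) * ((1 + v : ℝ) : ℂ) ^ (-(p + q)) ∂posMeas =
      Complex.Gamma p * Complex.Gamma q * (Complex.Gamma (p + q))⁻¹ := by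
  have hG : Complex.Gamma (p + q) ≠ 0 := Complex.Gamma_ne_zero_of_re_pos (by simp; linarith)
  have h := integral_integral_swap (integrable_beta_kernel hp hq)
  have h1 : ∫ v : ℝ, (∫ t : ℝ, (v : ℂ) ^ (p - 1) * ((t : ℂ) ^ (p + q - 1) *
      Complex.exp (-(((1 + v : ℝ) : ℂ) * t))) ∂posMeas) ∂posMeas =
      Complex.Gamma (p + q) * ∫ v : ℝ, (v : ℂ) ^ (p - 1) * ((1 + v : ℝ) : ℂ) ^ (-(p + q))
        ∂posMeas := by
    rw [← integral_const_mul]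
    refine integral_congr_ae ?_
    filter_upwards [ae_posMeas_pos] with v hv
    exact beta_inner hp hq hv
  have h2 : ∫ t : ℝ, (∫ v : ℝ, (v : ℂ) ^ (p - 1) * ((t : ℂ) ^ (p + q - 1) *
      Complex.exp (-(((1 + v : ℝ) : ℂ) * t))) ∂posMeas) ∂posMeas =
      Complex.Gamma p * Complex.Gamma q := by
    rw [Complex.Gamma_eq_integral hq, Complex.GammaIntegral, ← integral_const_mul]
    refine integral_congr_ae ?_
    filter_upwards [ae_posMeas_pos] with t ht
    have ht' : (t : ℂ) ≠ 0 := Complex.ofReal_ne_zero.2 ht.ne'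
    have : ∀ v : ℝ, (v : ℂ) ^ (p - 1) * ((t : ℂ) ^ (p + q - 1) *
        Complex.exp (-(((1 + v : ℝ) : ℂ) * t))) = (v : ℂ) ^ (p - 1) * Complex.exp (-(t * v)) *
        ((t : ℂ) ^ (p + q - 1) * Complex.exp (-t)) := by
      intro v
      rw [show -(((1 + v : ℝ) : ℂ) * t) = -(t * v) + -t by push_cast; ring, Complex.exp_add]
      ring
    simp_rw [this]
    rw [integral_mul_const, Complex.integral_cpow_mul_exp_neg_mul_Ioi hp ht,
      one_div, Complex.inv_cpow, ← Complex.cpow_neg, show p + q - 1 = p + (q - 1) by ring,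
      Complex.cpow_add _ _ ht', Complex.cpow_neg]
    · have : (t : ℂ) ^ p ≠ 0 := by simp [Complex.cpow_eq_zero_iff, ht']
      push_cast
      field_simp
    · rw [Complex.arg_ofReal_of_nonneg ht.le]; exact Real.pi_pos.ne
  rw [h1, h2] at h
  rw [← h]
  field_simp

theorem integrable_beta_Ioi {p q : ℝ} (hp : 0 < p) (hq : 0 < q) :
    Integrable (fun v : ℝ => v ^ (p - 1) * (1 + v) ^ (-(p + q))) posMeas := by
  have h := (integrable_beta_kernel (p := p) (q := q) (by simpa) (by simpa)).integral_prod_left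
  have hG : Complex.Gamma (p + q) ≠ 0 := Complex.Gamma_ne_zero_of_re_pos (by simp; linarith)
  refine ((h.const_mul (Complex.Gamma (p + q))⁻¹).norm).congr ?_
  filter_upwards [ae_posMeas_pos] with v hv
  simp only [Function.uncurry]
  rw [beta_inner (by simpa) (by simpa) hv, inv_mul_cancel_left₀ hG, norm_mul,
    Complex.norm_cpow_eq_rpow_re_of_pos hv, Complex.norm_cpow_eq_rpow_re_of_pos (by linarith)]
  simp

/-! ### The triple integral: convergence, Mellin–Barnes form, holomorphy. -/

/-- Lebesgue measure on the positive octant. -/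
abbrev octMeas : Measure (ℝ × ℝ × ℝ) := posMeas.prod (posMeas.prod posMeas)

theorem ae_octMeas_pos : ∀ᵐ p ∂octMeas, 0 < p.1 ∧ 0 < p.2.1 ∧ 0 < p.2.2 := by
  have h1 : ∀ᵐ p ∂octMeas, 0 < p.1 := Measure.quasiMeasurePreserving_fst.ae ae_posMeas_pos
  have h2 : ∀ᵐ p ∂octMeas, 0 < p.2.1 ∧ 0 < p.2.2 := by
    refine Measure.quasiMeasurePreserving_snd.ae (p := fun q : ℝ × ℝ => 0 < q.1 ∧ 0 < q.2) ?_
    filter_upwards [(Measure.quasiMeasurePreserving_fst (μ := posMeas) (ν := posMeas)).ae ae_posMeas_pos,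
      (Measure.quasiMeasurePreserving_snd (μ := posMeas) (ν := posMeas)).ae ae_posMeas_pos] with q a b
    exact ⟨a, b⟩
  filter_upwards [h1, h2] with p a b
  exact ⟨a, b⟩

/-- The exponential kernel of the triple integral; the variables are `(v, m, w)`. -/
def tripleKernel (y p : ℝ × ℝ × ℝ) : ℝ :=
  Real.exp (-(1 * p.2.1 + y.2.1 * (1 + p.1) / p.2.1)) *
    Real.exp (-(y.1 * (1 + p.1) * p.2.2 + y.2.2 / p.1 / p.2.2))

theorem tripleKernel_nonneg (y p : ℝ × ℝ × ℝ) : 0 ≤ tripleKernel y p := by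
  unfold tripleKernel; positivity

theorem measurable_tripleKernel : Measurable (Function.uncurry tripleKernel) := by
  unfold tripleKernel Function.uncurry; fun_prop

theorem exp_neg_le_rpow {N : ℝ} (hN : 0 ≤ N) : ∃ C : ℝ, 0 < C ∧ ∀ X : ℝ, 0 < X →
    Real.exp (-X) ≤ C * X ^ (-N) := by
  refine ⟨(N + 1) ^ N, by positivity, fun X hX => ?_⟩
  have h := Real.log_le_sub_one_of_pos (x := X / (N + 1)) (by positivity)
  rw [Real.log_div hX.ne' (by positivity)] at h
  have h2 := mul_le_mul_of_nonneg_left h hN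
  have h3 : N * (X / (N + 1) - 1) ≤ X := by
    rw [div_sub_one (by positivity), mul_div_assoc', div_le_iff₀ (by positivity)]
    nlinarith
  rw [Real.rpow_def_of_pos hX, Real.rpow_def_of_pos (by positivity : 0 < N + 1),
    ← Real.exp_add, Real.exp_le_exp]
  linarith

/-- The exponentials in 1/(vw) and (1+v)/m decay faster than any power, so no restriction on x or z
is needed. This unconditional convergence is what makes the continuation entire. -/
theorem integrable_triple {y : ℝ × ℝ × ℝ} (h1 : 0 < y.1) (h2 : 0 < y.2.1) (h3 : 0 < y.2.2)
    (x z : ℝ) : Integrable (fun p : ℝ × ℝ × ℝ => p.1 ^ (x - 1) * (p.2.1 ^ (z - 1) *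
      p.2.2 ^ (z - 1)) * tripleKernel y p) octMeas := by
  -- The power s makes x + s and z + s positive. Then s' = x + 2s is the exponent for which the
  -- v-factor becomes the beta integrand with parameters x + s and s.
  set s := |x| + |z| + 1 with hs
  have hs0 : 0 < s := by positivity
  have hxs : 0 < x + s := by linarith [neg_abs_le x, abs_nonneg z]
  have hzs : 0 < z + s := by linarith [neg_abs_le z, abs_nonneg x]
  set s' := x + s + s with hs'
  have hs'0 : 0 < s' := by positivity
  have hzs' : 0 < z + s' := by linarith
  obtain ⟨C, hC, hC'⟩ := exp_neg_le_rpow hs0.le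
  obtain ⟨D, hD, hD'⟩ := exp_neg_le_rpow hs'0.le
  have b1 := integrable_beta_Ioi hxs hs0
  have b2 := integrable_rpow_mul_exp hzs' one_pos
  have b3 := integrable_rpow_mul_exp hzs h1
  refine ((b1.mul_prod (b2.mul_prod b3)).const_mul
    (C * y.2.2 ^ (-s) * (D * y.2.1 ^ (-s')))).mono' ?_ ?_
  · have : Measurable (tripleKernel y) := measurable_tripleKernel.comp measurable_prodMk_left
    refine Measurable.aestronglyMeasurable (Measurable.mul (by fun_prop) this)
  filter_upwards [ae_octMeas_pos] with p hp
  obtain ⟨hv, hm, hw⟩ := hp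
  have hv1 : 0 < 1 + p.1 := by linarith
  have k1 := hC' (y.2.2 / p.1 / p.2.2) (by positivity)
  have k2 := hD' (y.2.1 * (1 + p.1) / p.2.1) (by positivity)
  have k3 : Real.exp (-(y.1 * (1 + p.1) * p.2.2)) ≤ Real.exp (-(y.1 * p.2.2)) := by
    rw [Real.exp_le_exp]; nlinarith [mul_pos (mul_pos h1 hv) hw]
  rw [Real.norm_of_nonneg (by have := tripleKernel_nonneg y p; positivity)]
  unfold tripleKernel
  rw [neg_add, neg_add, Real.exp_add, Real.exp_add]
  have e1 : (y.2.2 / p.1 / p.2.2) ^ (-s) = y.2.2 ^ (-s) * p.1 ^ s * p.2.2 ^ s := by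
    rw [Real.div_rpow (by positivity) hw.le, Real.div_rpow h3.le hv.le, Real.rpow_neg hv.le,
      Real.rpow_neg hw.le]
    field_simp
  have e2 : (y.2.1 * (1 + p.1) / p.2.1) ^ (-s') =
      y.2.1 ^ (-s') * (1 + p.1) ^ (-s') * p.2.1 ^ s' := by
    rw [Real.div_rpow (by positivity) hm.le, Real.mul_rpow h2.le hv1.le, Real.rpow_neg hm.le]
    field_simp
  rw [e1] at k1
  rw [e2] at k2
  calc _ ≤ p.1 ^ (x - 1) * (p.2.1 ^ (z - 1) * p.2.2 ^ (z - 1)) *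
        (Real.exp (-(1 * p.2.1)) * (D * (y.2.1 ^ (-s') * (1 + p.1) ^ (-s') * p.2.1 ^ s')) *
        (Real.exp (-(y.1 * p.2.2)) * (C * (y.2.2 ^ (-s) * p.1 ^ s * p.2.2 ^ s)))) := by
        gcongr
    _ = _ := by
        rw [← hs']
        clear_value s s'
        rw [show x + s - 1 = (x - 1) + s by ring, show z + s' - 1 = (z - 1) + s' by ring,
          show z + s - 1 = (z - 1) + s by ring, Real.rpow_add hv, Real.rpow_add hm,
          Real.rpow_add hw]
        ring

/-- The triple integral; `y` stands for the parameters `(y₁², π² y₂², π²)`. -/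
def tripleInt (y : ℝ × ℝ × ℝ) (x z : ℂ) : ℂ :=
  ∫ p : ℝ × ℝ × ℝ, (p.1 : ℂ) ^ (x - 1) * ((p.2.1 : ℂ) ^ (z - 1) * (p.2.2 : ℂ) ^ (z - 1)) *
    (tripleKernel y p : ℂ) ∂octMeas

theorem integrable_tripleInt {y : ℝ × ℝ × ℝ} (h1 : 0 < y.1) (h2 : 0 < y.2.1) (h3 : 0 < y.2.2)
    (x z : ℂ) : Integrable (fun p : ℝ × ℝ × ℝ => (p.1 : ℂ) ^ (x - 1) *
      ((p.2.1 : ℂ) ^ (z - 1) * (p.2.2 : ℂ) ^ (z - 1)) * (tripleKernel y p : ℂ)) octMeas := by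
  refine (integrable_triple h1 h2 h3 x.re z.re).mono' ?_ ?_
  · have : Measurable (tripleKernel y) := measurable_tripleKernel.comp measurable_prodMk_left
    exact Measurable.aestronglyMeasurable (Measurable.mul (by fun_prop) this.complex_ofReal)
  filter_upwards [ae_octMeas_pos] with p hp
  obtain ⟨hv, hm, hw⟩ := hp
  rw [norm_mul, norm_mul, norm_mul, Complex.norm_cpow_eq_rpow_re_of_pos hv,
    Complex.norm_cpow_eq_rpow_re_of_pos hm, Complex.norm_cpow_eq_rpow_re_of_pos hw,
    Complex.norm_real, Real.norm_of_nonneg (tripleKernel_nonneg y p)]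
  simp

theorem stronglyMeasurable_tripleInt (x z : ℂ) :
    StronglyMeasurable fun y : ℝ × ℝ × ℝ => tripleInt y x z := by
  refine StronglyMeasurable.integral_prod_right' (f := fun q : (ℝ × ℝ × ℝ) × (ℝ × ℝ × ℝ) =>
    (q.2.1 : ℂ) ^ (x - 1) * ((q.2.2.1 : ℂ) ^ (z - 1) * (q.2.2.2 : ℂ) ^ (z - 1)) *
    (tripleKernel q.1 q.2 : ℂ)) ?_
  have : Measurable fun q : (ℝ × ℝ × ℝ) × (ℝ × ℝ × ℝ) => tripleKernel q.1 q.2 :=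
    measurable_tripleKernel
  exact (Measurable.mul (by fun_prop) this.complex_ofReal).stronglyMeasurable

theorem tripleInt_eq_besselInt {y : ℝ × ℝ × ℝ} (h1 : 0 < y.1) (h2 : 0 < y.2.1) (h3 : 0 < y.2.2)
    (x z : ℂ) : tripleInt y x z = ∫ v : ℝ, (v : ℂ) ^ (x - 1) *
      (besselInt z 1 (y.2.1 * (1 + v)) * besselInt z (y.1 * (1 + v)) (y.2.2 / v)) ∂posMeas := by
  unfold tripleInt
  rw [integral_prod _ (integrable_tripleInt h1 h2 h3 x z)]
  refine integral_congr_ae (Eventually.of_forall fun v => ?_)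
  simp only [besselInt]
  rw [← integral_prod_mul, ← integral_const_mul]
  refine integral_congr_ae (Eventually.of_forall fun q => ?_)
  simp only [tripleKernel]
  push_cast
  ring

/-- The part of the Mellin-Barnes integrand that does not depend on the variable `v`. -/
def mbCoeff (y : ℝ × ℝ × ℝ) (z : ℂ) (σ σ' : ℝ) (p : ℝ × ℝ) : ℂ :=
  ((y.2.1 : ℂ) ^ (-(σ' + p.2 * Complex.I)) * (y.1 : ℂ) ^ (-(z + (σ + p.1 * Complex.I))) *
    (y.2.2 : ℂ) ^ (-(σ + p.1 * Complex.I))) * (Complex.Gamma (σ + p.1 * Complex.I) *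
      Complex.Gamma (z + (σ + p.1 * Complex.I)) * (Complex.Gamma (σ' + p.2 * Complex.I) *
      Complex.Gamma (z + (σ' + p.2 * Complex.I))))

/-- The part of the Mellin-Barnes integrand that depends on the variable `v`. -/
def mbKernel (x z : ℂ) (σ σ' v : ℝ) (p : ℝ × ℝ) : ℂ :=
  (v : ℂ) ^ (x + (σ + p.1 * Complex.I) - 1) *
    ((1 + v : ℝ) : ℂ) ^ (-(x + (σ + p.1 * Complex.I) + (z - x + (σ' + p.2 * Complex.I))))

theorem besselInt_mul_besselInt {y : ℝ × ℝ × ℝ} (h1 : 0 < y.1) (h2 : 0 < y.2.1)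
    (h3 : 0 < y.2.2) {x z : ℂ} {σ σ' v : ℝ} (hσ : 0 < σ) (hσ' : 0 < σ') (hσz : 0 < σ + z.re)
    (hσ'z : 0 < σ' + z.re) (hv : 0 < v) :
    (v : ℂ) ^ (x - 1) *
      (besselInt z 1 (y.2.1 * (1 + v)) * besselInt z (y.1 * (1 + v)) (y.2.2 / v)) =
    ((1 / (2 * Real.pi) : ℝ) * (1 / (2 * Real.pi) : ℝ)) *
      ∫ p : ℝ × ℝ, mbKernel x z σ σ' v p * mbCoeff y z σ σ' p := by
  have hv1 : 0 < 1 + v := by linarith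
  have hv' : (v : ℂ) ≠ 0 := Complex.ofReal_ne_zero.2 hv.ne'
  have hv1' : ((1 + v : ℝ) : ℂ) ≠ 0 := Complex.ofReal_ne_zero.2 hv1.ne'
  rw [besselInt_eq_mellinBarnes one_pos (by positivity) hσ' hσ'z,
    besselInt_eq_mellinBarnes (by positivity) (by positivity) hσ hσz,
    show ∀ a b J J' : ℂ, a * (b * J' * (b * J)) = (b * b) * (a * (J * J')) from
      fun _ _ _ _ => by ring, ← integral_prod_mul, ← integral_const_mul]
  congr 1
  refine integral_congr_ae (Eventually.of_forall fun p => ?_)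
  simp only [mbKernel, mbCoeff]
  rw [Complex.ofReal_one, Complex.one_cpow, Complex.ofReal_mul y.1,
    Complex.mul_cpow_ofReal_nonneg h1.le hv1.le, Complex.ofReal_mul y.2.1,
    Complex.mul_cpow_ofReal_nonneg h2.le hv1.le, Complex.ofReal_div,
    Complex.div_cpow_ofReal_nonneg h3.le hv.le,
    show x + (σ + p.1 * Complex.I) - 1 = (x - 1) + (σ + p.1 * Complex.I) by ring,
    show -(x + (σ + p.1 * Complex.I) + (z - x + (σ' + p.2 * Complex.I))) =
      -(z + (σ + p.1 * Complex.I)) + -(σ' + p.2 * Complex.I) by ring,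
    Complex.cpow_add _ _ hv', Complex.cpow_add _ _ hv1', Complex.cpow_neg (v : ℂ),
    div_inv_eq_mul]
  ring

theorem add_vertical (z : ℂ) (ρ t : ℝ) : z + (ρ + t * Complex.I) =
    ((ρ + z.re : ℝ) : ℂ) + ((t + z.im : ℝ) : ℂ) * Complex.I := by
  conv_lhs => rw [← Complex.re_add_im z]
  push_cast; ring

theorem measurable_mbCoeff {y : ℝ × ℝ × ℝ} {z : ℂ} {σ σ' : ℝ} (hσ : 0 < σ) (hσ' : 0 < σ')
    (hσz : 0 < σ + z.re) (hσ'z : 0 < σ' + z.re) : Measurable (mbCoeff y z σ σ') := by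
  have m1 := (continuous_Gamma_vertical hσ).measurable
  have m2 := (continuous_Gamma_vertical hσ').measurable
  have m3 := (continuous_Gamma_vertical hσz).measurable
  have m4 := (continuous_Gamma_vertical hσ'z).measurable
  unfold mbCoeff
  simp only [add_vertical z]
  refine Measurable.mul (by fun_prop) (Measurable.mul
    (Measurable.mul ?_ ?_) (Measurable.mul ?_ ?_))
  · exact m1.comp measurable_fst
  · exact m3.comp (f := fun q : ℝ × ℝ => q.1 + z.im) (by fun_prop)
  · exact m2.comp measurable_snd
  · exact m4.comp (f := fun q : ℝ × ℝ => q.2 + z.im) (by fun_prop)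

theorem integrable_mbCoeff {y : ℝ × ℝ × ℝ} (h1 : 0 < y.1) (h2 : 0 < y.2.1)
    (h3 : 0 < y.2.2) {z : ℂ} {σ σ' : ℝ} (hσ : 0 < σ) (hσ' : 0 < σ')
    (hσz : 0 < σ + z.re) (hσ'z : 0 < σ' + z.re) : Integrable (mbCoeff y z σ σ') := by
  obtain ⟨A, hA⟩ := norm_Gamma_bounded hσz
  obtain ⟨B, hB⟩ := norm_Gamma_bounded hσ'z
  have b2 := ((integrable_Gamma_vertical hσ).norm).mul_prod ((integrable_Gamma_vertical hσ').norm)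
  refine (b2.const_mul ((y.2.1 ^ (-σ') * y.1 ^ (-(z.re + σ)) * y.2.2 ^ (-σ)) * (A * B))).mono'
    (measurable_mbCoeff hσ hσ' hσz hσ'z).aestronglyMeasurable (Eventually.of_forall fun q => ?_)
  have n1 := hA (q.1 + z.im)
  have n2 := hB (q.2 + z.im)
  rw [← add_vertical] at n1 n2
  have hA0 := (norm_nonneg _).trans n1
  simp only [mbCoeff, norm_mul]
  rw [Complex.norm_cpow_eq_rpow_re_of_pos h2, Complex.norm_cpow_eq_rpow_re_of_pos h1,
    Complex.norm_cpow_eq_rpow_re_of_pos h3]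
  have r3 : (-(σ' + q.2 * Complex.I) : ℂ).re = -σ' := by simp
  have r4 : (-(z + (σ + q.1 * Complex.I))).re = -(z.re + σ) := by simp
  have r5 : (-(σ + q.1 * Complex.I) : ℂ).re = -σ := by simp
  rw [r3, r4, r5, mul_assoc (_ * _ * _) (A * B)]
  refine mul_le_mul_of_nonneg_left ?_ (by positivity)
  calc _ ≤ ‖Complex.Gamma (σ + q.1 * Complex.I)‖ * A *
        (‖Complex.Gamma (σ' + q.2 * Complex.I)‖ * B) := by gcongr
    _ = _ := by ring

theorem integrable_mbKernel_mul {y : ℝ × ℝ × ℝ} (h1 : 0 < y.1) (h2 : 0 < y.2.1)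
    (h3 : 0 < y.2.2) {x z : ℂ} {σ σ' : ℝ} (hσ : 0 < σ) (hσ' : 0 < σ') (hσz : 0 < σ + z.re)
    (hσ'z : 0 < σ' + z.re) (hσx : 0 < σ + x.re) (hσ'x : 0 < σ' + (z.re - x.re)) :
    Integrable (Function.uncurry fun v p => mbKernel x z σ σ' v p * mbCoeff y z σ σ' p)
      (posMeas.prod (volume : Measure (ℝ × ℝ))) := by
  refine ((integrable_beta_Ioi hσx hσ'x).mul_prod
    (integrable_mbCoeff h1 h2 h3 hσ hσ' hσz hσ'z).norm).mono' ?_ ?_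
  · refine Measurable.aestronglyMeasurable (Measurable.mul ?_
      ((measurable_mbCoeff hσ hσ' hσz hσ'z).comp measurable_snd))
    unfold mbKernel
    fun_prop
  · have hp : ∀ᵐ q ∂(posMeas.prod (volume : Measure (ℝ × ℝ))), 0 < q.1 :=
      Measure.quasiMeasurePreserving_fst.ae ae_posMeas_pos
    filter_upwards [hp] with q hv
    have hv1 : 0 < 1 + q.1 := by linarith
    simp only [mbKernel, Function.uncurry, norm_mul]
    rw [Complex.norm_cpow_eq_rpow_re_of_pos hv, Complex.norm_cpow_eq_rpow_re_of_pos hv1]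
    have r1 : (x + (σ + q.2.1 * Complex.I) - 1).re = σ + x.re - 1 := by simp; ring
    have r2 : (-(x + (σ + q.2.1 * Complex.I) + (z - x + (σ' + q.2.2 * Complex.I)))).re =
      -(σ + x.re + (σ' + (z.re - x.re))) := by simp; ring
    rw [r1, r2]

/-- The Mellin-Barnes representation of the triple integral. -/
theorem tripleInt_eq_mellinBarnes {y : ℝ × ℝ × ℝ} (h1 : 0 < y.1) (h2 : 0 < y.2.1)
    (h3 : 0 < y.2.2) {x z : ℂ} {σ σ' : ℝ} (hσ : 0 < σ) (hσ' : 0 < σ') (hσz : 0 < σ + z.re)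
    (hσ'z : 0 < σ' + z.re) (hσx : 0 < σ + x.re) (hσ'x : 0 < σ' + (z.re - x.re)) :
    tripleInt y x z = ((1 / (2 * Real.pi) : ℝ) * (1 / (2 * Real.pi) : ℝ)) * ∫ p : ℝ × ℝ,
      Complex.Gamma (x + (σ + p.1 * Complex.I)) * Complex.Gamma (z - x + (σ' + p.2 * Complex.I)) *
      (Complex.Gamma (z + (σ + p.1 * Complex.I) + (σ' + p.2 * Complex.I)))⁻¹ *
        mbCoeff y z σ σ' p := by
  have e1 : tripleInt y x z = ((1 / (2 * Real.pi) : ℝ) * (1 / (2 * Real.pi) : ℝ)) *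
      ∫ v : ℝ, (∫ p : ℝ × ℝ, mbKernel x z σ σ' v p * mbCoeff y z σ σ' p) ∂posMeas := by
    rw [tripleInt_eq_besselInt h1 h2 h3, ← integral_const_mul]
    refine integral_congr_ae ?_
    filter_upwards [ae_posMeas_pos] with v hv
    exact besselInt_mul_besselInt h1 h2 h3 hσ hσ' hσz hσ'z hv
  -- For fixed Mellin variables the v-integral is a beta integral. It supplies the two remaining
  -- numerator gammas and the denominator.
  rw [e1, integral_integral_swap
    (integrable_mbKernel_mul h1 h2 h3 hσ hσ' hσz hσ'z hσx hσ'x)]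
  congr 1
  refine integral_congr_ae (Eventually.of_forall fun p => ?_)
  simp only [mbKernel]
  rw [integral_mul_const, integral_beta_Ioi (by simp; linarith) (by simp; linarith)]
  rw [show x + (σ + p.1 * Complex.I) + (z - x + (σ' + p.2 * Complex.I)) =
    z + (σ + p.1 * Complex.I) + (σ' + p.2 * Complex.I) by ring]

/-- Differentiation under the integral sign for exponential families. -/
theorem differentiable_integral_exp {Ω : Type*} [MeasurableSpace Ω] {ν : Measure Ω}
    {A B k : Ω → ℝ} (hA : Measurable A) (hB : Measurable B) (hk : Measurable k)
    (hk0 : ∀ ω, 0 ≤ k ω)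
    (h : ∀ a b : ℝ, Integrable (fun ω => Real.exp (a * A ω + b * B ω) * k ω) ν) :
    Differentiable ℂ fun z : ℂ × ℂ => ∫ ω, Complex.exp (z.1 * A ω + z.2 * B ω) * (k ω : ℂ) ∂ν := by
  intro z₀
  set L : Ω → (ℂ × ℂ →L[ℂ] ℂ) := fun ω => (A ω : ℂ) • ContinuousLinearMap.fst ℂ ℂ ℂ +
    (B ω : ℂ) • ContinuousLinearMap.snd ℂ ℂ ℂ with hL
  have hLn : ∀ ω, ‖L ω‖ ≤ |A ω| + |B ω| := by
    intro ω
    refine (norm_add_le _ _).trans (add_le_add ?_ ?_)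
    · rw [norm_smul]
      refine (mul_le_of_le_one_right (norm_nonneg _) (ContinuousLinearMap.norm_fst_le ℂ ℂ ℂ)).trans ?_
      simp
    · rw [norm_smul]
      refine (mul_le_of_le_one_right (norm_nonneg _) (ContinuousLinearMap.norm_snd_le ℂ ℂ ℂ)).trans ?_
      simp
  have hn : ∀ (z : ℂ × ℂ) ω, ‖Complex.exp (z.1 * A ω + z.2 * B ω) * (k ω : ℂ)‖ =
      Real.exp (z.1.re * A ω + z.2.re * B ω) * k ω := by
    intro z ω
    rw [norm_mul, Complex.norm_exp, Complex.norm_real, Real.norm_of_nonneg (hk0 ω)]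
    simp
  have hm : ∀ z : ℂ × ℂ, Measurable fun ω => Complex.exp (z.1 * A ω + z.2 * B ω) * (k ω : ℂ) := by
    intro z; fun_prop
  set a := z₀.1.re with ha
  set b := z₀.2.re with hb
  -- On the unit ball the exponential grows by at most e^(|A|+|B|), and the derivative costs a
  -- factor |A|+|B|, which is bounded by the same quantity. The resulting e^(2(|A|+|B|)) is one of
  -- four exponentials according to the signs of A and B, and the bound is the sum of all four.
  refine (hasFDerivAt_integral_of_dominated_of_fderiv_le
    (F' := fun z ω => (Complex.exp (z.1 * A ω + z.2 * B ω) * (k ω : ℂ)) • L ω)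
    (bound := fun ω => Real.exp ((a + 2) * A ω + (b + 2) * B ω) * k ω +
      Real.exp ((a + 2) * A ω + (b - 2) * B ω) * k ω +
      (Real.exp ((a - 2) * A ω + (b + 2) * B ω) * k ω +
      Real.exp ((a - 2) * A ω + (b - 2) * B ω) * k ω))
    (Metric.ball_mem_nhds z₀ one_pos) ?_ ?_ ?_ ?_ ?_ ?_).differentiableAt
  · exact Eventually.of_forall fun z => (hm z).aestronglyMeasurable
  · refine (h a b).mono' (hm z₀).aestronglyMeasurable (Eventually.of_forall fun ω => ?_)
    exact (hn z₀ ω).le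
  · refine AEStronglyMeasurable.smul (hm z₀).aestronglyMeasurable ?_
    refine AEStronglyMeasurable.add ?_ ?_
    · exact (hA.complex_ofReal.aestronglyMeasurable).smul_const _
    · exact (hB.complex_ofReal.aestronglyMeasurable).smul_const _
  · refine Eventually.of_forall fun ω z hz => ?_
    rw [norm_smul, hn]
    have d1 : |z.1.re - a| ≤ 1 := by
      have := Complex.abs_re_le_norm (z.1 - z₀.1)
      have h2 := norm_fst_le (z - z₀)
      rw [mem_ball_iff_norm] at hz
      simp only [Complex.sub_re, Prod.fst_sub] at this h2
      linarith
    have d2 : |z.2.re - b| ≤ 1 := by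
      have := Complex.abs_re_le_norm (z.2 - z₀.2)
      have h2 := norm_snd_le (z - z₀)
      rw [mem_ball_iff_norm] at hz
      simp only [Complex.sub_re, Prod.snd_sub] at this h2
      linarith
    have q1 : (z.1.re - a) * A ω ≤ |A ω| := by
      refine (le_abs_self _).trans ?_
      rw [abs_mul]; exact mul_le_of_le_one_left (abs_nonneg _) d1
    have q2 : (z.2.re - b) * B ω ≤ |B ω| := by
      refine (le_abs_self _).trans ?_
      rw [abs_mul]; exact mul_le_of_le_one_left (abs_nonneg _) d2
    have q3 : |A ω| + |B ω| ≤ Real.exp (|A ω| + |B ω|) := by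
      linarith [Real.add_one_le_exp (|A ω| + |B ω|)]
    have q4 : Real.exp (z.1.re * A ω + z.2.re * B ω) ≤
        Real.exp (a * A ω + b * B ω + (|A ω| + |B ω|)) := by
      rw [Real.exp_le_exp]; linarith
    have key : Real.exp (z.1.re * A ω + z.2.re * B ω) * k ω * ‖L ω‖ ≤
        Real.exp (a * A ω + b * B ω + 2 * (|A ω| + |B ω|)) * k ω := by
      calc _ ≤ Real.exp (a * A ω + b * B ω + (|A ω| + |B ω|)) * k ω *
            Real.exp (|A ω| + |B ω|) := by
            have := hk0 ω
            gcongr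
            exact (hLn ω).trans q3
        _ = _ := by
            rw [mul_right_comm, ← Real.exp_add]; ring_nf
    refine key.trans ?_
    have k0 := hk0 ω
    have p1 : 0 ≤ Real.exp ((a + 2) * A ω + (b + 2) * B ω) * k ω := by positivity
    have p2 : 0 ≤ Real.exp ((a + 2) * A ω + (b - 2) * B ω) * k ω := by positivity
    have p3 : 0 ≤ Real.exp ((a - 2) * A ω + (b + 2) * B ω) * k ω := by positivity
    have p4 : 0 ≤ Real.exp ((a - 2) * A ω + (b - 2) * B ω) * k ω := by positivity
    rcases abs_cases (A ω) with ⟨e1, _⟩ | ⟨e1, _⟩ <;> rcases abs_cases (B ω) with ⟨e2, _⟩ | ⟨e2, _⟩ <;>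
      rw [e1, e2]
    · rw [show a * A ω + b * B ω + 2 * (A ω + B ω) = (a + 2) * A ω + (b + 2) * B ω by ring]
      linarith
    · rw [show a * A ω + b * B ω + 2 * (A ω + -B ω) = (a + 2) * A ω + (b - 2) * B ω by ring]
      linarith
    · rw [show a * A ω + b * B ω + 2 * (-A ω + B ω) = (a - 2) * A ω + (b + 2) * B ω by ring]
      linarith
    · rw [show a * A ω + b * B ω + 2 * (-A ω + -B ω) = (a - 2) * A ω + (b - 2) * B ω by ring]
      linarith
  · exact ((h _ _).add (h _ _)).add ((h _ _).add (h _ _))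
  · refine Eventually.of_forall fun ω z _ => ?_
    have e : HasFDerivAt (fun z : ℂ × ℂ => z.1 * (A ω : ℂ) + z.2 * (B ω : ℂ)) (L ω) z :=
      (hasFDerivAt_fst.mul_const (A ω : ℂ)).add (hasFDerivAt_snd.mul_const (B ω : ℂ))
    have := e.cexp.mul_const (k ω : ℂ)
    rwa [smul_smul, mul_comm] at this

theorem differentiable_tripleInt {y : ℝ × ℝ × ℝ} (h1 : 0 < y.1) (h2 : 0 < y.2.1)
    (h3 : 0 < y.2.2) : Differentiable ℂ fun q : ℂ × ℂ => tripleInt y q.1 q.2 := by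
  have hK : Measurable (tripleKernel y) := measurable_tripleKernel.comp measurable_prodMk_left
  -- The powers are written as exponentials of logarithms, and m and w share the exponent z. The
  -- shifts by -1 in the exponents go into the positive weight k.
  have h := differentiable_integral_exp (ν := octMeas) (A := fun p => Real.log p.1)
    (B := fun p => Real.log p.2.1 + Real.log p.2.2)
    (k := fun p => Real.exp (-(Real.log p.1 + (Real.log p.2.1 + Real.log p.2.2))) *
      tripleKernel y p) (by fun_prop) (by fun_prop) (by fun_prop)
    (fun p => mul_nonneg (Real.exp_pos _).le (tripleKernel_nonneg y p)) ?_
  · convert h using 2 with q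
    refine integral_congr_ae ?_
    filter_upwards [ae_octMeas_pos] with p hp
    obtain ⟨hv, hm, hw⟩ := hp
    rw [Complex.cpow_def_of_ne_zero (Complex.ofReal_ne_zero.2 hv.ne'),
      Complex.cpow_def_of_ne_zero (Complex.ofReal_ne_zero.2 hm.ne'),
      Complex.cpow_def_of_ne_zero (Complex.ofReal_ne_zero.2 hw.ne'), ← Complex.ofReal_log hv.le,
      ← Complex.ofReal_log hm.le, ← Complex.ofReal_log hw.le, Complex.ofReal_mul,
      Complex.ofReal_exp, ← Complex.exp_add, ← Complex.exp_add, ← mul_assoc, ← Complex.exp_add]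
    congr 2
    push_cast
    ring
  · intro a b
    refine (integrable_triple h1 h2 h3 a b).congr ?_
    filter_upwards [ae_octMeas_pos] with p hp
    obtain ⟨hv, hm, hw⟩ := hp
    rw [Real.rpow_def_of_pos hv, Real.rpow_def_of_pos hm, Real.rpow_def_of_pos hw,
      ← Real.exp_add, ← Real.exp_add, ← mul_assoc, ← Real.exp_add]
    congr 2
    ring

/-! ### Gaussian Fourier integrals. -/

theorem gaussian_fourier {P : ℝ} (hP : 0 < P) (ξ : ℝ) :
    Integrable (fun t : ℝ => Complex.exp (-(P : ℂ) * t ^ 2 + (2 * Real.pi * ξ * Complex.I) * t)) ∧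
    ∫ t : ℝ, Complex.exp (-(P : ℂ) * t ^ 2 + (2 * Real.pi * ξ * Complex.I) * t) =
      (Real.sqrt (Real.pi / P) * Real.exp (-(Real.pi ^ 2 * ξ ^ 2 / P)) : ℝ) := by
  have hb : (-(P : ℂ)).re < 0 := by simpa
  have h1 := integrable_cexp_quadratic' hb (2 * Real.pi * ξ * Complex.I) 0
  have h2 := integral_cexp_quadratic hb (2 * Real.pi * ξ * Complex.I) 0
  simp only [add_zero] at h1 h2
  refine ⟨h1, ?_⟩
  rw [h2, neg_neg, Complex.ofReal_mul, Real.sqrt_eq_rpow, Complex.ofReal_cpow (by positivity)]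
  have hP' : (P : ℂ) ≠ 0 := Complex.ofReal_ne_zero.2 hP.ne'
  congr 1
  · push_cast; rfl
  · push_cast
    congr 1
    rw [mul_pow, Complex.I_sq]
    field_simp
    ring

theorem norm_gaussian_fourier (P ξ t : ℝ) :
    ‖Complex.exp (-(P : ℂ) * t ^ 2 + (2 * Real.pi * ξ * Complex.I) * t)‖ =
      Real.exp (-P * t ^ 2) := by
  rw [Complex.norm_exp]
  congr 1
  have : (-(P : ℂ) * t ^ 2 + (2 * Real.pi * ξ * Complex.I) * t) =
    ((-P * t ^ 2 : ℝ) : ℂ) + ((2 * Real.pi * ξ * t : ℝ) : ℂ) * Complex.I := by push_cast; ring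
  rw [this, Complex.add_re, Complex.ofReal_re, Complex.re_ofReal_mul, Complex.I_re, mul_zero,
    add_zero]

theorem gaussian_normalized {R : ℝ} (hR : 0 < R) (s : ℝ) :
    Integrable (fun t : ℝ => Real.sqrt R * Real.exp (-R * (t - s) ^ 2)) ∧
    ∫ t : ℝ, Real.sqrt R * Real.exp (-R * (t - s) ^ 2) = Real.sqrt Real.pi := by
  refine ⟨((integrable_exp_neg_mul_sq hR).comp_sub_right s).const_mul _, ?_⟩
  rw [integral_const_mul, integral_sub_right_eq_self (fun t => Real.exp (-R * t ^ 2)),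
    integral_gaussian, ← Real.sqrt_mul hR.le]
  congr 1
  field_simp

theorem gaussian_normalized_complex {R : ℝ} (hR : 0 < R) (s : ℝ) :
    Integrable (fun t : ℝ => ((Real.sqrt R * Real.exp (-R * (t - s) ^ 2) : ℝ) : ℂ)) ∧
    ∫ t : ℝ, ((Real.sqrt R * Real.exp (-R * (t - s) ^ 2) : ℝ) : ℂ) = (Real.sqrt Real.pi : ℝ) ∧
    ∫ t : ℝ, ‖((Real.sqrt R * Real.exp (-R * (t - s) ^ 2) : ℝ) : ℂ)‖ = Real.sqrt Real.pi := by
  obtain ⟨h1, h2⟩ := gaussian_normalized hR s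
  refine ⟨h1.ofReal, by rw [integral_complex_ofReal, h2], ?_⟩
  rw [← h2]
  refine integral_congr_ae (Eventually.of_forall fun r => ?_)
  simp only [Complex.norm_real]
  exact Real.norm_of_nonneg (by positivity)

/-- Fubini with a kernel whose fibre integrals are constant. -/
theorem integral_prod_of_fiber {α β : Type*} [MeasurableSpace α] [MeasurableSpace β]
    {ν : Measure α} {ν' : Measure β} [SFinite ν] [SFinite ν'] {g : α → ℂ} {K : α × β → ℂ} {c : ℂ}
    {c' : ℝ} (hK : Measurable K) (hg : Integrable g ν)
    (h1 : ∀ a, Integrable (fun b => K (a, b)) ν') (hI : ∀ a, ∫ b, K (a, b) ∂ν' = c)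
    (hN : ∀ a, ∫ b, ‖K (a, b)‖ ∂ν' = c') :
    Integrable (fun q => g q.1 * K q) (ν.prod ν') ∧
      ∫ q, g q.1 * K q ∂(ν.prod ν') = (∫ a, g a ∂ν) * c ∧
      ∫ q, ‖g q.1 * K q‖ ∂(ν.prod ν') = (∫ a, ‖g a‖ ∂ν) * c' := by
  have hint : Integrable (fun q => g q.1 * K q) (ν.prod ν') := by
    have hm : AEStronglyMeasurable (fun q => g q.1 * K q) (ν.prod ν') :=
      hg.1.comp_fst.mul hK.aestronglyMeasurable
    refine (integrable_prod_iff hm).2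
      ⟨Eventually.of_forall fun a => (h1 a).const_mul (g a), (hg.norm.mul_const c').congr ?_⟩
    refine Eventually.of_forall fun a => ?_
    simp only [norm_mul]
    rw [integral_const_mul, hN]
  refine ⟨hint, ?_, ?_⟩
  · rw [integral_prod _ hint, ← integral_mul_const]
    refine integral_congr_ae (Eventually.of_forall fun a => ?_)
    simp only
    rw [integral_const_mul, hI]
  · rw [integral_prod _ hint.norm, ← integral_mul_const]
    refine integral_congr_ae (Eventually.of_forall fun a => ?_)
    simp only [norm_mul]
    rw [integral_const_mul, hN]

/-- The sheared Gaussian in three variables. -/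
def gaussian₃ (P Q k ξ : ℝ) (R : ℝ → ℝ) (x : ℝ × ℝ × ℝ) : ℂ :=
  Complex.exp (-(P : ℂ) * x.1 ^ 2 + (2 * Real.pi * ξ * Complex.I) * x.1) *
    (Complex.exp (-(Q : ℂ) * x.2.1 ^ 2 + (2 * Real.pi * ξ * Complex.I) * x.2.1) *
      (Real.sqrt (R x.1) * Real.exp (-R x.1 * (x.2.2 - k * x.1 * x.2.1) ^ 2) : ℝ))

/-- Integrated over x₃ first, the normalized Gaussian gives √π whatever its centre and width, so the
shear and the dependence of R on x₁ disappear. The variables x₁ and x₂ then separate. -/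
theorem gaussian₃_integral {P Q : ℝ} (hP : 0 < P) (hQ : 0 < Q) (k ξ : ℝ) {R : ℝ → ℝ}
    (hR : ∀ t, 0 < R t) (hRm : Measurable R) :
    Integrable (gaussian₃ P Q k ξ R) ∧
    ∫ x, gaussian₃ P Q k ξ R x =
      ((Real.sqrt (Real.pi / P) * Real.exp (-(Real.pi ^ 2 * ξ ^ 2 / P))) *
        ((Real.sqrt (Real.pi / Q) * Real.exp (-(Real.pi ^ 2 * ξ ^ 2 / Q))) * Real.sqrt Real.pi) :
        ℝ) ∧
    ∫ x, ‖gaussian₃ P Q k ξ R x‖ =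
      Real.sqrt (Real.pi / P) * (Real.sqrt (Real.pi / Q) * Real.sqrt Real.pi) := by
  have inner := fun t : ℝ => integral_prod_of_fiber (ν := (volume : Measure ℝ))
    (ν' := (volume : Measure ℝ))
    (K := fun q : ℝ × ℝ =>
      ((Real.sqrt (R t) * Real.exp (-R t * (q.2 - k * t * q.1) ^ 2) : ℝ) : ℂ))
    (by fun_prop) (gaussian_fourier hQ ξ).1
    (fun s => (gaussian_normalized_complex (hR t) (k * t * s)).1)
    (fun s => (gaussian_normalized_complex (hR t) (k * t * s)).2.1)
    (fun s => (gaussian_normalized_complex (hR t) (k * t * s)).2.2)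
  have h := integral_prod_of_fiber (ν := (volume : Measure ℝ)) (ν' := (volume : Measure (ℝ × ℝ)))
    (K := fun x : ℝ × ℝ × ℝ =>
      Complex.exp (-(Q : ℂ) * x.2.1 ^ 2 + (2 * Real.pi * ξ * Complex.I) * x.2.1) *
      ((Real.sqrt (R x.1) * Real.exp (-R x.1 * (x.2.2 - k * x.1 * x.2.1) ^ 2) : ℝ) : ℂ))
    (by fun_prop) (gaussian_fourier hP ξ).1 (fun t => (inner t).1) (fun t => (inner t).2.1)
    (fun t => (inner t).2.2)
  refine ⟨h.1, h.2.1.trans ?_, h.2.2.trans ?_⟩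
  · rw [(gaussian_fourier hP ξ).2, (gaussian_fourier hQ ξ).2]
    push_cast; ring
  · simp only [norm_gaussian_fourier]
    rw [integral_gaussian, integral_gaussian]

/-! ### From Jacquet's integral to the triple integral. -/

/-- The scaled beta integral. -/
theorem integral_beta_scaled {a b : ℂ} (ha : 0 < a.re) (hb : 0 < b.re) {D₁ D₂ : ℝ} (h₁ : 0 < D₁)
    (h₂ : 0 < D₂) :
    ∫ v : ℝ, (v : ℂ) ^ (a - 1) * ((v * D₂ + D₁ : ℝ) : ℂ) ^ (-(a + b)) ∂posMeas =
      (D₂ : ℂ) ^ (-a) * (D₁ : ℂ) ^ (-b) *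
        (Complex.Gamma a * Complex.Gamma b * (Complex.Gamma (a + b))⁻¹) := by
  have hr : 0 < D₂ / D₁ := by positivity
  have h := integral_comp_mul_left_Ioi
    (fun u : ℝ => (u : ℂ) ^ (a - 1) * ((1 + u : ℝ) : ℂ) ^ (-(a + b))) 0 hr
  rw [mul_zero, integral_beta_Ioi ha hb] at h
  have h₁' : (D₁ : ℂ) ≠ 0 := Complex.ofReal_ne_zero.2 h₁.ne'
  have h₂' : (D₂ : ℂ) ≠ 0 := Complex.ofReal_ne_zero.2 h₂.ne'
  have e : ∀ᵐ v : ℝ ∂posMeas, (v : ℂ) ^ (a - 1) * ((v * D₂ + D₁ : ℝ) : ℂ) ^ (-(a + b)) =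
      ((D₂ : ℂ) ^ (-(a - 1)) * (D₁ : ℂ) ^ (-(b + 1))) *
      (((D₂ / D₁ * v : ℝ) : ℂ) ^ (a - 1) * ((1 + D₂ / D₁ * v : ℝ) : ℂ) ^ (-(a + b))) := by
    filter_upwards [ae_posMeas_pos] with v hv
    have hq : 0 < 1 + D₂ / D₁ * v := by positivity
    rw [show v * D₂ + D₁ = D₁ * (1 + D₂ / D₁ * v) by field_simp; ring, Complex.ofReal_mul D₁,
      Complex.mul_cpow_ofReal_nonneg h₁.le hq.le, Complex.ofReal_mul (D₂ / D₁) v,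
      Complex.mul_cpow_ofReal_nonneg hr.le hv.le, Complex.ofReal_div,
      Complex.div_cpow_ofReal_nonneg h₂.le h₁.le, Complex.cpow_neg (D₂ : ℂ),
      show -(a + b) = -(b + 1) + -(a - 1) by ring, Complex.cpow_add (x := (D₁ : ℂ)) _ _ h₁',
      Complex.cpow_neg (D₁ : ℂ) (a - 1)]
    have q1 : (D₁ : ℂ) ^ (a - 1) ≠ 0 := by simp [Complex.cpow_eq_zero_iff, h₁']
    have q2 : (D₂ : ℂ) ^ (a - 1) ≠ 0 := by simp [Complex.cpow_eq_zero_iff, h₂']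
    field_simp
  rw [integral_congr_ae e, integral_const_mul, h, Complex.real_smul]
  have q3 : (D₂ : ℂ) ^ (-a) = (D₂ : ℂ) ^ (-(a - 1)) * (D₂ : ℂ)⁻¹ := by
    rw [← Complex.cpow_neg_one, ← Complex.cpow_add _ _ h₂']; ring_nf
  have q4 : (D₁ : ℂ) ^ (-b) = (D₁ : ℂ) ^ (-(b + 1)) * (D₁ : ℂ) := by
    nth_rewrite 3 [← Complex.cpow_one (D₁ : ℂ)]
    rw [← Complex.cpow_add _ _ h₁']; ring_nf
  rw [q3, q4]
  push_cast
  field_simp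

/-- The quadratic form in the Gaussian integral over `x₁`. -/
def auxN (y : ℝ × ℝ) (v x₁ : ℝ) : ℝ := y.1 ^ 2 * (1 + v) + v * x₁ ^ 2

/-- The squared norm of the last row of `w_l x y`. -/
def delta₁ (y : ℝ × ℝ) (x : ℝ × ℝ × ℝ) : ℝ :=
  y.1 ^ 2 * y.2 ^ 2 + x.2.1 ^ 2 * y.1 ^ 2 + x.2.2 ^ 2

/-- The squared norm of the exterior product of the last two rows of `w_l x y`, up to `y₁²`. -/
def delta₂ (y : ℝ × ℝ) (x : ℝ × ℝ × ℝ) : ℝ :=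
  y.1 ^ 2 * y.2 ^ 2 + y.2 ^ 2 * x.1 ^ 2 + (x.1 * x.2.1 - x.2.2) ^ 2

theorem delta₁_pos {y : ℝ × ℝ} (h1 : 0 < y.1) (h2 : 0 < y.2) (x : ℝ × ℝ × ℝ) :
    0 < delta₁ y x := by unfold delta₁; positivity

theorem delta₂_pos {y : ℝ × ℝ} (h1 : 0 < y.1) (h2 : 0 < y.2) (x : ℝ × ℝ × ℝ) :
    0 < delta₂ y x := by unfold delta₂; positivity

theorem auxN_pos {y : ℝ × ℝ} (h1 : 0 < y.1) {v : ℝ} (hv : 0 < v) (t : ℝ) : 0 < auxN y v t := by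
  unfold auxN; positivity

theorem cpow_ofReal_eq_exp {r : ℝ} (hr : 0 < r) (s : ℂ) :
    (r : ℂ) ^ s = Complex.exp ((Real.log r : ℂ) * s) := by
  rw [Complex.cpow_def_of_ne_zero (Complex.ofReal_ne_zero.2 hr.ne'), Complex.ofReal_log hr.le]

/-- The lower right minors of g gᵀ are `delta₁`, y₁² `delta₂` and (y₁² y₂)². Taking logarithms turns
the power function into an identity linear in μ. -/
theorem powerFn_eq {y : ℝ × ℝ} (h1 : 0 < y.1) (h2 : 0 < y.2) (x : ℝ × ℝ × ℝ) {μ : Fin 3 → ℂ}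
    (hμ : μ 0 + μ 1 + μ 2 = 0) :
    powerFn (rho + μ) (longWeyl * unip x * torus y) =
      (y.1 : ℂ) ^ (1 - μ 2) * (y.2 : ℂ) ^ (1 + μ 0) * ((delta₂ y x : ℝ) : ℂ) ^ (-((1 + μ 0 - μ 1) / 2)) *
        ((delta₁ y x : ℝ) : ℂ) ^ (-((1 + μ 1 - μ 2) / 2)) := by
  have p1 := delta₁_pos h1 h2 x
  have p2 := delta₂_pos h1 h2 x
  obtain ⟨a, b⟩ := y
  obtain ⟨x₁, x₂, x₃⟩ := x
  simp only at h1 h2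
  have e1 : ((longWeyl * unip (x₁, x₂, x₃) * torus (a, b)) *
      (longWeyl * unip (x₁, x₂, x₃) * torus (a, b)).transpose) 2 2 = delta₁ (a, b) (x₁, x₂, x₃) := by
    simp [longWeyl, unip, torus, Matrix.mul_apply, Fin.sum_univ_three, delta₁]; ring
  have e2 : ((longWeyl * unip (x₁, x₂, x₃) * torus (a, b)) *
      (longWeyl * unip (x₁, x₂, x₃) * torus (a, b)).transpose) 1 1 *
      ((longWeyl * unip (x₁, x₂, x₃) * torus (a, b)) *
      (longWeyl * unip (x₁, x₂, x₃) * torus (a, b)).transpose) 2 2 -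
      ((longWeyl * unip (x₁, x₂, x₃) * torus (a, b)) *
      (longWeyl * unip (x₁, x₂, x₃) * torus (a, b)).transpose) 1 2 *
      ((longWeyl * unip (x₁, x₂, x₃) * torus (a, b)) *
      (longWeyl * unip (x₁, x₂, x₃) * torus (a, b)).transpose) 2 1 =
      a ^ 2 * delta₂ (a, b) (x₁, x₂, x₃) := by
    simp [longWeyl, unip, torus, Matrix.mul_apply, Fin.sum_univ_three, delta₂]; ring
  have e3 : ((longWeyl * unip (x₁, x₂, x₃) * torus (a, b)) *
      (longWeyl * unip (x₁, x₂, x₃) * torus (a, b)).transpose).det = (a ^ 2 * b) ^ 2 := by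
    rw [Matrix.det_mul, Matrix.det_transpose]
    simp [longWeyl, unip, torus, Matrix.det_fin_three]; ring
  simp only [powerFn, iwasawaY]
  rw [e2, e3, e1]
  set d1 := delta₁ (a, b) (x₁, x₂, x₃)
  set d2 := delta₂ (a, b) (x₁, x₂, x₃)
  have l1 : Real.log (Real.sqrt (a ^ 2 * d2) / d1) =
      Real.log a + Real.log d2 / 2 - Real.log d1 := by
    rw [Real.log_div (by positivity) p1.ne', Real.log_sqrt (by positivity),
      Real.log_mul (by positivity) p2.ne', Real.log_pow]
    push_cast; ring
  have l2 : Real.log (Real.sqrt ((a ^ 2 * b) ^ 2 * d1) / (a ^ 2 * d2)) =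
      Real.log b + Real.log d1 / 2 - Real.log d2 := by
    rw [Real.log_div (by positivity) (by positivity), Real.log_sqrt (by positivity),
      Real.log_mul (by positivity) p1.ne', Real.log_mul (by positivity) p2.ne', Real.log_pow,
      Real.log_mul (by positivity) (by positivity), Real.log_pow]
    push_cast; ring
  rw [cpow_ofReal_eq_exp (by positivity), cpow_ofReal_eq_exp (by positivity),
    cpow_ofReal_eq_exp h1, cpow_ofReal_eq_exp h2, cpow_ofReal_eq_exp p1, cpow_ofReal_eq_exp p2,
    l1, l2, ← Complex.exp_add, ← Complex.exp_add, ← Complex.exp_add, ← Complex.exp_add]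
  congr 1
  have r0 : rho 0 = 1 := rfl
  have r1 : rho 1 = 0 := rfl
  simp only [Pi.add_apply, r0, r1]
  obtain h : μ 2 = -μ 0 - μ 1 := by linear_combination hμ
  rw [h]
  push_cast
  ring

/-- The m- and w-integrals are gamma integrals. The latter leaves (1+v)^(-z), so the v-integral is a
beta integral with parameters x and z - x. -/
theorem integrable_octant {A x z : ℝ} (hA : 0 < A) (hx : 0 < x) (hzx : 0 < z - x) :
    Integrable (fun p : ℝ × ℝ × ℝ => p.1 ^ (x - 1) * ((p.2.1 ^ (z - 1) * Real.exp (-(1 * p.2.1))) *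
      (p.2.2 ^ (z - 1) * Real.exp (-(A * (1 + p.1) * p.2.2))))) octMeas := by
  have hz : 0 < z := by linarith
  have hm : Measurable (fun p : ℝ × ℝ × ℝ => p.1 ^ (x - 1) *
      ((p.2.1 ^ (z - 1) * Real.exp (-(1 * p.2.1))) *
      (p.2.2 ^ (z - 1) * Real.exp (-(A * (1 + p.1) * p.2.2))))) := by fun_prop
  rw [integrable_prod_iff hm.aestronglyMeasurable]
  constructor
  · filter_upwards [ae_posMeas_pos] with v hv
    exact ((integrable_rpow_mul_exp hz one_pos).mul_prod
      (integrable_rpow_mul_exp hz (by positivity : 0 < A * (1 + v)))).const_mul _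
  · refine ((integrable_beta_Ioi hx hzx).const_mul
      (Real.Gamma z * (A ^ (-z) * Real.Gamma z))).congr ?_
    filter_upwards [ae_posMeas_pos] with v hv
    have hv1 : 0 < 1 + v := by linarith
    have e : ∫ q : ℝ × ℝ, ‖v ^ (x - 1) * ((q.1 ^ (z - 1) * Real.exp (-(1 * q.1))) *
        (q.2 ^ (z - 1) * Real.exp (-(A * (1 + v) * q.2))))‖ ∂(posMeas.prod posMeas) =
        ∫ q : ℝ × ℝ, v ^ (x - 1) * ((q.1 ^ (z - 1) * Real.exp (-(1 * q.1))) *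
        (q.2 ^ (z - 1) * Real.exp (-(A * (1 + v) * q.2)))) ∂(posMeas.prod posMeas) := by
      refine integral_congr_ae ?_
      filter_upwards [(Measure.quasiMeasurePreserving_fst (μ := posMeas) (ν := posMeas)).ae
        ae_posMeas_pos, (Measure.quasiMeasurePreserving_snd (μ := posMeas) (ν := posMeas)).ae
        ae_posMeas_pos] with q h1 h2
      exact Real.norm_of_nonneg (by positivity)
    rw [e, integral_const_mul,
      integral_prod_mul (fun m : ℝ => m ^ (z - 1) * Real.exp (-(1 * m)))
        (fun w : ℝ => w ^ (z - 1) * Real.exp (-(A * (1 + v) * w))),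
      Real.integral_rpow_mul_exp_neg_mul_Ioi hz one_pos,
      Real.integral_rpow_mul_exp_neg_mul_Ioi hz (by positivity), one_div, one_div, inv_one,
      Real.one_rpow, Real.inv_rpow (by positivity), Real.mul_rpow hA.le hv1.le,
      Real.rpow_neg hA.le, show -(x + (z - x)) = -z by ring, Real.rpow_neg hv1.le]
    field_simp

/-- The kernel connecting Jacquet's integral with the triple integral; the variables are
`(v, m, w)` and `x`. -/
def bigKernel (y : ℝ × ℝ) (a b : ℂ) (ξ : ℝ) (p x : ℝ × ℝ × ℝ) : ℂ :=
  (p.1 : ℂ) ^ (a - 1) * ((p.2.1 : ℂ) ^ (a + b - 1) * (p.2.2 : ℂ) ^ (a + b - 1 / 2 - 1)) *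
    ((auxN y p.1 x.1 ^ (-(1 / 2) : ℝ) *
      Real.exp (-(p.2.1 * ((p.1 * delta₂ y x + delta₁ y x) / (y.2 ^ 2 * auxN y p.1 x.1)))) *
      Real.exp (-(auxN y p.1 x.1 * p.2.2)) : ℝ) : ℂ) *
    Complex.exp (2 * Real.pi * ξ * Complex.I * (x.1 + x.2.1))

theorem measurable_bigKernel (y : ℝ × ℝ) (a b : ℂ) (ξ : ℝ) :
    Measurable (Function.uncurry (bigKernel y a b ξ)) := by
  unfold Function.uncurry bigKernel delta₁ delta₂ auxN
  fun_prop

/-- The factor of `bigKernel` that does not depend on `x`. -/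
def bigCoeff (y : ℝ × ℝ) (a b : ℂ) (p : ℝ × ℝ × ℝ) : ℂ :=
  (p.1 : ℂ) ^ (a - 1) * ((p.2.1 : ℂ) ^ (a + b - 1) * (p.2.2 : ℂ) ^ (a + b - 1 / 2 - 1)) *
    ((y.2 / Real.sqrt (p.2.1 * (1 + p.1)) * (Real.exp (-(1 * p.2.1)) *
      Real.exp (-(y.1 ^ 2 * (1 + p.1) * p.2.2))) : ℝ) : ℂ)

/-- With n = `auxN`, completing the square in x₃ gives v δ₂ + δ₁ = y₂² n + n x₂²/(1+v) + (1+v)(x₃ -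
v x₁x₂/(1+v))². Division by y₂² n makes the coefficient of x₂² independent of x₁. The exponent n w
is itself quadratic in x₁, and n^(-1/2) normalizes the Gaussian in x₃. -/
theorem bigKernel_eq {y : ℝ × ℝ} (h1 : 0 < y.1) (h2 : 0 < y.2) (a b : ℂ) (ξ : ℝ)
    {p : ℝ × ℝ × ℝ} (hv : 0 < p.1) (hm : 0 < p.2.1) (x : ℝ × ℝ × ℝ) :
    bigKernel y a b ξ p x = bigCoeff y a b p *
      gaussian₃ (p.2.2 * p.1) (p.2.1 / (y.2 ^ 2 * (1 + p.1))) (p.1 / (1 + p.1)) ξ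
        (fun t => p.2.1 * (1 + p.1) / (y.2 ^ 2 * auxN y p.1 t)) x := by
  obtain ⟨v, m, w⟩ := p
  obtain ⟨x₁, x₂, x₃⟩ := x
  simp only at hv hm
  have hn := auxN_pos h1 hv x₁
  have hv1 : 0 < 1 + v := by linarith
  unfold bigKernel bigCoeff gaussian₃
  simp only
  have es : auxN y v x₁ ^ (-(1 / 2) : ℝ) = y.2 / Real.sqrt (m * (1 + v)) *
      Real.sqrt (m * (1 + v) / (y.2 ^ 2 * auxN y v x₁)) := by
    rw [Real.sqrt_div (by positivity), Real.sqrt_mul (by positivity) (auxN y v x₁),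
      Real.sqrt_sq h2.le, Real.rpow_neg hn.le, ← Real.sqrt_eq_rpow]
    have : Real.sqrt (m * (1 + v)) ≠ 0 := (Real.sqrt_pos.2 (by positivity)).ne'
    field_simp
  have ee : -(m * ((v * delta₂ y (x₁, x₂, x₃) + delta₁ y (x₁, x₂, x₃)) /
      (y.2 ^ 2 * auxN y v x₁))) + -(auxN y v x₁ * w) = -(1 * m) + -(y.1 ^ 2 * (1 + v) * w) +
      -(w * v) * x₁ ^ 2 + -(m / (y.2 ^ 2 * (1 + v))) * x₂ ^ 2 +
      -(m * (1 + v) / (y.2 ^ 2 * auxN y v x₁)) * (x₃ - v / (1 + v) * x₁ * x₂) ^ 2 := by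
    have hn' := hn.ne'
    unfold delta₁ delta₂
    unfold auxN at hn' ⊢
    field_simp
    ring
  have ec : ∀ r : ℝ, (Real.exp r : ℂ) = Complex.exp r := fun r => Complex.ofReal_exp r
  rw [es]
  simp only [Complex.ofReal_mul, ec]
  have e0 : Complex.exp ((-(m * ((v * delta₂ y (x₁, x₂, x₃) + delta₁ y (x₁, x₂, x₃)) /
      (y.2 ^ 2 * auxN y v x₁))) : ℝ) : ℂ) * Complex.exp ((-(auxN y v x₁ * w) : ℝ) : ℂ) =
      Complex.exp ((-(1 * m) : ℝ) : ℂ) * Complex.exp ((-(y.1 ^ 2 * (1 + v) * w) : ℝ) : ℂ) *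
      Complex.exp ((-(w * v) * x₁ ^ 2 : ℝ) : ℂ) *
      Complex.exp ((-(m / (y.2 ^ 2 * (1 + v))) * x₂ ^ 2 : ℝ) : ℂ) *
      Complex.exp ((-(m * (1 + v) / (y.2 ^ 2 * auxN y v x₁)) *
        (x₃ - v / (1 + v) * x₁ * x₂) ^ 2 : ℝ) : ℂ) := by
    simp only [← Complex.exp_add, ← Complex.ofReal_add]
    rw [ee]
  rw [show (2 * Real.pi * ξ * Complex.I * (x₁ + x₂) : ℂ) = 2 * Real.pi * ξ * Complex.I * x₁ +
    2 * Real.pi * ξ * Complex.I * x₂ by ring, Complex.exp_add, Complex.exp_add, Complex.exp_add]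
  have e1 : Complex.exp (-((w : ℂ) * v) * (x₁ : ℂ) ^ 2) =
      Complex.exp ((-(w * v) * x₁ ^ 2 : ℝ) : ℂ) := by push_cast; rfl
  have e2 : Complex.exp (-((m / (y.2 ^ 2 * (1 + v)) : ℝ) : ℂ) * (x₂ : ℂ) ^ 2) =
      Complex.exp ((-(m / (y.2 ^ 2 * (1 + v))) * x₂ ^ 2 : ℝ) : ℂ) := by push_cast; rfl
  have e3 : Complex.exp (((-(m * (1 + v) / (y.2 ^ 2 * auxN y v x₁)) : ℝ) : ℂ) *
      (((x₃ - v / (1 + v) * x₁ * x₂) ^ 2 : ℝ) : ℂ)) =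
      Complex.exp ((-(m * (1 + v) / (y.2 ^ 2 * auxN y v x₁)) *
        (x₃ - v / (1 + v) * x₁ * x₂) ^ 2 : ℝ) : ℂ) := by rw [Complex.ofReal_mul]
  rw [e1, e2, e3]
  linear_combination ((v : ℂ) ^ (a - 1) * ((m : ℂ) ^ (a + b - 1) *
    (w : ℂ) ^ (a + b - 1 / 2 - 1)) * (((y.2 / Real.sqrt (m * (1 + v)) : ℝ) : ℂ) *
      ((Real.sqrt (m * (1 + v) / (y.2 ^ 2 * auxN y v x₁)) : ℝ) : ℂ)) *
    (Complex.exp (2 * Real.pi * ξ * Complex.I * x₁) *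
      Complex.exp (2 * Real.pi * ξ * Complex.I * x₂))) * e0

theorem gaussian_const_eq {y₂ v m w : ℝ} (h2 : 0 < y₂) (hv : 0 < v) (hm : 0 < m) (hw : 0 < w) :
    y₂ / Real.sqrt (m * (1 + v)) * (Real.sqrt (Real.pi / (w * v)) *
      (Real.sqrt (Real.pi / (m / (y₂ ^ 2 * (1 + v)))) * Real.sqrt Real.pi)) =
    Real.pi * Real.sqrt Real.pi * y₂ ^ 2 *
      (v ^ (-(1 / 2) : ℝ) * (m ^ (-1 : ℝ) * w ^ (-(1 / 2) : ℝ))) := by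
  have hp := Real.pi_pos
  have hv1 : 0 < 1 + v := by linarith
  rw [show Real.pi / (m / (y₂ ^ 2 * (1 + v))) = Real.pi * (y₂ ^ 2 * (1 + v)) / m by field_simp,
    Real.sqrt_div (by positivity), Real.sqrt_div (by positivity), Real.sqrt_mul (by positivity),
    Real.sqrt_mul (by positivity), Real.sqrt_mul (by positivity), Real.sqrt_mul (by positivity),
    Real.sqrt_sq h2.le, Real.rpow_neg hv.le, Real.rpow_neg hw.le, Real.rpow_neg hm.le,
    Real.rpow_one, ← Real.sqrt_eq_rpow, ← Real.sqrt_eq_rpow]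
  have s1 : Real.sqrt v ≠ 0 := (Real.sqrt_pos.2 hv).ne'
  have s2 : Real.sqrt w ≠ 0 := (Real.sqrt_pos.2 hw).ne'
  have s3 : Real.sqrt m ≠ 0 := (Real.sqrt_pos.2 hm).ne'
  have s4 : Real.sqrt (1 + v) ≠ 0 := (Real.sqrt_pos.2 hv1).ne'
  have q1 : Real.sqrt m ^ 2 = m := Real.sq_sqrt hm.le
  have q2 : Real.sqrt Real.pi ^ 2 = Real.pi := Real.sq_sqrt hp.le
  field_simp
  rw [q1, q2, mul_comm]

section

variable {y : ℝ × ℝ} {a b : ℂ}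

/-- This is the order of integration with the unipotent variables first: the Fourier transforms in
x₁ and x₂ supply the terms in 1/(vw) and (1+v)/m of `tripleKernel`. They are absent from the
integral of the norm, so Fubini requires more of a and b than `tripleInt` does. -/
theorem bigKernel_inner (h1 : 0 < y.1) (h2 : 0 < y.2) (ξ : ℝ) {p : ℝ × ℝ × ℝ} (hv : 0 < p.1)
    (hm : 0 < p.2.1) (hw : 0 < p.2.2) :
    Integrable (bigKernel y a b ξ p) ∧
    ∫ x, bigKernel y a b ξ p x = (Real.pi * Real.sqrt Real.pi * y.2 ^ 2 : ℝ) *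
      ((p.1 : ℂ) ^ (a - 1 / 2 - 1) * ((p.2.1 : ℂ) ^ (a + b - 1 - 1) * (p.2.2 : ℂ) ^ (a + b - 1 - 1))
        * (tripleKernel (y.1 ^ 2, Real.pi ^ 2 * ξ ^ 2 * y.2 ^ 2, Real.pi ^ 2 * ξ ^ 2) p : ℂ)) ∧
    ∫ x, ‖bigKernel y a b ξ p x‖ = (Real.pi * Real.sqrt Real.pi * y.2 ^ 2) *
      (p.1 ^ (a.re - 1 / 2 - 1) * ((p.2.1 ^ (a.re + b.re - 1 - 1) * Real.exp (-(1 * p.2.1))) *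
      (p.2.2 ^ (a.re + b.re - 1 - 1) * Real.exp (-(y.1 ^ 2 * (1 + p.1) * p.2.2))))) := by
  have hv1 : 0 < 1 + p.1 := by linarith
  have hv' : (p.1 : ℂ) ≠ 0 := Complex.ofReal_ne_zero.2 hv.ne'
  have hm' : (p.2.1 : ℂ) ≠ 0 := Complex.ofReal_ne_zero.2 hm.ne'
  have hw' : (p.2.2 : ℂ) ≠ 0 := Complex.ofReal_ne_zero.2 hw.ne'
  obtain ⟨g1, g2, g3⟩ := gaussian₃_integral (P := p.2.2 * p.1)
    (Q := p.2.1 / (y.2 ^ 2 * (1 + p.1))) (by positivity) (by positivity) (p.1 / (1 + p.1)) ξ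
    (R := fun t => p.2.1 * (1 + p.1) / (y.2 ^ 2 * auxN y p.1 t))
    (fun t => by have := auxN_pos h1 hv t; positivity) (by unfold auxN; fun_prop)
  have e : bigKernel y a b ξ p = fun x => bigCoeff y a b p * gaussian₃ (p.2.2 * p.1)
      (p.2.1 / (y.2 ^ 2 * (1 + p.1))) (p.1 / (1 + p.1)) ξ
        (fun t => p.2.1 * (1 + p.1) / (y.2 ^ 2 * auxN y p.1 t)) x :=
    funext fun x => bigKernel_eq h1 h2 a b ξ hv hm x
  have k := gaussian_const_eq h2 hv hm hw
  refine ⟨e ▸ g1.const_mul _, ?_, ?_⟩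
  · rw [e, integral_const_mul, g2]
    unfold bigCoeff tripleKernel
    have ev : (p.1 : ℂ) ^ (a - 1 / 2 - 1) =
        (p.1 : ℂ) ^ (a - 1) * ((p.1 ^ (-(1 / 2) : ℝ) : ℝ) : ℂ) := by
      rw [Complex.ofReal_cpow hv.le, ← Complex.cpow_add _ _ hv']
      push_cast; ring_nf
    have em : (p.2.1 : ℂ) ^ (a + b - 1 - 1) =
        (p.2.1 : ℂ) ^ (a + b - 1) * ((p.2.1 ^ (-1 : ℝ) : ℝ) : ℂ) := by
      rw [Complex.ofReal_cpow hm.le, ← Complex.cpow_add _ _ hm']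
      push_cast; ring_nf
    have ew : (p.2.2 : ℂ) ^ (a + b - 1 - 1) =
        (p.2.2 : ℂ) ^ (a + b - 1 / 2 - 1) * ((p.2.2 ^ (-(1 / 2) : ℝ) : ℝ) : ℂ) := by
      rw [Complex.ofReal_cpow hw.le, ← Complex.cpow_add _ _ hw']
      push_cast; ring_nf
    rw [ev, em, ew]
    have kc := congrArg (fun r : ℝ => (r : ℂ)) k
    simp only [Complex.ofReal_mul] at kc ⊢
    have x1 : Real.pi ^ 2 * ξ ^ 2 / (p.2.2 * p.1) = Real.pi ^ 2 * ξ ^ 2 / p.1 / p.2.2 := by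
      field_simp
    have x2 : Real.pi ^ 2 * ξ ^ 2 / (p.2.1 / (y.2 ^ 2 * (1 + p.1))) =
        Real.pi ^ 2 * ξ ^ 2 * y.2 ^ 2 * (1 + p.1) / p.2.1 := by field_simp
    rw [x1, x2, neg_add (1 * p.2.1), neg_add (y.1 ^ 2 * (1 + p.1) * p.2.2), Real.exp_add,
      Real.exp_add]
    simp only [Complex.ofReal_mul]
    linear_combination ((p.1 : ℂ) ^ (a - 1) * ((p.2.1 : ℂ) ^ (a + b - 1) *
      (p.2.2 : ℂ) ^ (a + b - 1 / 2 - 1)) * ((Real.exp (-(1 * p.2.1)) : ℂ) *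
      (Real.exp (-(y.1 ^ 2 * (1 + p.1) * p.2.2)) : ℂ)) *
      ((Real.exp (-(Real.pi ^ 2 * ξ ^ 2 / p.1 / p.2.2)) : ℂ) *
      (Real.exp (-(Real.pi ^ 2 * ξ ^ 2 * y.2 ^ 2 * (1 + p.1) / p.2.1)) : ℂ))) * kc
  · rw [e]
    simp only [norm_mul (bigCoeff y a b p)]
    rw [integral_const_mul, g3]
    unfold bigCoeff
    rw [norm_mul, norm_mul, norm_mul, Complex.norm_cpow_eq_rpow_re_of_pos hv,
      Complex.norm_cpow_eq_rpow_re_of_pos hm, Complex.norm_cpow_eq_rpow_re_of_pos hw,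
      Complex.norm_real, Real.norm_of_nonneg (by positivity)]
    have ev : p.1 ^ (a.re - 1 / 2 - 1) = p.1 ^ (a - 1).re * p.1 ^ (-(1 / 2) : ℝ) := by
      rw [← Real.rpow_add hv]; congr 1; simp; ring
    have em : p.2.1 ^ (a.re + b.re - 1 - 1) = p.2.1 ^ (a + b - 1).re * p.2.1 ^ (-1 : ℝ) := by
      rw [← Real.rpow_add hm]; congr 1
    have ew : p.2.2 ^ (a.re + b.re - 1 - 1) =
        p.2.2 ^ (a + b - 1 / 2 - 1).re * p.2.2 ^ (-(1 / 2) : ℝ) := by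
      rw [← Real.rpow_add hw]; congr 1; simp; ring
    rw [ev, em, ew]
    linear_combination (p.1 ^ (a - 1).re * (p.2.1 ^ (a + b - 1).re *
      p.2.2 ^ (a + b - 1 / 2 - 1).re) * (Real.exp (-(1 * p.2.1)) *
      Real.exp (-(y.1 ^ 2 * (1 + p.1) * p.2.2)))) * k

/-- The conditions on Re a and Re b are positivity of the parameters of the remaining beta integral
in v. They correspond to Jacquet's chamber Re μ₀ > Re μ₁ > Re μ₂. -/
theorem integrable_bigKernel (h1 : 0 < y.1) (h2 : 0 < y.2) (ha : 1 / 2 < a.re) (hb : 1 / 2 < b.re)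
    (ξ : ℝ) : Integrable (Function.uncurry (bigKernel y a b ξ))
      (octMeas.prod (volume : Measure (ℝ × ℝ × ℝ))) := by
  rw [integrable_prod_iff (measurable_bigKernel y a b ξ).aestronglyMeasurable]
  constructor
  · filter_upwards [ae_octMeas_pos] with p hp
    exact (bigKernel_inner h1 h2 ξ hp.1 hp.2.1 hp.2.2).1
  · refine ((integrable_octant (A := y.1 ^ 2) (x := a.re - 1 / 2) (z := a.re + b.re - 1)
      (by positivity) (by linarith) (by linarith)).const_mul
        (Real.pi * Real.sqrt Real.pi * y.2 ^ 2)).congr ?_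
    filter_upwards [ae_octMeas_pos] with p hp
    exact (bigKernel_inner h1 h2 ξ hp.1 hp.2.1 hp.2.2).2.2.symm

/-- This is the other order of integration, without the character. The m- and w-integrals produce
powers of n that cancel n^(-1/2) exactly, and the scaled beta integral splits the rest into powers
of δ₂ and δ₁. -/
theorem integral_bigKernel_octant (h1 : 0 < y.1) (h2 : 0 < y.2) (ha : 1 / 2 < a.re)
    (hb : 1 / 2 < b.re) (x : ℝ × ℝ × ℝ) (hint : Integrable (fun p => bigKernel y a b 0 p x) octMeas) :
    ∫ p, bigKernel y a b 0 p x ∂octMeas = ((y.2 ^ 2 : ℝ) : ℂ) ^ (a + b) *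
      (((delta₂ y x : ℝ) : ℂ) ^ (-a) * ((delta₁ y x : ℝ) : ℂ) ^ (-b)) *
      (Complex.Gamma a * Complex.Gamma b * Complex.Gamma (a + b - 1 / 2)) := by
  have d1 := delta₁_pos h1 h2 x
  have d2 := delta₂_pos h1 h2 x
  have hab : 0 < (a + b).re := by simp; linarith
  have hc : 0 < (a + b - 1 / 2).re := by simp; linarith
  have hG : Complex.Gamma (a + b) ≠ 0 := Complex.Gamma_ne_zero_of_re_pos hab
  rw [integral_prod _ hint]
  have step : ∀ᵐ v ∂posMeas, ∫ q : ℝ × ℝ, bigKernel y a b 0 (v, q) x ∂(posMeas.prod posMeas) =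
      ((y.2 ^ 2 : ℝ) : ℂ) ^ (a + b) * (Complex.Gamma (a + b) * Complex.Gamma (a + b - 1 / 2)) *
      ((v : ℂ) ^ (a - 1) * ((v * delta₂ y x + delta₁ y x : ℝ) : ℂ) ^ (-(a + b))) := by
    filter_upwards [ae_posMeas_pos] with v hv
    have hn := auxN_pos h1 hv x.1
    set n := auxN y v x.1 with hndef
    set D := v * delta₂ y x + delta₁ y x with hD
    have hDpos : 0 < D := by positivity
    have hE : 0 < D / (y.2 ^ 2 * n) := by positivity
    have e : ∀ q : ℝ × ℝ, bigKernel y a b 0 (v, q) x = ((v : ℂ) ^ (a - 1) *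
        ((n ^ (-(1 / 2) : ℝ) : ℝ) : ℂ)) * (((q.1 : ℂ) ^ (a + b - 1) *
          Complex.exp (-(((D / (y.2 ^ 2 * n) : ℝ) : ℂ) * q.1))) *
        ((q.2 : ℂ) ^ (a + b - 1 / 2 - 1) * Complex.exp (-((n : ℂ) * q.2)))) := by
      intro q
      unfold bigKernel
      simp only [← hndef, ← hD]
      rw [Complex.ofReal_zero, mul_zero, zero_mul, zero_mul, Complex.exp_zero]
      push_cast
      rw [mul_comm (q.1 : ℂ) (_ / _)]
      ring
    simp only [e]
    rw [integral_const_mul, integral_prod_mul (fun m : ℝ => (m : ℂ) ^ (a + b - 1) *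
      Complex.exp (-(((D / (y.2 ^ 2 * n) : ℝ) : ℂ) * m))) (fun w : ℝ =>
        (w : ℂ) ^ (a + b - 1 / 2 - 1) * Complex.exp (-((n : ℂ) * w))),
      Complex.integral_cpow_mul_exp_neg_mul_Ioi hab hE,
      Complex.integral_cpow_mul_exp_neg_mul_Ioi hc hn]
    have f1 : (1 / ((D / (y.2 ^ 2 * n) : ℝ) : ℂ)) ^ (a + b) =
        ((y.2 ^ 2 : ℝ) : ℂ) ^ (a + b) * (n : ℂ) ^ (a + b) * (D : ℂ) ^ (-(a + b)) := by
      rw [one_div, ← Complex.ofReal_inv, inv_div, Complex.ofReal_div,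
        Complex.div_cpow_ofReal_nonneg (by positivity) hDpos.le, Complex.ofReal_mul (y.2 ^ 2),
        Complex.mul_cpow_ofReal_nonneg (by positivity) hn.le, Complex.cpow_neg]
      rfl
    have f2 : (1 / (n : ℂ)) ^ (a + b - 1 / 2) = (n : ℂ) ^ (-(a + b - 1 / 2)) := by
      rw [one_div, Complex.inv_cpow, ← Complex.cpow_neg]
      rw [Complex.arg_ofReal_of_nonneg hn.le]; exact Real.pi_pos.ne
    have hn' : (n : ℂ) ≠ 0 := Complex.ofReal_ne_zero.2 hn.ne'
    have f3 : ((n ^ (-(1 / 2) : ℝ) : ℝ) : ℂ) * ((n : ℂ) ^ (a + b) *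
        (n : ℂ) ^ (-(a + b - 1 / 2))) = 1 := by
      rw [Complex.ofReal_cpow hn.le, ← Complex.cpow_add _ _ hn', ← Complex.cpow_add _ _ hn']
      push_cast
      ring_nf
      exact Complex.cpow_zero _
    rw [f1, f2]
    linear_combination ((v : ℂ) ^ (a - 1) * ((y.2 ^ 2 : ℝ) : ℂ) ^ (a + b) * (D : ℂ) ^ (-(a + b)) *
      Complex.Gamma (a + b) * Complex.Gamma (a + b - 1 / 2)) * f3
  rw [integral_congr_ae step, integral_const_mul,
    integral_beta_scaled (by linarith) (by linarith) d1 d2]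
  field_simp

end

/-- An entire function of `μ` that continues Jacquet's integral; see `jacquetIntegral_eq`. -/
def whittakerFormula (y : ℝ × ℝ) (μ : Fin 3 → ℂ) : ℂ :=
  (Real.pi * Real.sqrt Real.pi : ℝ) * (y.1 : ℂ) ^ (1 - μ 2) * (y.2 : ℂ) ^ (1 + μ 2) *
    gammaFactor μ * tripleInt (y.1 ^ 2, Real.pi ^ 2 * y.2 ^ 2, Real.pi ^ 2)
      ((μ 0 - μ 1) / 2) ((μ 0 - μ 2) / 2)

/-- Jacquet's integral in its domain of absolute convergence. -/
theorem jacquetIntegral_eq {y : ℝ × ℝ} (h1 : 0 < y.1) (h2 : 0 < y.2) {μ : Fin 3 → ℂ}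
    (hμ : μ 0 + μ 1 + μ 2 = 0) (h01 : (μ 1).re < (μ 0).re) (h12 : (μ 2).re < (μ 1).re) :
    jacquetIntegral (torus y) μ (1, 1) = whittakerFormula y μ := by
  set a := (1 + μ 0 - μ 1) / 2 with hadef
  set b := (1 + μ 1 - μ 2) / 2 with hbdef
  have hre : ∀ z : ℂ, (z / 2).re = z.re / 2 := fun z => by simp
  have ha : 1 / 2 < a.re := by rw [hadef, hre]; simp; linarith
  have hb : 1 / 2 < b.re := by rw [hbdef, hre]; simp; linarith
  have hc : a + b - 1 / 2 = (1 + μ 0 - μ 2) / 2 := by rw [hadef, hbdef]; ring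
  set G := Complex.Gamma a * Complex.Gamma b * Complex.Gamma (a + b - 1 / 2) with hG
  have hG0 : G ≠ 0 := by
    refine mul_ne_zero (mul_ne_zero ?_ ?_) ?_ <;> apply Complex.Gamma_ne_zero_of_re_pos
    · linarith
    · linarith
    · simp; linarith
  have hgf : gammaFactor μ = G⁻¹ := by
    rw [gammaFactor, hG, mul_inv, mul_inv, hc]
  set Y := (y.1 : ℂ) ^ (1 - μ 2) * (y.2 : ℂ) ^ (1 + μ 0) with hY
  set Z := ((y.2 ^ 2 : ℝ) : ℂ) ^ (a + b) with hZ
  have hZ0 : Z ≠ 0 := by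
    rw [hZ, Ne, Complex.cpow_eq_zero_iff]
    simp [h2.ne']
  have hI := integrable_bigKernel h1 h2 ha hb
  -- The identity is needed only for almost every x, where Fubini makes the slice over the octant
  -- integrable. The character does not involve (v, m, w) and factors out.
  have key : ∀ᵐ x : ℝ × ℝ × ℝ, powerFn (rho + μ) (longWeyl * unip x * torus y) * psi (1, 1) x =
      Y * Z⁻¹ * G⁻¹ * ∫ p, bigKernel y a b 1 p x ∂octMeas := by
    filter_upwards [(hI 0).prod_left_ae] with x hx
    have e : ∀ p, bigKernel y a b 1 p x = bigKernel y a b 0 p x * psi (1, 1) x := by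
      intro p
      unfold bigKernel psi
      rw [Complex.ofReal_zero, mul_zero, zero_mul, zero_mul, Complex.exp_zero, mul_one]
      congr 2
      push_cast; ring
    simp only [e]
    rw [integral_mul_const, integral_bigKernel_octant h1 h2 ha hb x hx, powerFn_eq h1 h2 x hμ,
      ← hadef, ← hbdef, ← hY, ← hZ, ← hG]
    field_simp
  rw [jacquetIntegral, integral_congr_ae key, integral_const_mul,
    ← integral_integral_swap (f := bigKernel y a b 1) (hI 1)]
  have inner : ∫ p, (∫ x, bigKernel y a b 1 p x) ∂octMeas =
      (Real.pi * Real.sqrt Real.pi * y.2 ^ 2 : ℝ) *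
        tripleInt (y.1 ^ 2, Real.pi ^ 2 * y.2 ^ 2, Real.pi ^ 2) (a - 1 / 2) (a + b - 1) := by
    rw [tripleInt, ← integral_const_mul]
    refine integral_congr_ae ?_
    filter_upwards [ae_octMeas_pos] with p hp
    have := (bigKernel_inner (a := a) (b := b) h1 h2 1 hp.1 hp.2.1 hp.2.2).2.1
    rw [this]
    norm_num
  rw [inner, whittakerFormula, hgf, show a - 1 / 2 = (μ 0 - μ 1) / 2 by rw [hadef]; ring,
    show a + b - 1 = (μ 0 - μ 2) / 2 by rw [hadef, hbdef]; ring]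
  have hyz : (y.2 : ℂ) ^ (1 + μ 0) * ((y.2 ^ 2 : ℝ) : ℂ) = (y.2 : ℂ) ^ (1 + μ 2) * Z := by
    have h2' : (y.2 : ℂ) ≠ 0 := Complex.ofReal_ne_zero.2 h2.ne'
    have hl : ((y.2 ^ 2 : ℝ) : ℂ) = Complex.exp ((Real.log y.2 : ℂ) * 2) := by
      rw [← cpow_ofReal_eq_exp h2]; push_cast; norm_cast
    rw [hZ, cpow_ofReal_eq_exp (by positivity : 0 < y.2 ^ 2), hl, cpow_ofReal_eq_exp h2,
      cpow_ofReal_eq_exp h2, ← Complex.exp_add, ← Complex.exp_add, Real.log_pow, hadef, hbdef]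
    congr 1
    push_cast
    ring
  rw [hY]
  generalize tripleInt (y.1 ^ 2, Real.pi ^ 2 * y.2 ^ 2, Real.pi ^ 2)
    ((μ 0 - μ 1) / 2) ((μ 0 - μ 2) / 2) = T
  simp only [Complex.ofReal_mul] at hyz ⊢
  field_simp
  linear_combination ((y.1 : ℂ) ^ (1 - μ 2) * T) * hyz

/-! ### Uniqueness of the continuation. -/

/-- Two entire functions on `ℂ²` that agree on the chamber `Re a > Re b > Re (-a-b)` are equal. -/
theorem eq_of_eq_on_chamber {F G : ℂ × ℂ → ℂ} (hF : Differentiable ℂ F) (hG : Differentiable ℂ G)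
    (h : ∀ a b : ℂ, b.re < a.re → (-a - b).re < b.re → F (a, b) = G (a, b)) : F = G := by
  funext q
  obtain ⟨a, b⟩ := q
  -- This complex line joins the interior point (1, 0) of the chamber to (a, b). Near t = 0 it stays
  -- in the chamber, so the one-variable identity theorem carries equality to t = 1.
  let l : ℂ → ℂ × ℂ := fun t => (1 + t * (a - 1), t * b)
  have hl : Differentiable ℂ l := by fun_prop
  have an : ∀ {H : ℂ × ℂ → ℂ}, Differentiable ℂ H → AnalyticOnNhd ℂ (H ∘ l) Set.univ :=
    fun hH => (hH.comp hl).differentiableOn.analyticOnNhd isOpen_univ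
  have ev : F ∘ l =ᶠ[𝓝 0] G ∘ l := by
    have c1 : Tendsto (fun t => (l t).1.re) (𝓝 0) (𝓝 1) := by
      have : Continuous fun t => (l t).1.re := by fun_prop
      simpa [l] using this.tendsto 0
    have c2 : Tendsto (fun t => (l t).2.re) (𝓝 0) (𝓝 0) := by
      have : Continuous fun t => (l t).2.re := by fun_prop
      simpa [l] using this.tendsto 0
    filter_upwards [c1.eventually_const_lt (show (1 / 2 : ℝ) < 1 by norm_num),
      c2.eventually_lt_const (show (0 : ℝ) < 1 / 4 by norm_num),
      c2.eventually_const_lt (show (-(1 / 4) : ℝ) < 0 by norm_num)] with t t1 t2 t3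
    refine h (l t).1 (l t).2 (by linarith) ?_
    simp only [Complex.sub_re, Complex.neg_re]
    linarith
  have := congrFun ((an hF).eq_of_eventuallyEq (an hG) ev) 1
  simpa [l] using this

theorem differentiable_whittakerFormula {y : ℝ × ℝ} (h1 : 0 < y.1) (h2 : 0 < y.2) :
    Differentiable ℂ fun q : ℂ × ℂ => whittakerFormula y ![q.1, q.2, -q.1 - q.2] := by
  have hT : Differentiable ℂ fun q : ℂ × ℂ =>
      tripleInt (y.1 ^ 2, Real.pi ^ 2 * y.2 ^ 2, Real.pi ^ 2) q.1 q.2 :=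
    differentiable_tripleInt (by positivity) (by simp; positivity) (by simp; positivity)
  have hT' : Differentiable ℂ fun q : ℂ × ℂ =>
      tripleInt (y.1 ^ 2, Real.pi ^ 2 * y.2 ^ 2, Real.pi ^ 2) ((q.1 - q.2) / 2)
        ((q.1 - (-q.1 - q.2)) / 2) :=
    hT.comp (f := fun q : ℂ × ℂ => ((q.1 - q.2) / 2, (q.1 - (-q.1 - q.2)) / 2)) (by fun_prop)
  have hΓ : ∀ {f : ℂ × ℂ → ℂ}, Differentiable ℂ f →
      Differentiable ℂ fun q => (Complex.Gamma (f q))⁻¹ :=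
    fun hf => Complex.differentiable_one_div_Gamma.comp hf
  have hy : ∀ {r : ℝ}, 0 < r → ∀ {f : ℂ × ℂ → ℂ}, Differentiable ℂ f →
      Differentiable ℂ fun q => (r : ℂ) ^ f q :=
    fun hr _ hf => hf.const_cpow (Or.inl (Complex.ofReal_ne_zero.2 hr.ne'))
  unfold whittakerFormula gammaFactor
  simp only [Matrix.cons_val_zero, Matrix.cons_val_one, Matrix.cons_val]
  refine ((((differentiable_const _).mul (hy h1 ?_)).mul (hy h2 ?_)).mul
    (((hΓ ?_).mul (hΓ ?_)).mul (hΓ ?_))).mul hT' <;> fun_prop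

theorem isJacquetContinuation_whittakerFormula {y : ℝ × ℝ} (h1 : 0 < y.1) (h2 : 0 < y.2) :
    IsJacquetContinuation (torus y) (1, 1)
      fun q => whittakerFormula y ![q.1, q.2, -q.1 - q.2] :=
  ⟨differentiable_whittakerFormula h1 h2, fun a b hab hb =>
    (jacquetIntegral_eq h1 h2 (by simp) (by simpa using hab) (by simpa using hb)).symm⟩

/-- The continuation chosen in the definition is unique, so any explicit entire continuation may be
used in its place. -/
theorem whittaker_eq {y : ℝ × ℝ} (h1 : 0 < y.1) (h2 : 0 < y.2) {μ : Fin 3 → ℂ}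
    (hμ : μ 0 + μ 1 + μ 2 = 0) : whittaker (torus y) μ (1, 1) = whittakerFormula y μ := by
  have hF := isJacquetContinuation_whittakerFormula h1 h2
  have hex : ∃ F, IsJacquetContinuation (torus y) (1, 1) F := ⟨_, hF⟩
  have hμ' : ![μ 0, μ 1, -μ 0 - μ 1] = μ := by
    funext i
    fin_cases i
    · rfl
    · rfl
    · simp only [Fin.reduceFinMk, Matrix.cons_val]; linear_combination -hμ
  rw [whittaker, dif_pos hex, eq_of_eq_on_chamber hex.choose_spec.1 hF.1 fun a b hab hb =>
    (hex.choose_spec.2 a b hab hb).trans (hF.2 a b hab hb).symm]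
  simp only [hμ']

/-! ### The pointwise bound for W. -/

theorem norm_Gamma_eq_of_eq {a b : ℝ} {z : ℂ} (hr : z.re = a) (hi : z.im = b) :
    ‖Complex.Gamma z‖ = ‖Complex.Gamma (a + (b : ℝ) * Complex.I)‖ := by
  congr 2; apply Complex.ext <;> simp [hr, hi]

theorem norm_Gamma_eq_of_eq_neg {a b : ℝ} {z : ℂ} (hr : z.re = a) (hi : z.im = -b) :
    ‖Complex.Gamma z‖ = ‖Complex.Gamma (a + (b : ℝ) * Complex.I)‖ := by
  rw [← Complex.norm_conj, ← Complex.Gamma_conj]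
  congr 2; apply Complex.ext <;> simp [hr, hi]

/-- The reflection-translation `(u, v) ↦ (u - s, t - v)` preserves integrals. -/
theorem integral_sub_sub (f : ℝ × ℝ → ℂ) (s t : ℝ) :
    ∫ p : ℝ × ℝ, f (p.1 - s, t - p.2) = ∫ p, f p := by
  have h : MeasurePreserving ((MeasurableEquiv.subRight s).prodCongr (MeasurableEquiv.subLeft t))
      (volume : Measure (ℝ × ℝ)) volume :=
    (measurePreserving_sub_right volume s).prod (Measure.measurePreserving_sub_left volume t)
  exact h.integral_comp' f

/-- The contours at (σ₁-η₀)/2 and (σ₂+η₂)/2 turn the powers of y into y₁^(1-σ₁) y₂^(1-σ₂). The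
exponential factors of the integral and of the normalization cancel. -/
theorem norm_whittakerFormula_le {η : Fin 3 → ℝ} {σ₁ σ₂ δ e : ℝ} (he : 0 < e)
    (H : Exponents (fun i => (σ₁ - η i) / 2) (fun i => (σ₂ + η i) / 2) ((σ₁ + σ₂) / 2) δ) :
    ∃ C : ℝ, 0 < C ∧ ∀ μ : Fin 3 → ℂ, (∀ i, (μ i).re = η i) → ∃ w : Equiv.Perm (Fin 3),
      (μ (w 1)).im ≤ (μ (w 0)).im ∧ (μ (w 2)).im ≤ (μ (w 1)).im ∧ ∀ y : ℝ × ℝ, 0 < y.1 →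
      0 < y.2 → ‖whittakerFormula y μ‖ ≤ C * (y.1 ^ (1 - σ₁) * y.2 ^ (1 - σ₂)) *
        (Real.exp (boundLog ((fun i => (μ i).im / 2) ∘ w) ((σ₁ + σ₂) / 2) δ e) /
          LambdaPoly μ) := by
  obtain ⟨C, hC, hI⟩ := integral_le_of_le_mbWeight he H
  obtain ⟨K, hK, hg⟩ := norm_gammaFactor_le η
  have hp := Real.pi_pos
  set P : ℝ := Real.pi ^ (-(σ₂ + η 2)) * Real.pi ^ (-(σ₁ - η 0)) with hP
  have hP0 : 0 < P := by positivity
  refine ⟨Real.pi * Real.sqrt Real.pi * K * ((1 / (2 * Real.pi)) * (1 / (2 * Real.pi)) * P * C),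
    by positivity, fun μ hμ => ?_⟩
  set τ : Fin 3 → ℝ := fun i => (μ i).im / 2 with hτ
  obtain ⟨w, hw1, hw2, hb⟩ := hI τ
  refine ⟨w, by simp only [hτ] at hw1; linarith, by simp only [hτ] at hw2; linarith,
    fun y h1 h2 => ?_⟩
  have hα := H.posα
  have hβ := H.posβ
  have half_re : ∀ z : ℂ, (z / 2).re = z.re / 2 := fun z => by simp
  have half_im : ∀ z : ℂ, (z / 2).im = z.im / 2 := fun z => by simp
  have α0 := hα 0
  have α1 := hα 1
  have α2 := hα 2
  have β0 := hβ 0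
  have β1 := hβ 1
  have β2 := hβ 2
  set x : ℂ := (μ 0 - μ 1) / 2 with hx
  set z : ℂ := (μ 0 - μ 2) / 2 with hz
  have xre : x.re = (η 0 - η 1) / 2 := by rw [hx, half_re, Complex.sub_re, hμ, hμ]
  have zre : z.re = (η 0 - η 2) / 2 := by rw [hz, half_re, Complex.sub_re, hμ, hμ]
  have xim : x.im = τ 0 - τ 1 := by rw [hx, half_im, Complex.sub_im]; simp only [hτ]; ring
  have zim : z.im = τ 0 - τ 2 := by rw [hz, half_im, Complex.sub_im]; simp only [hτ]; ring
  set Y : ℝ × ℝ × ℝ := (y.1 ^ 2, Real.pi ^ 2 * y.2 ^ 2, Real.pi ^ 2) with hY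
  set σ := (σ₁ - η 0) / 2 with hσ
  set σ' := (σ₂ + η 2) / 2 with hσ'
  have hmb := tripleInt_eq_mellinBarnes (y := Y) (x := x) (z := z) (σ := σ) (σ' := σ')
    (by simp only [hY]; positivity) (by simp only [hY]; positivity) (by simp only [hY]; positivity)
    α0 β2 (by rw [zre]; linarith) (by rw [zre]; linarith) (by rw [xre]; linarith)
    (by rw [zre, xre]; linarith)
  set f : ℝ × ℝ → ℂ := fun p => Complex.Gamma (x + (σ + p.1 * Complex.I)) *
    Complex.Gamma (z - x + (σ' + p.2 * Complex.I)) *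
    (Complex.Gamma (z + (σ + p.1 * Complex.I) + (σ' + p.2 * Complex.I)))⁻¹ * mbCoeff Y z σ σ' p
    with hf
  set D : ℝ := (Real.pi ^ 2 * y.2 ^ 2) ^ (-σ') * (y.1 ^ 2) ^ (-((σ₁ - η 2) / 2)) *
    (Real.pi ^ 2) ^ (-σ) with hD
  have hD0 : 0 < D := by positivity
  -- Translating the first variable by τ₀ and reflecting the second in τ₂ makes the gamma arguments
  -- symmetric in i. The second family appears conjugated, which does not affect norms. D collects
  -- the powers of y and π.
  have hfw : ∀ p : ℝ × ℝ, ‖(D : ℂ)⁻¹ * f (p.1 - τ 0, τ 2 - p.2)‖ =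
      mbWeight (fun i => (σ₁ - η i) / 2) (fun i => (σ₂ + η i) / 2) τ ((σ₁ + σ₂) / 2) p.1 p.2 := by
    intro p
    simp only [hf, mbCoeff, hY, norm_mul, norm_inv]
    rw [Complex.norm_cpow_eq_rpow_re_of_pos (by positivity),
      Complex.norm_cpow_eq_rpow_re_of_pos (by positivity),
      Complex.norm_cpow_eq_rpow_re_of_pos (by positivity),
      norm_Gamma_eq_of_eq (a := (σ₁ - η 1) / 2) (b := p.1 - τ 1)
        (z := x + (σ + (p.1 - τ 0 : ℝ) * Complex.I)) (by simp [xre, hσ]; ring)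
        (by simp [xim]),
      norm_Gamma_eq_of_eq_neg (a := (σ₂ + η 1) / 2) (b := p.2 - τ 1)
        (z := z - x + (σ' + (τ 2 - p.2 : ℝ) * Complex.I)) (by simp [xre, zre, hσ']; ring)
        (by simp [xim, zim]),
      norm_Gamma_eq_of_eq (a := (σ₁ + σ₂) / 2) (b := p.1 - p.2)
        (z := z + (σ + (p.1 - τ 0 : ℝ) * Complex.I) + (σ' + (τ 2 - p.2 : ℝ) * Complex.I))
        (by simp [zre, hσ, hσ']; ring) (by simp [zim]),
      norm_Gamma_eq_of_eq (a := (σ₁ - η 2) / 2) (b := p.1 - τ 2)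
        (z := z + (σ + (p.1 - τ 0 : ℝ) * Complex.I)) (by simp [zre, hσ]; ring) (by simp [zim]),
      norm_Gamma_eq_of_eq_neg (a := σ') (b := p.2 - τ 2)
        (z := σ' + (τ 2 - p.2 : ℝ) * Complex.I) (by simp) (by simp),
      norm_Gamma_eq_of_eq_neg (a := (σ₂ + η 0) / 2) (b := p.2 - τ 0)
        (z := z + (σ' + (τ 2 - p.2 : ℝ) * Complex.I)) (by simp [zre, hσ']; ring)
        (by simp [zim])]
    have r1 : (-((σ' : ℂ) + (τ 2 - p.2 : ℝ) * Complex.I)).re = -σ' := by simp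
    have r2 : (-(z + ((σ : ℂ) + (p.1 - τ 0 : ℝ) * Complex.I))).re = -((σ₁ - η 2) / 2) := by
      simp [zre, hσ]; ring
    have r3 : (-((σ : ℂ) + (p.1 - τ 0 : ℝ) * Complex.I)).re = -σ := by simp
    rw [r1, r2, r3, ← hD, Complex.norm_real, Real.norm_of_nonneg hD0.le, mbWeight,
      Fin.prod_univ_three, Fin.prod_univ_three, norm_inv]
    simp only [hσ, hσ']
    field_simp
  have hint : ‖∫ p, f p‖ ≤ D * (C * Real.exp (boundLog (τ ∘ w) ((σ₁ + σ₂) / 2) δ e) *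
      Real.exp (-(Real.pi / 2 * gapSum τ))) := by
    have h := hb _ fun p => (hfw p).le
    rw [integral_const_mul, integral_sub_sub f, norm_mul, norm_inv, Complex.norm_real,
      Real.norm_of_nonneg hD0.le, inv_mul_le_iff₀ hD0] at h
    exact h
  have hDy : y.1 ^ (1 - η 2) * y.2 ^ (1 + η 2) * D = P * (y.1 ^ (1 - σ₁) * y.2 ^ (1 - σ₂)) := by
    have sq : ∀ {r : ℝ}, 0 < r → ∀ s : ℝ, (r ^ 2) ^ s = r ^ (2 * s) := fun hr s => by
      rw [← Real.rpow_natCast, ← Real.rpow_mul hr.le]; norm_num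
    have y1 : y.1 ^ (1 - σ₁) = y.1 ^ (1 - η 2) * y.1 ^ (2 * -((σ₁ - η 2) / 2)) := by
      rw [← Real.rpow_add h1]; ring_nf
    have y2 : y.2 ^ (1 - σ₂) = y.2 ^ (1 + η 2) * y.2 ^ (-(σ₂ + η 2)) := by
      rw [← Real.rpow_add h2]; ring_nf
    rw [hD, Real.mul_rpow (by positivity) (by positivity), sq hp, sq hp, sq h1, sq h2, hP, y1, y2,
      show 2 * -σ' = -(σ₂ + η 2) by rw [hσ']; ring, show 2 * -σ = -(σ₁ - η 0) by rw [hσ]; ring]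
    ring
  have hL : 0 < LambdaPoly μ := Mpoly_pos _ _ _ _
  have e1 : Real.exp (Real.pi / 2 * gapSum τ) * Real.exp (-(Real.pi / 2 * gapSum τ)) = 1 := by
    rw [← Real.exp_add]; simp
  rw [whittakerFormula, hmb]
  simp only [norm_mul, Complex.norm_real]
  rw [Complex.norm_cpow_eq_rpow_re_of_pos h1, Complex.norm_cpow_eq_rpow_re_of_pos h2,
    Complex.sub_re, Complex.add_re, Complex.one_re, hμ, Real.norm_of_nonneg hp.le,
    Real.norm_of_nonneg (Real.sqrt_nonneg _),
    Real.norm_of_nonneg (by positivity : 0 ≤ 1 / (2 * Real.pi))]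
  calc _ ≤ Real.pi * Real.sqrt Real.pi * y.1 ^ (1 - η 2) * y.2 ^ (1 + η 2) *
        (K * ((LambdaPoly μ)⁻¹ * Real.exp (Real.pi / 2 * gapSum τ))) *
        (1 / (2 * Real.pi) * (1 / (2 * Real.pi)) *
        (D * (C * Real.exp (boundLog (τ ∘ w) ((σ₁ + σ₂) / 2) δ e) *
          Real.exp (-(Real.pi / 2 * gapSum τ))))) := by
        gcongr
        exact hg μ hμ
    _ = _ := by
        rw [div_eq_mul_inv (Real.exp _) (LambdaPoly μ)]
        linear_combination (Real.pi * Real.sqrt Real.pi * y.1 ^ (1 - η 2) * y.2 ^ (1 + η 2) * K *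
          (LambdaPoly μ)⁻¹ * (1 / (2 * Real.pi) * (1 / (2 * Real.pi))) * D * C *
          Real.exp (boundLog (τ ∘ w) ((σ₁ + σ₂) / 2) δ e)) * e1 +
          (Real.pi * Real.sqrt Real.pi * K *
          (LambdaPoly μ)⁻¹ * (1 / (2 * Real.pi) * (1 / (2 * Real.pi))) * C *
          Real.exp (boundLog (τ ∘ w) ((σ₁ + σ₂) / 2) δ e)) * hDy

theorem deltaExp_le (s₁ s₂ : ℝ) (μ : Fin 3 → ℂ) (i : Fin 3) :
    deltaExp s₁ s₂ μ ≤ (2 * s₁ + (μ i).re) / 2 ∧ deltaExp s₁ s₂ μ ≤ (s₁ - (μ i).re) / 2 ∧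
      deltaExp s₁ s₂ μ ≤ (2 * s₂ - (μ i).re) / 2 ∧ deltaExp s₁ s₂ μ ≤ (s₂ + (μ i).re) / 2 := by
  rw [deltaExp]
  have h := Finset.inf'_le (fun i : Fin 3 =>
    min (min ((2 * s₁ + (μ i).re) / 2) ((s₁ - (μ i).re) / 2))
      (min ((2 * s₂ - (μ i).re) / 2) ((s₂ + (μ i).re) / 2))) (Finset.mem_univ i)
  simpa only [le_min_iff, and_assoc] using h

theorem deltaExp_congr {s₁ s₂ : ℝ} {μ ν : Fin 3 → ℂ} (h : ∀ i, (μ i).re = (ν i).re) :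
    deltaExp s₁ s₂ μ = deltaExp s₁ s₂ ν := by
  simp only [deltaExp, h]

/-- Since the real parts sum to zero, αᵢ + αⱼ = (2σ₁ + Re μₖ)/2 and βᵢ + βⱼ = (2σ₂ - Re μₖ)/2 with k
the third index, which are terms of the minimum defining δ. Averaging two of its terms in which Re
μᵢ cancels gives the bound by g + 1/2. Moving sⱼ by at most e costs at most e in δ. -/
theorem exponents_of_shift {s₁ s₂ e θ₁ θ₂ : ℝ} {μ : Fin 3 → ℂ}
    (hμ : (μ 0).re + (μ 1).re + (μ 2).re = 0) (h₁ : ∀ i, e < s₁ - (μ i).re)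
    (h₂ : ∀ i, e < s₂ + (μ i).re) (hθ₁ : |θ₁| ≤ e) (hθ₂ : |θ₂| ≤ e) :
    Exponents (fun i => (s₁ + θ₁ - (μ i).re) / 2) (fun i => (s₂ + θ₂ + (μ i).re) / 2)
      ((s₁ + θ₁ + (s₂ + θ₂)) / 2) (deltaExp s₁ s₂ μ - e) := by
  obtain ⟨l₁, -⟩ := abs_le.1 hθ₁
  obtain ⟨l₂, -⟩ := abs_le.1 hθ₂
  have d := deltaExp_le s₁ s₂ μ
  obtain ⟨d0, d0', d0'', d0'''⟩ := d 0
  obtain ⟨d1, -, d1', -⟩ := d 1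
  obtain ⟨d2, -, d2', -⟩ := d 2
  have p₁ := h₁ 0
  have p₂ := h₂ 0
  have he : 0 ≤ e := (abs_nonneg _).trans hθ₁
  refine ⟨fun i => by linarith [h₁ i], fun i => by linarith [h₂ i], fun i => by ring, ?_, ?_,
    by linarith⟩
  · intro i j hij
    fin_cases i <;> fin_cases j <;> simp at hij ⊢ <;> linarith
  · intro i j hij
    fin_cases i <;> fin_cases j <;> simp at hij ⊢ <;> linarith

/-- The larger-gap exponent loses at most 2e from 2g, e from δ and 2e from the integrable weights.
The total 5e fits into 2ε when 4e ≤ ε. -/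
theorem norm_whittakerFormula_le_Msym {s₁ s₂ e ε θ₁ θ₂ : ℝ} {η : Fin 3 → ℝ} (he : 0 < e)
    (heε : 4 * e ≤ ε) (hη : η 0 + η 1 + η 2 = 0) (h₁ : ∀ i, e < s₁ - η i)
    (h₂ : ∀ i, e < s₂ + η i) (hθ₁ : |θ₁| ≤ e) (hθ₂ : |θ₂| ≤ e) :
    ∃ C : ℝ, 0 < C ∧ ∀ μ : Fin 3 → ℂ, (∀ i, (μ i).re = η i) → ∀ y : ℝ × ℝ, 0 < y.1 → 0 < y.2 →
      ‖whittakerFormula y μ‖ ≤ C * (y.1 ^ (1 - (s₁ + θ₁)) * y.2 ^ (1 - (s₂ + θ₂))) *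
        (Msym ε (s₁ + s₂ - 1 / 2) (deltaExp s₁ s₂ μ) μ / LambdaPoly μ) := by
  set δ := deltaExp s₁ s₂ (fun i => (η i : ℂ)) with hδ
  have H := exponents_of_shift (μ := fun i => (η i : ℂ)) (by simpa using hη) (by simpa using h₁)
    (by simpa using h₂) hθ₁ hθ₂
  simp only [Complex.ofReal_re, ← hδ] at H
  obtain ⟨A, hA, hA'⟩ := norm_whittakerFormula_le he H
  obtain ⟨B, hB, hB'⟩ := exp_boundLog_le_Msym (g := (s₁ + θ₁ + (s₂ + θ₂)) / 2) (δ₀ := δ - e)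
    (δ := δ) (e := e) (κ := s₁ + s₂ - 1 / 2) (ε := ε)
    (by linarith [(abs_le.1 hθ₁).2, (abs_le.1 hθ₂).2]) (by linarith)
  refine ⟨A * B, by positivity, fun μ hμ y h1 h2 => ?_⟩
  obtain ⟨w, w1, w2, hw⟩ := hA' μ hμ
  have hL : 0 < LambdaPoly μ := Mpoly_pos _ _ _ _
  rw [deltaExp_congr (ν := fun i => (η i : ℂ)) (by simpa using hμ), ← hδ]
  calc _ ≤ _ := hw y h1 h2
    _ ≤ A * (y.1 ^ (1 - (s₁ + θ₁)) * y.2 ^ (1 - (s₂ + θ₂))) *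
        (B * Msym ε (s₁ + s₂ - 1 / 2) δ μ / LambdaPoly μ) := by
        gcongr
        exact hB' μ w w1 w2
    _ = _ := by ring

/-! ### Integration over the torus. -/

/-- The function equal to `t ^ (e - 1)` on `(0, 1]` and to `t ^ (-e - 1)` on `(1, ∞)`. -/
def splitPower (e t : ℝ) : ℝ := if t ≤ 1 then t ^ (e - 1) else t ^ (-e - 1)

theorem integrableOn_splitPower {e : ℝ} (he : 0 < e) :
    IntegrableOn (splitPower e) (Set.Ioi 0) := by
  rw [← Set.Ioc_union_Ioi_eq_Ioi zero_le_one]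
  refine IntegrableOn.union ?_ ?_
  · refine IntegrableOn.congr_fun (f := fun t : ℝ => t ^ (e - 1)) ?_
      (fun t ht => by simp [splitPower, ht.2]) measurableSet_Ioc
    exact (intervalIntegrable_iff_integrableOn_Ioc_of_le zero_le_one).1
      (intervalIntegral.intervalIntegrable_rpow' (by linarith))
  · refine IntegrableOn.congr_fun (f := fun t : ℝ => t ^ (-e - 1)) ?_
      (fun t ht => by simp [splitPower, not_le.2 (Set.mem_Ioi.1 ht)]) measurableSet_Ioi
    exact integrableOn_Ioi_rpow_of_lt (by linarith) zero_lt_one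

theorem splitPower_eq (e t : ℝ) :
    ∃ θ : ℝ, (θ = e ∨ θ = -e) ∧ splitPower e t = t ^ (-θ - 1) := by
  unfold splitPower
  split_ifs
  · exact ⟨-e, Or.inr rfl, by rw [neg_neg]⟩
  · exact ⟨e, Or.inl rfl, rfl⟩

/-- With σⱼ = sⱼ + θ the powers of yⱼ, including the density, combine to yⱼ^(-θ-1). Choosing θ = ±e
separately in the two variables gives four pointwise bounds, and the constant is the sum of theirs.
-/
theorem norm_whittakerFormula_le_splitPower {s₁ s₂ e ε : ℝ} {η : Fin 3 → ℝ} (he : 0 < e)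
    (heε : 4 * e ≤ ε) (hη : η 0 + η 1 + η 2 = 0) (h₁ : ∀ i, e < s₁ - η i)
    (h₂ : ∀ i, e < s₂ + η i) :
    ∃ C : ℝ, ∀ μ : Fin 3 → ℂ, (∀ i, (μ i).re = η i) → ∀ y : ℝ × ℝ, 0 < y.1 → 0 < y.2 →
      1 / (y.1 * y.2) ^ 3 * (‖whittakerFormula y μ‖ * y.1 ^ (s₁ + 1) * y.2 ^ (s₂ + 1)) ≤
        C * (Msym ε (s₁ + s₂ - 1 / 2) (deltaExp s₁ s₂ μ) μ / LambdaPoly μ) *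
          (splitPower e y.1 * splitPower e y.2) := by
  have ae : |e| ≤ e := (abs_of_pos he).le
  have ae' : |-e| ≤ e := by rw [abs_neg]; exact ae
  obtain ⟨C₁, p₁, b₁⟩ := norm_whittakerFormula_le_Msym he heε hη h₁ h₂ ae ae
  obtain ⟨C₂, p₂, b₂⟩ := norm_whittakerFormula_le_Msym he heε hη h₁ h₂ ae ae'
  obtain ⟨C₃, p₃, b₃⟩ := norm_whittakerFormula_le_Msym he heε hη h₁ h₂ ae' ae
  obtain ⟨C₄, p₄, b₄⟩ := norm_whittakerFormula_le_Msym he heε hη h₁ h₂ ae' ae'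
  refine ⟨C₁ + C₂ + C₃ + C₄, fun μ hμ y h1 h2 => ?_⟩
  have hM : 0 ≤ Msym ε (s₁ + s₂ - 1 / 2) (deltaExp s₁ s₂ μ) μ / LambdaPoly μ :=
    div_nonneg (Finset.sum_nonneg fun w _ => (Mpoly_pos _ _ _ _).le) (Mpoly_pos _ _ _ _).le
  set M := Msym ε (s₁ + s₂ - 1 / 2) (deltaExp s₁ s₂ μ) μ / LambdaPoly μ with hMdef
  have step : ∀ {c θ θ' : ℝ}, c ≤ C₁ + C₂ + C₃ + C₄ →
      ‖whittakerFormula y μ‖ ≤ c * (y.1 ^ (1 - (s₁ + θ)) * y.2 ^ (1 - (s₂ + θ'))) * M →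
      1 / (y.1 * y.2) ^ 3 * (‖whittakerFormula y μ‖ * y.1 ^ (s₁ + 1) * y.2 ^ (s₂ + 1)) ≤
        (C₁ + C₂ + C₃ + C₄) * M * (y.1 ^ (-θ - 1) * y.2 ^ (-θ' - 1)) := by
    intro c θ θ' hc hW
    have e1 : y.1 ^ (-θ - 1) = (y.1 ^ 3)⁻¹ * (y.1 ^ (1 - (s₁ + θ)) * y.1 ^ (s₁ + 1)) := by
      rw [← Real.rpow_natCast y.1 3, ← Real.rpow_neg h1.le, ← Real.rpow_add h1,
        ← Real.rpow_add h1]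
      push_cast; ring_nf
    have e2 : y.2 ^ (-θ' - 1) = (y.2 ^ 3)⁻¹ * (y.2 ^ (1 - (s₂ + θ')) * y.2 ^ (s₂ + 1)) := by
      rw [← Real.rpow_natCast y.2 3, ← Real.rpow_neg h2.le, ← Real.rpow_add h2,
        ← Real.rpow_add h2]
      push_cast; ring_nf
    rw [e1, e2]
    calc _ ≤ 1 / (y.1 * y.2) ^ 3 * (((C₁ + C₂ + C₃ + C₄) *
          (y.1 ^ (1 - (s₁ + θ)) * y.2 ^ (1 - (s₂ + θ'))) * M) * y.1 ^ (s₁ + 1) *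
            y.2 ^ (s₂ + 1)) := by
          gcongr
          exact hW.trans (by gcongr)
      _ = _ := by rw [mul_pow]; field_simp
  obtain ⟨θ, hθ, eθ⟩ := splitPower_eq e y.1
  obtain ⟨θ', hθ', eθ'⟩ := splitPower_eq e y.2
  rw [eθ, eθ']
  rcases hθ with rfl | rfl <;> rcases hθ' with rfl | rfl
  · exact step (by linarith) (b₁ μ hμ y h1 h2)
  · exact step (by linarith) (b₂ μ hμ y h1 h2)
  · exact step (by linarith) (b₃ μ hμ y h1 h2)
  · exact step (by linarith) (b₄ μ hμ y h1 h2)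

theorem measurable_whittakerFormula (μ : Fin 3 → ℂ) :
    Measurable fun y : ℝ × ℝ => whittakerFormula y μ := by
  have h : Measurable fun y : ℝ × ℝ => tripleInt (y.1 ^ 2, Real.pi ^ 2 * y.2 ^ 2, Real.pi ^ 2)
      ((μ 0 - μ 1) / 2) ((μ 0 - μ 2) / 2) :=
    (stronglyMeasurable_tripleInt _ _).measurable.comp
      (g := fun y : ℝ × ℝ × ℝ => tripleInt y ((μ 0 - μ 1) / 2) ((μ 0 - μ 2) / 2))
      (f := fun y : ℝ × ℝ => (y.1 ^ 2, Real.pi ^ 2 * y.2 ^ 2, Real.pi ^ 2)) (by fun_prop)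
  unfold whittakerFormula
  exact Measurable.mul (by fun_prop) h

theorem exists_pos_lt_sub {f : Fin 3 → ℝ} (hf : ∀ i, 0 < f i) : ∃ d, 0 < d ∧ ∀ i, d < f i :=
  ⟨min (f 0) (min (f 1) (f 2)) / 2, by simp [hf], fun i => by
    have h : 0 < min (f 0) (min (f 1) (f 2)) := by simp [hf]
    have h' : min (f 0) (min (f 1) (f 2)) ≤ f i := by fin_cases i <;> simp
    linarith⟩

theorem integral_measY {f : ℝ × ℝ → ℝ} : (Integrable f measY ↔ Integrable
      (fun y : ℝ × ℝ => (ENNReal.ofReal (1 / (y.1 * y.2) ^ 3)).toReal * f y)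
        (volume.restrict (Set.Ioi 0 ×ˢ Set.Ioi 0))) ∧
    ∫ y, f y ∂measY = ∫ y in Set.Ioi 0 ×ˢ Set.Ioi 0,
      (ENNReal.ofReal (1 / (y.1 * y.2) ^ 3)).toReal * f y := by
  have hm : Measurable fun y : ℝ × ℝ => ENNReal.ofReal (1 / (y.1 * y.2) ^ 3) := by fun_prop
  have hlt : ∀ᵐ y ∂(volume.restrict (Set.Ioi 0 ×ˢ Set.Ioi 0) : Measure (ℝ × ℝ)),
      ENNReal.ofReal (1 / (y.1 * y.2) ^ 3) < ⊤ := Eventually.of_forall fun _ => ENNReal.ofReal_lt_top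
  exact ⟨integrable_withDensity_iff_integrable_smul' hm hlt,
    integral_withDensity_eq_integral_toReal_smul hm hlt f⟩

end SL3

end

theorem mainTheorem8 (s₁ s₂ : ℝ) (η : Fin 3 → ℝ)
    (hs₁ : ∀ i, 0 < s₁ - η i) (hs₂ : ∀ i, 0 < s₂ + η i) (ε : ℝ) (hε : 0 < ε) :
    ∃ C : ℝ, ∀ μ : Fin 3 → ℂ, μ 0 + μ 1 + μ 2 = 0 → (∀ i, (μ i).re = η i) →
      MeasureTheory.Integrable (fun t : ℝ × ℝ =>
        ‖SL3.whittaker (SL3.torus t) μ (1, 1)‖ * t.1 ^ (s₁ + 1) * t.2 ^ (s₂ + 1)) SL3.measY ∧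
      ∫ t : ℝ × ℝ, ‖SL3.whittaker (SL3.torus t) μ (1, 1)‖ * t.1 ^ (s₁ + 1) * t.2 ^ (s₂ + 1)
          ∂SL3.measY
        ≤ C * (SL3.Msym ε (s₁ + s₂ - 1 / 2) (SL3.deltaExp s₁ s₂ μ) μ / SL3.LambdaPoly μ) := by
  open SL3 in
  -- If the prescribed real parts do not sum to zero, no μ qualifies and any constant works.
  by_cases hη : η 0 + η 1 + η 2 = 0
  swap
  · refine ⟨0, fun μ h0 hμ => absurd ?_ hη⟩
    rw [← hμ, ← hμ, ← hμ, ← Complex.add_re, ← Complex.add_re, h0, Complex.zero_re]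
  obtain ⟨d₁, hd₁, hd₁'⟩ := exists_pos_lt_sub hs₁
  obtain ⟨d₂, hd₂, hd₂'⟩ := exists_pos_lt_sub hs₂
  -- The shift e stays below every margin sⱼ ∓ Re μᵢ, so all four contour choices remain admissible,
  -- and below ε/4 so that the losses fit into ε.
  set e := min (ε / 4) (min d₁ d₂) with he
  have he0 : 0 < e := by simp [he, hε, hd₁, hd₂]
  have heε : e ≤ ε / 4 := min_le_left _ _
  have he1 : e ≤ d₁ := (min_le_right _ _).trans (min_le_left _ _)
  have he2 : e ≤ d₂ := (min_le_right _ _).trans (min_le_right _ _)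
  obtain ⟨C, hC⟩ := norm_whittakerFormula_le_splitPower (ε := ε) he0 (by linarith) hη
    (fun i => he1.trans_lt (hd₁' i)) (fun i => he2.trans_lt (hd₂' i))
  set Q : Set (ℝ × ℝ) := Set.Ioi 0 ×ˢ Set.Ioi 0 with hQ
  have hQm : MeasurableSet Q := measurableSet_Ioi.prod measurableSet_Ioi
  have hQv : (volume.restrict Q : Measure (ℝ × ℝ)) =
      (volume.restrict (Set.Ioi 0)).prod (volume.restrict (Set.Ioi 0)) := by
    rw [Measure.prod_restrict, ← Measure.volume_eq_prod]
  have hI := integrableOn_splitPower he0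
  refine ⟨C * ((∫ t in Set.Ioi 0, splitPower e t) * ∫ t in Set.Ioi 0, splitPower e t),
    fun μ h0 hμ => ?_⟩
  set M := Msym ε (s₁ + s₂ - 1 / 2) (deltaExp s₁ s₂ μ) μ / LambdaPoly μ with hM
  have hdom : Integrable (fun y : ℝ × ℝ => C * M * (splitPower e y.1 * splitPower e y.2))
      (volume.restrict Q) := by
    rw [hQv]
    exact (hI.mul_prod hI).const_mul _
  have hcongr : (fun y : ℝ × ℝ => 1 / (y.1 * y.2) ^ 3 * (‖whittakerFormula y μ‖ * y.1 ^ (s₁ + 1) *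
      y.2 ^ (s₂ + 1))) =ᵐ[volume.restrict Q] fun y => (ENNReal.ofReal (1 / (y.1 * y.2) ^ 3)).toReal *
        (‖whittaker (torus y) μ (1, 1)‖ * y.1 ^ (s₁ + 1) * y.2 ^ (s₂ + 1)) := by
    filter_upwards [ae_restrict_mem hQm] with y hy
    have h1 : 0 < y.1 := hy.1
    have h2 : 0 < y.2 := hy.2
    rw [whittaker_eq h1 h2 h0, ENNReal.toReal_ofReal (by positivity)]
  have hle : ∀ᵐ y ∂(volume.restrict Q : Measure (ℝ × ℝ)), 1 / (y.1 * y.2) ^ 3 *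
      (‖whittakerFormula y μ‖ * y.1 ^ (s₁ + 1) * y.2 ^ (s₂ + 1)) ≤
        C * M * (splitPower e y.1 * splitPower e y.2) := by
    filter_upwards [ae_restrict_mem hQm] with y hy
    exact hC μ hμ y hy.1 hy.2
  have hint : Integrable (fun y : ℝ × ℝ => 1 / (y.1 * y.2) ^ 3 * (‖whittakerFormula y μ‖ *
      y.1 ^ (s₁ + 1) * y.2 ^ (s₂ + 1))) (volume.restrict Q) := by
    have hW := (measurable_whittakerFormula μ).norm
    refine hdom.mono' (Measurable.aestronglyMeasurable (by fun_prop)) ?_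
    filter_upwards [hle, ae_restrict_mem hQm] with y hy hyQ
    have h1 : 0 < y.1 := hyQ.1
    have h2 : 0 < y.2 := hyQ.2
    rwa [Real.norm_of_nonneg (by positivity)]
  refine ⟨integral_measY.1.2 (hint.congr hcongr), ?_⟩
  rw [integral_measY.2, ← integral_congr_ae hcongr]
  refine (integral_mono_ae hint hdom hle).trans_eq ?_
  rw [integral_const_mul, hQv, integral_prod_mul]
  ring
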